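/- Let $\Sigma$ be a closed (compact, connected, smooth, without boundary) oriented surface and let $D$ be an oriented knot diagram on $\Sigma$, i.e. a smoothly immersed closed curve whose only multiple points are finitely many transverse double points (the crossings), with over/under information at each of them. For homology classes $a,b\in H_1(\Sigma,\mathbb Z)$ let $a\cdot b$ be the algebraic intersection number: the signed number of intersection points of transverse closed curves $\alpha,\beta$ representing $a,b$, where an intersection point is positive if the velocities of $\alpha$ and $\beta$, in this order, form a positive basis of the tangent plane, and negative otherwise. Let $\gamma$ be an oriented smooth closed curve on $\Sigma$ that meets $D$ transversally, and suppose that $[\gamma]\cdot[D]=0$. The intersection points with $\gamma$ divide $D$ into parts. Color each part by an integer so that, when one walks along $D$ according to its orientation, the integer increases by one at each positive, and decreases by one at each negative intersection point of $\gamma$ and $D$ (the sign being that of the velocities of $\gamma$ and $D$, in this order). Such a coloring exists and is unique up to adding a constant. For a crossing $c$ of $D$ not on $\gamma$, let $f_\gamma(c)$ be the integer on the over-arc at $c$ minus the integer on the under-arc at $c$. Let the writhe $w(c)$ be $+1$ if the velocities of the over-strand and of the under-strand at $c$, in this order, form a positive basis of the tangent plane, and $-1$ otherwise. Smoothing $c$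 according to the orientation cuts $D$ into two closed curves. Let $u,v$ be the velocities of the two strands of $D$ at $c$, ordered so that $(u,v)$ is a positive basis. Denote by $D_c^r$ the curve that arrives at $c$ with velocity $u$ and leaves with velocity $v$ (it has the smoothed crossing on its right-hand side), and by $D_c^l$ the curve that arrives with velocity $v$ and leaves with velocity $u$ (it has the smoothed crossing on its left-hand side). Then $$f_\gamma(c)=\begin{cases}[\gamma]\cdot[D_c^r] & \text{if } w(c)=+1,\\ [\gamma]\cdot[D_c^l] & \text{if } w(c)=-1.\end{cases}$$ -/

import Mathlib

open scoped Manifold ContDiff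

namespace SurfaceKnot

universe u

/-! ### Oriented surfaces -/

/-- An orientation of a surface, given by an oriented atlas: all the coordinate changes between
charts of the atlas have positive Jacobian determinant. The orientation of the tangent plane at `x`
is the one for which the preferred chart `chartAt _ x` preserves orientation. -/
class OrientedAtlas (S : Type u) [TopologicalSpace S]
    [ChartedSpace (EuclideanSpace ℝ (Fin 2)) S] : Prop where
  det_pos : ∀ e ∈ atlas (EuclideanSpace ℝ (Fin 2)) S, ∀ e' ∈ atlas (EuclideanSpace ℝ (Fin 2)) S,
    ∀ x ∈ e.source ∩ e'.source, 0 < (fderiv ℝ (e' ∘ e.symm) (e x)).det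

/-- For two tangent vectors `v`, `w` at the same point `x`, expressed in the preferred chart at `x`
(this is how Mathlib represents tangent vectors): `1` if `(v, w)` is a positively oriented basis of
the tangent plane, `-1` if it is a negatively oriented basis, `0` if it is not a basis. -/
noncomputable def orientationSign (v w : EuclideanSpace ℝ (Fin 2)) : ℤ :=
  SignType.sign (v 0 * w 1 - v 1 * w 0)

/-! ### Loops and their classes in singular homology -/

section Homology

open scoped Simplicial
open CategoryTheory

variable (X : Type u) [TopologicalSpace X]

/-- The group `H₁(X, ℤ)`: Mathlib's singular homology with integer coefficients. -/
noncomputable abbrev H1 : AddCommGrpCat.{u} :=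
  ((AlgebraicTopology.singularHomologyFunctor AddCommGrpCat.{u} 1).obj
    (AddCommGrpCat.of (ULift.{u} ℤ))).obj (TopCat.of X)

/-- A continuous closed path, parametrized by the unit interval. -/
structure Loop where
  toMap : C(unitInterval, X)
  closed : toMap 0 = toMap 1

variable {X}

/-- A loop as a singular `1`-simplex; it runs from vertex `0` to vertex `1`. -/
noncomputable def Loop.simplex (p : Loop X) : (TopCat.toSSet.obj (TopCat.of X)) _⦋1⦌ :=
  (TopCat.toSSetObjEquiv (TopCat.of X) (Opposite.op ⦋1⦌)).symm
    ⟨fun x => p.toMap ⟨x.1 1, x.2.1 1, by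
        have h := x.2.2
        have h0 := x.2.1 0
        simp only [SimplexCategory.len_mk] at h h0 ⊢
        change ∑ i : Fin 2, x.1 i = 1 at h
        rw [Fin.sum_univ_two] at h
        change (0 : ℝ) ≤ x.1 (0 : Fin 2) at h0
        change x.1 (1 : Fin 2) ≤ 1
        linarith⟩,
      p.toMap.continuous.comp (Continuous.subtype_mk
        ((continuous_apply _).comp continuous_subtype_val) _)⟩

/-- Both vertices of the simplex of a loop are its base point. -/
theorem Loop.simplex_vertex (p : Loop X) (i : Fin 2) (y : stdSimplex ℝ (Fin 1)) :
    (TopCat.toSSetObjEquiv (TopCat.of X) (Opposite.op ⦋0⦌))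
      ((TopCat.toSSet.obj (TopCat.of X)).δ i p.simplex) y = p.toMap 0 := by
  have key : ∃ z : stdSimplex ℝ (Fin 2), z = stdSimplex.map (SimplexCategory.δ i) y ∧
      (TopCat.toSSetObjEquiv (TopCat.of X) (Opposite.op ⦋0⦌))
        ((TopCat.toSSet.obj (TopCat.of X)).δ i p.simplex) y =
      (TopCat.toSSetObjEquiv (TopCat.of X) (Opposite.op ⦋1⦌)) p.simplex z :=
    ⟨_, rfl, rfl⟩
  obtain ⟨z, hz, h⟩ := key
  have hy : y = stdSimplex.vertex 0 := Subsingleton.elim _ _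
  have hv : z = stdSimplex.vertex (SimplexCategory.δ i (0 : Fin 1)) := by
    rw [hz, hy, stdSimplex.map_vertex]
  have happ : ∀ w : stdSimplex ℝ (Fin 2), ∀ t : unitInterval, w.1 1 = t.1 →
      (TopCat.toSSetObjEquiv (TopCat.of X) (Opposite.op ⦋1⦌)) p.simplex w = p.toMap t := by
    intro w t hwt
    rw [Loop.simplex, Equiv.apply_symm_apply]
    exact congrArg p.toMap (Subtype.ext hwt)
  rw [h]
  fin_cases i
  · have hv' : z = stdSimplex.vertex (1 : Fin 2) := hv
    refine (happ z 1 ?_).trans p.closed.symm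
    rw [hv']; simp
  · have hv' : z = stdSimplex.vertex (0 : Fin 2) := hv
    refine happ z 0 ?_
    rw [hv']; simp

/-- The simplex of a loop is a singular cycle. -/
theorem Loop.simplex_isCycle (p : Loop X) :
    (TopCat.toSSet.obj (TopCat.of X)).ιChainComplex
        (R := AddCommGrpCat.of (ULift.{u} ℤ)) p.simplex ≫
      ((TopCat.toSSet.obj (TopCat.of X)).chainComplex _).d 1 0 = 0 := by
  have h : (TopCat.toSSet.obj (TopCat.of X)).δ 0 p.simplex =
      (TopCat.toSSet.obj (TopCat.of X)).δ 1 p.simplex := by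
    apply (TopCat.toSSetObjEquiv (TopCat.of X) (Opposite.op ⦋0⦌)).injective
    ext y
    exact (p.simplex_vertex 0 y).trans (p.simplex_vertex 1 y).symm
  rw [SSet.ιChainComplex_d, Fin.sum_univ_two, h]
  simp

/-- The class in `H₁(X, ℤ)` of the `1`-cycle given by a loop. -/
noncomputable def Loop.homologyClass (p : Loop X) : H1 X :=
  (HomologicalComplex.liftCycles ((TopCat.toSSet.obj (TopCat.of X)).chainComplex
      (AddCommGrpCat.of (ULift.{u} ℤ))) ((TopCat.toSSet.obj (TopCat.of X)).ιChainComplex p.simplex)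
      0 (by simp)
      p.simplex_isCycle ≫
    HomologicalComplex.homologyπ _ 1) (ULift.up (1 : ℤ))

end Homology

variable (S : Type u) [TopologicalSpace S] [ChartedSpace (EuclideanSpace ℝ (Fin 2)) S]

/-! ### Closed curves and the intersection number -/

/-- An oriented smooth closed curve on a surface, as a smooth map `ℝ → S` of period `1`. It may have
self-intersections and points of zero velocity. -/
structure ClosedCurve where
  toFun : ℝ → S
  smooth : ContMDiff 𝓘(ℝ, ℝ) (𝓡 2) ∞ toFun
  periodic : Function.Periodic toFun 1

variable {S}

instance : CoeFun (ClosedCurve S) (fun _ => ℝ → S) := ⟨ClosedCurve.toFun⟩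

namespace ClosedCurve

/-- The velocity vector at time `t`, in the preferred chart at the point `α t`. -/
noncomputable def velocity (α : ClosedCurve S) (t : ℝ) : EuclideanSpace ℝ (Fin 2) :=
  (mfderiv 𝓘(ℝ, ℝ) (𝓡 2) α.toFun t : ℝ →L[ℝ] EuclideanSpace ℝ (Fin 2)) 1

/-- The piece of a closed curve between two times at which it is at the same point, as a loop. -/
noncomputable def restrict (α : ClosedCurve S) (a b : ℝ) (h : α a = α b) : Loop S where
  toMap := ⟨fun x => α (a + (b - a) * x), α.smooth.continuous.comp (by fun_prop)⟩
  closed := by simpa using h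

/-- The class `[α]` in `H₁(S, ℤ)`. -/
noncomputable def homologyClass (α : ClosedCurve S) : H1 S :=
  (α.restrict 0 1 (by simpa using (α.periodic 0).symm)).homologyClass

/-- Whenever the two curves are at the same point, their velocities span the tangent plane. -/
def Transverse (α β : ClosedCurve S) : Prop :=
  ∀ s t : ℝ, α s = β t → LinearIndependent ℝ ![α.velocity s, β.velocity t]

/-- The signed number of intersections of `α` with `β` that `β` meets at times in `T`; an
intersection is positive if the velocities of `α` and `β`, in this order, are a positive basis of
the tangent plane. (For transverse curves and bounded `T` this is a finite sum.) -/
noncomputable def signedCount (α β : ClosedCurve S) (T : Set ℝ) : ℤ :=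
  ∑ᶠ p ∈ {p : ℝ × ℝ | p.1 ∈ Set.Ico (0 : ℝ) 1 ∧ p.2 ∈ T ∧ α p.1 = β p.2},
    orientationSign (α.velocity p.1) (β.velocity p.2)

end ClosedCurve

/-- `n` is the signed number of intersection points of some transverse closed curves representing
the homology classes `a` and `b`. -/
def IsIntersectionNumber (a b : H1 S) (n : ℤ) : Prop :=
  ∃ α β : ClosedCurve S, α.homologyClass = a ∧ β.homologyClass = b ∧ α.Transverse β ∧
    α.signedCount β (Set.Ico 0 1) = n

open Classical in
/-- The algebraic intersection number `a · b` of homology classes of a closed oriented surface: the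
signed number of intersection points of transverse closed curves representing `a` and `b` (classically
it does not depend on the curves). -/
noncomputable def intersectionNumber (a b : H1 S) : ℤ :=
  if h : ∃ n, IsIntersectionNumber a b n then h.choose else 0

/-! ### Knot diagrams, colorings and the chord index -/

variable (S)

/-- An oriented knot diagram: an immersed closed curve whose only multiple points are transverse
double points, together with the choice, at each double point, of the strand that passes over. -/
structure KnotDiagram extends ClosedCurve S where
  immersed : ∀ t, toClosedCurve.velocity t ≠ 0
  transverse_double : ∀ s ∈ Set.Ico (0 : ℝ) 1, ∀ t ∈ Set.Ico (0 : ℝ) 1, s ≠ t →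
    toFun s = toFun t →
      LinearIndependent ℝ ![toClosedCurve.velocity s, toClosedCurve.velocity t]
  no_triple : ∀ r ∈ Set.Ico (0 : ℝ) 1, ∀ s ∈ Set.Ico (0 : ℝ) 1, ∀ t ∈ Set.Ico (0 : ℝ) 1,
    toFun r = toFun s → toFun s = toFun t → r = s ∨ s = t ∨ r = t
  /-- the times at which the diagram runs through a crossing on the over-strand -/
  overTimes : Set ℝ
  over_xor : ∀ s ∈ Set.Ico (0 : ℝ) 1, ∀ t ∈ Set.Ico (0 : ℝ) 1, s ≠ t → toFun s = toFun t →
    Xor (s ∈ overTimes) (t ∈ overTimes)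

variable {S}

instance : CoeFun (KnotDiagram S) (fun _ => ℝ → S) := ⟨fun D => D.toFun⟩

/-- A crossing point, given by the times in `[0, 1)` of its over- and of its under-passage. -/
structure KnotDiagram.Crossing (D : KnotDiagram S) where
  overTime : ℝ
  underTime : ℝ
  overTime_mem : overTime ∈ Set.Ico (0 : ℝ) 1
  underTime_mem : underTime ∈ Set.Ico (0 : ℝ) 1
  ne : overTime ≠ underTime
  meet : D overTime = D underTime
  isOver : overTime ∈ D.overTimes

/-- A coloring of `D` with respect to `γ`: integers on the parts into which the intersection points
with `γ` divide `D`, which increase (decrease) by one whenever `D` runs through a positive (negative)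
intersection point. It is written as a function `col` of the time; its values at times when `D` is
on `γ` are irrelevant. -/
def KnotDiagram.IsColoring (D : KnotDiagram S) (γ : ClosedCurve S) (col : ℝ → ℤ) : Prop :=
  (∀ t, D t ∉ Set.range γ → col (t + 1) = col t) ∧
  ∀ s t, s < t → D s ∉ Set.range γ → D t ∉ Set.range γ →
    col t = col s + γ.signedCount D.toClosedCurve (Set.Ioo s t)

namespace KnotDiagram.Crossing

variable {D : KnotDiagram S} (c : D.Crossing)

open Classical in
/-- The chord index `f_γ(c)`: the integer on the over-arc minus the integer on the under-arc, for a
coloring of `D` with respect to `γ` (any two colorings differ by a constant). -/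
noncomputable def chordIndex (γ : ClosedCurve S) : ℤ :=
  if h : ∃ col, D.IsColoring γ col then h.choose c.overTime - h.choose c.underTime else 0

/-- The writhe `w(c)`: it is `1` if the velocities of the over- and of the under-strand, in this
order, are a positive basis of the tangent plane, and `-1` if they are a negative basis. -/
noncomputable def writhe : ℤ :=
  orientationSign (D.velocity c.overTime) (D.velocity c.underTime)

open Classical in
/-- The two times of the crossing, ordered so that the velocities at the first and at the second time
are a positive basis: if both strands are drawn upwards, the first runs from the bottom left to the
top right, the second from the bottom right to the top left. -/
noncomputable def strands : ℝ × ℝ :=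
  if 0 < orientationSign (D.velocity c.overTime) (D.velocity c.underTime) then (c.overTime, c.underTime)
  else (c.underTime, c.overTime)

theorem meet_strands : D c.strands.1 = D c.strands.2 := by
  unfold strands
  split_ifs
  exacts [c.meet, c.meet.symm]

/-- The first time after `a` at which the diagram is again at the time `b` of its period. -/
noncomputable def nextTime (a b : ℝ) : ℝ :=
  if a < b then b else b + 1

theorem apply_nextTime (D : KnotDiagram S) (a b : ℝ) : D (nextTime a b) = D b := by
  unfold nextTime
  split_ifs
  exacts [rfl, D.periodic b]

/-- The smoothing of `c` according to the orientation cuts the diagram at `c` into two closed curves.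
`smoothRight` is the one that has the smoothed crossing on its right-hand side: it arrives at `c`
along the first strand and turns left to leave along the second one. -/
noncomputable def smoothRight : Loop S :=
  D.restrict c.strands.2 (nextTime c.strands.2 c.strands.1)
    (c.meet_strands.symm.trans (apply_nextTime D _ _).symm)

/-- The other closed curve of the smoothing, which has the smoothed crossing on its left-hand side:
it arrives at `c` along the second strand and turns right to leave along the first one. -/
noncomputable def smoothLeft : Loop S :=
  D.restrict c.strands.1 (nextTime c.strands.1 c.strands.2)
    (c.meet_strands.trans (apply_nextTime D _ _).symm)

end KnotDiagram.Crossing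

end SurfaceKnot

/-!
Both sides of the identity are the signed number of intersection points of `γ` with the piece of
`D` from the under-passage of `c` to its next over-passage. For the chord index this is the
defining property of a coloring (`KnotDiagram.Crossing.chordIndex_eq`). For either value of the
writhe the curve in question, `D_c^r` or `D_c^l`, is the piece of `D` from the under- to the
over-passage, and slowing it down at `c` makes it a smooth closed curve that is transverse to `γ`,
in the same homology class (`ClosedCurve.corner`). Two things remain. A coloring has to exist,
which it does as the signed number of intersection points of `γ` and `D` is zero
(`KnotDiagram.exists_isColoring`). And an intersection number of classes has to be computed from
any pair of transverse representatives: the signed number of intersection points of transverse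
closed curves depends only on their homology classes (`ClosedCurve.Transverse.signedCount_eq`).
This is the main part of the proof.

The invariance is proved with maps to the punctured plane instead of Poincaré duality. Subdivide
`α` into short arcs from `x i` to `x (i + 1)`. In a disc around such an arc there is a function
with a simple pole at `x i` and a simple zero at `x (i + 1)` that is `1` far away (`Disc.lam` is
its logarithm). In the product of these functions zeros and poles cancel, so that up to the
exponential of a function that is continuous off the points `x i` it extends to a continuous map
`g` from the surface to the punctured plane (`exists_continuous_nonvanishing`). Its degree along
`β` is minus the number of crossings (`exists_dual_map`): the sum of the integrals of
`d log (z - w)` over the arcs is a periodic logarithm of the product along `β`, with a jump of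
`±2πi` at each crossing (`exists_logVar_jump`), and the increment of a continuous logarithm
compensates these jumps (`sub_eq_neg_finsum_of_jumps`).

The degree of a fixed `g` factors through `H₁` (`exists_degree_onHomology`), which gives the
invariance in `β`. For the invariance in `α`, the functions `Disc.lam` are a locally additive
function of pairs of points with values in functions modulo `expTrivial S`
(`exists_locallyAdditive_lam`). Such a function can be summed along curves, and the sum along a
closed curve depends only on its class in `H₁` (`LocallyAdditive.exists_onHomology`,
`exists_dual_class`). Hence for homologous curves the quotient of the two maps `g` is the
exponential of a continuous function, and the degrees agree.
-/

namespace SurfaceKnot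

universe u

open Filter Topology Set

/-! ### Primitives of locally additive functions -/

section Primitive

/-- Additivity near the diagonal: `κ x y` behaves locally like a difference `f y - f x`. -/
def LocallyAdditive {X G : Type*} [TopologicalSpace X] [AddCommGroup G] (κ : X → X → G) : Prop :=
  ∀ p, ∃ V ∈ 𝓝 p, ∀ x ∈ V, ∀ y ∈ V, ∀ z ∈ V, κ x y + κ y z = κ x z

/-- `h` is a primitive of `κ` along `σ`: locally, `h` changes by the values of `κ` along `σ`. -/
def IsPrimitive {K X G : Type*} [TopologicalSpace K] [AddCommGroup G] (κ : X → X → G)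
    (σ : K → X) (h : K → G) : Prop :=
  ∀ x, ∀ᶠ y in 𝓝 x, h y - h x = κ (σ x) (σ y)

variable {K L X G : Type*} [TopologicalSpace K] [TopologicalSpace L] [AddCommGroup G]
  {κ : X → X → G}

theorem IsPrimitive.comp {σ : K → X} {h : K → G} (hh : IsPrimitive κ σ h) {φ : L → K}
    (hφ : Continuous φ) : IsPrimitive κ (σ ∘ φ) (h ∘ φ) := fun x =>
  hφ.continuousAt.eventually (hh (φ x))

/-- On a connected space two primitives differ by a constant. -/
theorem IsPrimitive.sub_eq_sub [PreconnectedSpace K] {σ : K → X} {h h' : K → G}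
    (hh : IsPrimitive κ σ h) (hh' : IsPrimitive κ σ h') (x y : K) : h y - h x = h' y - h' x := by
  have hl : IsLocallyConstant (fun x => h x - h' x) := by
    refine (IsLocallyConstant.iff_eventually_eq _).2 fun x => ?_
    filter_upwards [hh x, hh' x] with y hy hy'
    rw [← hy'] at hy
    rw [sub_eq_sub_iff_add_eq_add] at hy ⊢
    rw [add_comm, ← sub_eq_zero] at hy ⊢
    rw [← hy]; abel
  have := hl.apply_eq_of_isPreconnected isPreconnected_univ (mem_univ x) (mem_univ y)
  rw [sub_eq_sub_iff_add_eq_add] at this ⊢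
  rw [← sub_eq_zero] at this ⊢
  rw [← neg_eq_zero, ← this]; abel

/-- A locally additive function has a primitive along every continuous map from a compact convex
set: add up its values along a sufficiently fine subdivision of the segment from a base point. -/
theorem LocallyAdditive.exists_isPrimitive [TopologicalSpace X] {E : Type*}
    [NormedAddCommGroup E] [NormedSpace ℝ E]
    {S : Set E} (hS : IsCompact S) (hc : Convex ℝ S) (hκ : LocallyAdditive κ) {σ : S → X}
    (hσ : Continuous σ) : ∃ h : S → G, IsPrimitive κ σ h := by
  classical
  rcases isEmpty_or_nonempty S with he | ⟨⟨o, ho⟩⟩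
  · exact ⟨fun _ => 0, fun x => he.elim x⟩
  have : CompactSpace S := isCompact_iff_compactSpace.1 hS
  choose V hV hadd using hκ
  obtain ⟨δ, hδ, hleb⟩ := lebesgue_number_lemma_of_metric (s := (univ : Set S))
    (c := fun p : S => σ ⁻¹' interior (V (σ p))) isCompact_univ
    (fun p => isOpen_interior.preimage hσ)
    (fun p _ => mem_iUnion.2 ⟨p, mem_interior_iff_mem_nhds.2 (hV (σ p))⟩)
  -- `κ` is additive on points of the image whose parameters lie in a common ball of radius `δ`
  have key : ∀ a x y z : S, dist x a < δ → dist y a < δ → dist z a < δ →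
      κ (σ x) (σ y) + κ (σ y) (σ z) = κ (σ x) (σ z) := by
    intro a x y z hx hy hz
    obtain ⟨p, hp⟩ := hleb a (mem_univ a)
    exact hadd _ _ (interior_subset (hp hx)) _ (interior_subset (hp hy)) _
      (interior_subset (hp hz))
  obtain ⟨C, hC⟩ := hS.isBounded.subset_closedBall o
  obtain ⟨N, hN⟩ := exists_nat_gt (max C 0 / (δ / 2))
  have hN0 : (0 : ℝ) < N := lt_of_le_of_lt (by positivity) hN
  have hmem : ∀ (x : S) (k : ℕ), o + (min ((k : ℝ) / N) 1) • ((x : E) - o) ∈ S := by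
    intro x k
    have := hc.add_smul_sub_mem ho x.2 (t := min ((k : ℝ) / N) 1)
      ⟨by positivity, min_le_right _ _⟩
    exact this
  let pt : S → ℕ → S := fun x k => ⟨_, hmem x k⟩
  have hxy : ∀ x y k, dist (pt x k) (pt y k) ≤ dist x y := by
    intro x y k
    simp only [pt, Subtype.dist_eq, dist_eq_norm]
    rw [show o + (min ((k : ℝ) / N) 1) • ((x : E) - o) - (o + (min ((k : ℝ) / N) 1) • ((y : E) - o))
      = (min ((k : ℝ) / N) 1) • ((x : E) - y) by module, norm_smul]
    have h1 : ‖min ((k : ℝ) / N) 1‖ ≤ 1 := by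
      rw [Real.norm_of_nonneg (by positivity)]; exact min_le_right _ _
    nlinarith [norm_nonneg ((x : E) - y)]
  have hstep : ∀ x k, dist (pt x (k + 1)) (pt x k) < δ / 2 := by
    intro x k
    simp only [pt, Subtype.dist_eq, dist_eq_norm]
    rw [show o + (min (((k + 1 : ℕ) : ℝ) / N) 1) • ((x : E) - o)
        - (o + (min ((k : ℝ) / N) 1) • ((x : E) - o))
      = (min (((k + 1 : ℕ) : ℝ) / N) 1 - min ((k : ℝ) / N) 1) • ((x : E) - o) by module, norm_smul]
    have h1 : ‖min (((k + 1 : ℕ) : ℝ) / N) 1 - min ((k : ℝ) / N) 1‖ ≤ 1 / N := by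
      have h2 : ((k + 1 : ℕ) : ℝ) / N = (k : ℝ) / N + 1 / N := by push_cast; ring
      have h3 : (0 : ℝ) < 1 / N := by positivity
      rw [Real.norm_eq_abs, abs_le, h2]
      constructor <;> rcases min_cases ((k : ℝ) / N + 1 / N) 1 with h | h <;>
        rcases min_cases ((k : ℝ) / N) 1 with h' | h' <;> linarith [h.1, h.2, h'.1, h'.2]
    have h2 : ‖(x : E) - o‖ ≤ max C 0 := by
      have := hC x.2
      rw [Metric.mem_closedBall, dist_eq_norm] at this
      exact this.trans (le_max_left _ _)
    calc _ ≤ 1 / N * max C 0 := by gcongr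
      _ < δ / 2 := by
        rw [div_lt_iff₀ (by positivity)] at hN
        rw [one_div, inv_mul_lt_iff₀ hN0]
        linarith
  refine ⟨fun x => ∑ k ∈ Finset.range N, κ (σ (pt x k)) (σ (pt x (k + 1))), fun x => ?_⟩
  filter_upwards [Metric.ball_mem_nhds x (half_pos hδ)] with y hy
  rw [Metric.mem_ball] at hy
  -- compare the subdivided segments to `x` and to `y` on each thin quadrilateral
  have hterm : ∀ k, κ (σ (pt y k)) (σ (pt y (k + 1))) - κ (σ (pt x k)) (σ (pt x (k + 1))) =
      κ (σ (pt x (k + 1))) (σ (pt y (k + 1))) - κ (σ (pt x k)) (σ (pt y k)) := by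
    intro k
    have d1 := hxy y x k
    have d2 := hxy y x (k + 1)
    have d3 := hstep x k
    have d4 : dist (pt y (k + 1)) (pt x k) < δ := by
      linarith [dist_triangle (pt y (k + 1)) (pt x (k + 1)) (pt x k)]
    have e1 := key (pt x k) (pt x k) (pt y k) (pt y (k + 1)) (by simpa using hδ) (by linarith) d4
    have e2 := key (pt x k) (pt x k) (pt x (k + 1)) (pt y (k + 1)) (by simpa using hδ)
      (by linarith) d4
    rw [sub_eq_sub_iff_add_eq_add]
    exact (add_comm _ _).trans ((e1.trans e2.symm).trans (add_comm _ _))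
  rw [← Finset.sum_sub_distrib, Finset.sum_congr rfl fun k _ => hterm k,
    Finset.sum_range_sub (fun k => κ (σ (pt x k)) (σ (pt y k)))]
  have h0 : ∀ z, pt z 0 = ⟨o, ho⟩ := fun z => Subtype.ext (by simp [pt])
  have h1 : ∀ z, pt z N = z := fun z => Subtype.ext (by simp [pt, hN0.ne'])
  have h2 := key ⟨o, ho⟩ ⟨o, ho⟩ ⟨o, ho⟩ ⟨o, ho⟩ (by simpa using hδ) (by simpa using hδ)
    (by simpa using hδ)
  simp only [h0, h1]
  rw [add_eq_left.1 h2, sub_zero]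

end Primitive

/-! ### Functions on singular homology -/

section Homology

open scoped Simplicial
open CategoryTheory

variable {X : Type u} [TopologicalSpace X]

/-- The continuous map of a singular simplex. -/
noncomputable def simplexMap {n : ℕ} (x : (TopCat.toSSet.obj (TopCat.of X)) _⦋n⦌) :
    C(stdSimplex ℝ (Fin (n + 1)), X) :=
  TopCat.toSSetObjEquiv (TopCat.of X) (Opposite.op ⦋n⦌) x

theorem simplexMap_δ {n : ℕ} (x : (TopCat.toSSet.obj (TopCat.of X)) _⦋n + 1⦌) (i : Fin (n + 2)) :
    simplexMap ((TopCat.toSSet.obj (TopCat.of X)).δ i x) =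
      (simplexMap x).comp ⟨stdSimplex.map (SimplexCategory.δ i), by continuity⟩ := rfl

theorem simplexMap_injective {n : ℕ} :
    Function.Injective (simplexMap (X := X) (n := n)) :=
  (TopCat.toSSetObjEquiv (TopCat.of X) (Opposite.op ⦋n⦌)).injective

theorem exists_simplexMap_eq {n : ℕ} (f : C(stdSimplex ℝ (Fin (n + 1)), X)) :
    ∃ x : (TopCat.toSSet.obj (TopCat.of X)) _⦋n⦌, simplexMap x = f :=
  (TopCat.toSSetObjEquiv (TopCat.of X) (Opposite.op ⦋n⦌)).surjective f

theorem simplexMap_loop (p : Loop X) (x : stdSimplex ℝ (Fin 2)) (t : unitInterval)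
    (h : x.1 1 = t.1) : simplexMap p.simplex x = p.toMap t := by
  rw [simplexMap, Loop.simplex, Equiv.apply_symm_apply]
  exact congrArg p.toMap (Subtype.ext h)

/-- A locally additive function defines a function on `H₁`, evaluated on the class of a loop by
means of a primitive along the loop. -/
theorem LocallyAdditive.exists_onHomology {G : Type u} [AddCommGroup G] {κ : X → X → G}
    (hκ : LocallyAdditive κ) : ∃ Φ : H1 X → G, ∀ (p : Loop X) (h : unitInterval → G),
      IsPrimitive κ p.toMap h → Φ p.homologyClass = h 1 - h 0 := by
  have hex : ∀ (n : ℕ) (x : (TopCat.toSSet.obj (TopCat.of X)) _⦋n⦌),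
      ∃ h : stdSimplex ℝ (Fin (n + 1)) → G, IsPrimitive κ (simplexMap x) h := fun n x =>
    hκ.exists_isPrimitive (isCompact_stdSimplex ℝ _) (convex_stdSimplex ℝ _)
      (simplexMap x).continuous
  choose h hh using fun x => hex 1 x
  -- the increments of primitives over the edges form a singular cocycle
  let v : Fin 2 → stdSimplex ℝ (Fin 2) := fun i => stdSimplex.vertex i
  let φ : (TopCat.toSSet.obj (TopCat.of X)) _⦋1⦌ → G := fun x => h x (v 1) - h x (v 0)
  have hsum : ∀ x : (TopCat.toSSet.obj (TopCat.of X)) _⦋2⦌,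
      φ ((TopCat.toSSet.obj (TopCat.of X)).δ 0 x) - φ ((TopCat.toSSet.obj (TopCat.of X)).δ 1 x) +
        φ ((TopCat.toSSet.obj (TopCat.of X)).δ 2 x) = 0 := by
    intro x
    obtain ⟨H, hH⟩ := hex 2 x
    have hφ : ∀ i : Fin 3, φ ((TopCat.toSSet.obj (TopCat.of X)).δ i x) =
        H (stdSimplex.vertex (SimplexCategory.δ i (1 : Fin 2))) -
          H (stdSimplex.vertex (SimplexCategory.δ i (0 : Fin 2))) := by
      intro i
      have h1 := hH.comp (L := stdSimplex ℝ (Fin 2))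
        (φ := stdSimplex.map (SimplexCategory.δ i)) (by continuity)
      have h2 := hh ((TopCat.toSSet.obj (TopCat.of X)).δ i x)
      rw [simplexMap_δ] at h2
      have : PreconnectedSpace (stdSimplex ℝ (Fin 2)) :=
        isPreconnected_iff_preconnectedSpace.1 (convex_stdSimplex ℝ (Fin 2)).isPreconnected
      have h3 := IsPrimitive.sub_eq_sub h2 h1 (v 0) (v 1)
      simp only [φ]
      rw [h3]
      simp only [v, Function.comp, stdSimplex.map_vertex]
    rw [hφ, hφ, hφ]
    have e0 : SimplexCategory.δ (0 : Fin 3) (1 : Fin 2) = (2 : Fin 3) := rfl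
    have e1 : SimplexCategory.δ (0 : Fin 3) (0 : Fin 2) = (1 : Fin 3) := rfl
    have e2 : SimplexCategory.δ (1 : Fin 3) (1 : Fin 2) = (2 : Fin 3) := rfl
    have e3 : SimplexCategory.δ (1 : Fin 3) (0 : Fin 2) = (0 : Fin 3) := rfl
    have e4 : SimplexCategory.δ (2 : Fin 3) (1 : Fin 2) = (1 : Fin 3) := rfl
    have e5 : SimplexCategory.δ (2 : Fin 3) (0 : Fin 2) = (0 : Fin 3) := rfl
    rw [e0, e1, e2, e3, e4, e5]
    abel
  let Y := TopCat.toSSet.obj (TopCat.of X)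
  let R := AddCommGrpCat.of (ULift.{u} ℤ)
  -- the coefficient group is `ℤ`, so homomorphisms from it to `G` are elements of `G`
  let m : G → (R ⟶ AddCommGrpCat.of G) := fun g =>
    AddCommGrpCat.ofHom ((zmultiplesHom G g).comp AddEquiv.ulift.toAddMonoidHom)
  have hm : ∀ a b c : G, a - b + c = 0 → m a + -m b + m c = 0 := by
    intro a b c habc
    ext ⟨k⟩
    change k • a + -(k • b) + k • c = 0
    rw [← smul_neg, ← smul_add, ← smul_add, ← sub_eq_add_neg, habc, smul_zero]
  let f : (Y.chainComplex R).X 1 ⟶ AddCommGrpCat.of G :=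
    Limits.Sigma.desc fun x => m (φ x)
  have hf : ∀ x, Y.ιChainComplex (R := R) x ≫ f = m (φ x) := fun x =>
    Limits.Sigma.ι_desc _ _
  have hdf : (Y.chainComplex R).d 2 1 ≫ f = 0 := by
    apply SSet.chainComplex_hom_ext
    intro x
    rw [← Category.assoc, SSet.ιChainComplex_d, Limits.comp_zero, Preadditive.sum_comp]
    simp only [Preadditive.zsmul_comp, hf]
    rw [Fin.sum_univ_three]
    simpa using hm _ _ _ (hsum x)
  refine ⟨fun a => ((Y.chainComplex R).homologyι 1 ≫
    (Y.chainComplex R).descOpcycles f 2 (by simp) hdf) a, fun p g hg => ?_⟩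
  have h1 : (HomologicalComplex.liftCycles (Y.chainComplex R)
      (Y.ιChainComplex p.simplex) 0 (by simp) p.simplex_isCycle ≫
      HomologicalComplex.homologyπ _ 1) ≫ ((Y.chainComplex R).homologyι 1 ≫
      (Y.chainComplex R).descOpcycles f 2 (by simp) hdf) = m (φ p.simplex) := by
    rw [Category.assoc, HomologicalComplex.homology_π_ι_assoc,
      HomologicalComplex.p_descOpcycles, HomologicalComplex.liftCycles_i_assoc, hf]
  have h2 := congrArg (fun F : R ⟶ AddCommGrpCat.of G => F (ULift.up (1 : ℤ))) h1
  refine Eq.trans h2 ?_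
  change (1 : ℤ) • φ p.simplex = _
  rw [one_smul]
  -- the parametrization of the edge by the unit interval
  let w : unitInterval → stdSimplex ℝ (Fin 2) := fun t =>
    ⟨![1 - t.1, t.1], by
      refine ⟨fun i => ?_, by simp⟩
      fin_cases i
      · simpa using t.2.2
      · simpa using t.2.1⟩
  have hw : Continuous w := by
    refine Continuous.subtype_mk (continuous_pi fun i => ?_) _
    fin_cases i
    · simp; fun_prop
    · simp; fun_prop
  have h3 := (hh p.simplex).comp hw
  have h4 : simplexMap p.simplex ∘ w = p.toMap := by
    ext t
    exact simplexMap_loop p _ t (by simp [w])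
  rw [h4] at h3
  rw [← h3.sub_eq_sub hg 0 1]
  have w0 : w 0 = v 0 := by
    refine Subtype.ext (funext fun i => ?_)
    fin_cases i <;> simp [w, v]
  have w1 : w 1 = v 1 := by
    refine Subtype.ext (funext fun i => ?_)
    fin_cases i <;> simp [w, v]
  simp [φ, w0, w1]

/-- Two loops are homologous if they are two edges of a singular `2`-simplex whose third edge is
constant. The boundary of the simplex still contains the third edge, which is the boundary of a
constant `2`-simplex. -/
theorem Loop.homologyClass_eq_of_simplex (p q : Loop X) (σ : C(stdSimplex ℝ (Fin 3), X))
    (hp : ∀ (x : stdSimplex ℝ (Fin 3)) (t : unitInterval), x.1 2 = 0 → x.1 1 = t.1 →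
      σ x = p.toMap t)
    (hq : ∀ (x : stdSimplex ℝ (Fin 3)) (t : unitInterval), x.1 1 = 0 → x.1 2 = t.1 →
      σ x = q.toMap t)
    (b : X) (hb : ∀ x : stdSimplex ℝ (Fin 3), x.1 0 = 0 → σ x = b) :
    p.homologyClass = q.homologyClass := by
  let Y := TopCat.toSSet.obj (TopCat.of X)
  let R := AddCommGrpCat.of (ULift.{u} ℤ)
  obtain ⟨x, hx⟩ := exists_simplexMap_eq σ
  obtain ⟨e, he⟩ := exists_simplexMap_eq (n := 2) (ContinuousMap.const _ b)
  obtain ⟨l, hl⟩ := exists_simplexMap_eq (n := 1) (ContinuousMap.const _ b)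
  have hcoord : ∀ (i : Fin 3) (z : stdSimplex ℝ (Fin 2)) (j : Fin 3),
      (stdSimplex.map (SimplexCategory.δ i) z).1 j =
        ∑ k : Fin 2, if SimplexCategory.δ i k = j then z.1 k else 0 := by
    intro i z j
    change (stdSimplex.map (SimplexCategory.δ i) z) j = _
    rw [stdSimplex.map_coe, FunOnFinite.linearMap_apply_apply, Finset.sum_filter]
    rfl
  have hδ : ∀ (i : Fin 3) (z : stdSimplex ℝ (Fin 2)), simplexMap (Y.δ i x) z =
      σ (stdSimplex.map (SimplexCategory.δ i) z) := by
    intro i z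
    rw [← hx]; rfl
  have e0 : Y.δ 0 x = l := by
    apply simplexMap_injective
    rw [hl]
    ext z
    rw [hδ]
    refine hb _ ?_
    rw [hcoord, Fin.sum_univ_two, if_neg (by decide), if_neg (by decide), add_zero]
  have hz : ∀ z : stdSimplex ℝ (Fin 2), z.1 1 ≤ 1 := by
    intro z
    have h := z.2.2
    rw [Fin.sum_univ_two] at h
    linarith [z.2.1 0]
  have e1 : Y.δ 1 x = q.simplex := by
    apply simplexMap_injective
    ext z
    rw [hδ, simplexMap_loop q z ⟨z.1 1, z.2.1 1, hz z⟩ rfl]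
    refine hq _ _ ?_ ?_ <;> rw [hcoord, Fin.sum_univ_two]
    · rw [if_neg (by decide), if_neg (by decide), add_zero]
    · rw [if_neg (by decide), if_pos (by decide), zero_add]
  have e2 : Y.δ 2 x = p.simplex := by
    apply simplexMap_injective
    ext z
    rw [hδ, simplexMap_loop p z ⟨z.1 1, z.2.1 1, hz z⟩ rfl]
    refine hp _ _ ?_ ?_ <;> rw [hcoord, Fin.sum_univ_two]
    · rw [if_neg (by decide), if_neg (by decide), add_zero]
    · rw [if_neg (by decide), if_pos (by decide), zero_add]
  have ee : ∀ i, Y.δ i e = l := by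
    intro i
    apply simplexMap_injective
    rw [hl, simplexMap_δ, he]
    rfl
  have hbd : Y.ιChainComplex (R := R) p.simplex - Y.ιChainComplex q.simplex =
      (Y.ιChainComplex x - Y.ιChainComplex e) ≫ (Y.chainComplex R).d 2 1 := by
    rw [Preadditive.sub_comp, SSet.ιChainComplex_d, SSet.ιChainComplex_d, Fin.sum_univ_three,
      Fin.sum_univ_three, e0, e1, e2, ee, ee, ee]
    simp
    abel
  have h0 := HomologicalComplex.liftCycles_homologyπ_eq_zero_of_boundary (Y.chainComplex R) _ 0
    (by simp) _ hbd
  have hd : HomologicalComplex.liftCycles (Y.chainComplex R) (Y.ιChainComplex p.simplex) 0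
        (by simp) p.simplex_isCycle ≫ HomologicalComplex.homologyπ _ 1 =
      HomologicalComplex.liftCycles (Y.chainComplex R) (Y.ιChainComplex q.simplex) 0
        (by simp) q.simplex_isCycle ≫ HomologicalComplex.homologyπ _ 1 := by
    rw [← sub_eq_zero, ← Preadditive.sub_comp, ← h0]
    congr 1
    rw [← cancel_mono ((Y.chainComplex R).iCycles 1), Preadditive.sub_comp]
    simp only [HomologicalComplex.liftCycles_i]
  exact congrArg (fun F : R ⟶ H1 X => F (ULift.up (1 : ℤ))) hd

end Homology

/-- Reparametrizing a loop does not change its homology class. -/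
theorem Loop.homologyClass_reparam {X : Type u} [TopologicalSpace X] {c : ℝ → X}
    (hc : Continuous c) {θ : ℝ → ℝ} (hθ : Continuous θ) (h0 : θ 0 = 0) (h1 : θ 1 = 1)
    (p q : Loop X) (hp : ∀ t : unitInterval, p.toMap t = c t)
    (hq : ∀ t : unitInterval, q.toMap t = c (θ t)) : p.homologyClass = q.homologyClass := by
  -- `T` is `x 1` on the edge `x 2 = 0`, `θ (x 2)` on the edge `x 1 = 0`, and `1` on the edge
  -- `x 0 = 0`: it is `x 1 + x 2` plus a correction, which the bound by `|θ (x 2) - x 2|` switches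
  -- off for `x 2 = 0`.
  let T : stdSimplex ℝ (Fin 3) → ℝ := fun x => (x.1 1 + x.1 2) +
    max (-|θ (x.1 2) - x.1 2|) (min |θ (x.1 2) - x.1 2| (θ (x.1 1 + x.1 2) - (x.1 1 + x.1 2)))
  have hcoe : ∀ i, Continuous fun x : stdSimplex ℝ (Fin 3) => x.1 i := fun i =>
    (continuous_apply i).comp continuous_subtype_val
  have hT : Continuous T := by
    have key : ∀ a b : stdSimplex ℝ (Fin 3) → ℝ, Continuous a → Continuous b →
        Continuous fun x => (a x + b x) +
          max (-|θ (b x) - b x|) (min |θ (b x) - b x| (θ (a x + b x) - (a x + b x))) := by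
      intro a b ha hb
      fun_prop
    exact key _ _ (hcoe 1) (hcoe 2)
  refine Loop.homologyClass_eq_of_simplex p q ⟨fun x => c (T x), hc.comp hT⟩ ?_ ?_ (c 1) ?_
  · intro x t hx ht
    rw [hp]
    simp only [ContinuousMap.coe_mk, T]
    rw [hx, ht, h0]
    simp
  · intro x t hx ht
    rw [hq]
    simp only [ContinuousMap.coe_mk, T]
    rw [hx, ht, zero_add, min_eq_right (le_abs_self _), max_eq_right (neg_abs_le _)]
    congr 1
    ring
  · intro x hx
    have h := x.2.2
    rw [Fin.sum_univ_three, hx, zero_add] at h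
    simp only [ContinuousMap.coe_mk, T]
    rw [h, h1]
    simp

/-! ### Complex logarithms -/

theorem exp_inj_of_abs_im_sub_lt {a b : ℂ} (h : Complex.exp a = Complex.exp b)
    (him : |a.im - b.im| < 2 * Real.pi) : a = b := by
  obtain ⟨n, hn⟩ := Complex.exp_eq_exp_iff_exists_int.1 h
  have h1 : a.im - b.im = n * (2 * Real.pi) := by
    rw [hn]; simp
  rw [h1, abs_mul, abs_of_pos Real.two_pi_pos] at him
  have h2 : |(n : ℝ)| < 1 := by
    by_contra! hc
    nlinarith [Real.two_pi_pos]
  have h3 : n = 0 := by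
    rw [← Int.abs_lt_one_iff]
    exact_mod_cast h2
  simpa [h3] using hn

theorem re_pos_of_norm_sub_one_lt {q : ℂ} (h : ‖q - 1‖ < 1) : 0 < q.re := by
  have := (Complex.abs_re_le_norm (q - 1)).trans_lt h
  rw [abs_lt] at this
  simp at this
  linarith

theorem mem_slitPlane_of_norm_sub_one_lt {q : ℂ} (h : ‖q - 1‖ < 1) : q ∈ Complex.slitPlane :=
  Or.inl (re_pos_of_norm_sub_one_lt h)

theorem ne_zero_of_norm_sub_one_lt {q : ℂ} (h : ‖q - 1‖ < 1) : q ≠ 0 :=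
  Complex.slitPlane_ne_zero (mem_slitPlane_of_norm_sub_one_lt h)

theorem abs_log_im_lt_of_norm_sub_one_lt {q : ℂ} (h : ‖q - 1‖ < 1) :
    |(Complex.log q).im| < Real.pi / 2 := by
  rw [Complex.log_im]
  exact Complex.abs_arg_lt_pi_div_two_iff.2 (Or.inl (re_pos_of_norm_sub_one_lt h))

/-- A nonvanishing function has a logarithm near each of its points of continuity. -/
theorem exists_local_log {S : Type*} [TopologicalSpace S] {h : S → ℂ} {w : S}
    (hc : ContinuousAt h w) (h0 : h w ≠ 0) : ∃ m : S → ℂ, ∀ᶠ v in 𝓝 w,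
      (ContinuousAt h v → ContinuousAt m v) ∧ Complex.exp (m v) = h v := by
  refine ⟨fun v => Complex.log (h v / h w) + Complex.log (h w), ?_⟩
  have h1 : ∀ᶠ v in 𝓝 w, h v / h w ∈ Complex.slitPlane := by
    have : ContinuousAt (fun v => h v / h w) w := hc.div_const _
    refine this.eventually_mem (Complex.isOpen_slitPlane.mem_nhds ?_)
    rw [div_self h0]; exact Complex.one_mem_slitPlane
  filter_upwards [h1] with v hv
  refine ⟨fun hcv => ((hcv.div_const _).clog hv).add_const _, ?_⟩
  rw [Complex.exp_add, Complex.exp_log (Complex.slitPlane_ne_zero hv), Complex.exp_log h0,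
    div_mul_cancel₀ _ h0]

theorem exists_continuous_log_real {g : ℝ → ℂ} (hg : Continuous g) (h0 : ∀ t, g t ≠ 0) :
    ∃ L : ℝ → ℂ, Continuous L ∧ ∀ t, Complex.exp (L t) = g t := by
  obtain ⟨F, ⟨-, hF⟩, -⟩ := Complex.isCoveringMapOn_exp.existsUnique_continuousMap_lifts ⟨g, hg⟩
    (a₀ := 0) (e₀ := Complex.log (g 0)) (Complex.exp_log (h0 0)) (fun t => h0 t)
  exact ⟨F, F.continuous, fun t => congrFun hF t⟩

/-- The degree of a map to the punctured plane along loops factors through `H₁`. It is expressed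
by the increment of a logarithm along the loop, that is `2πi` times the winding number. -/
theorem exists_degree_onHomology {X : Type u} [TopologicalSpace X] {g : X → ℂ}
    (hg : Continuous g) (h0 : ∀ x, g x ≠ 0) : ∃ ψ : H1 X → ℂ, ∀ (p : Loop X) (L : unitInterval → ℂ),
      Continuous L → (∀ t, Complex.exp (L t) = g (p.toMap t)) →
        ψ p.homologyClass = L 1 - L 0 := by
  let κ : X → X → ULift.{u} ℂ := fun x y => ⟨Complex.log (g y / g x)⟩
  have hκ : LocallyAdditive κ := by
    intro p
    have h2 : ∀ᶠ x in 𝓝 p, ‖g x / g p - 1‖ < 1 / 4 := by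
      have h1 : Tendsto (fun x => ‖g x / g p - 1‖) (𝓝 p) (𝓝 ‖g p / g p - 1‖) :=
        ((hg.continuousAt.div_const _).sub_const _).norm
      rw [div_self (h0 p), sub_self, norm_zero] at h1
      exact h1.eventually_lt_const (by norm_num)
    refine ⟨_, h2, ?_⟩
    have hlog : ∀ x y, ‖g x / g p - 1‖ < 1 / 4 → ‖g y / g p - 1‖ < 1 / 4 →
        ‖g y / g x - 1‖ < 1 := by
      intro x y hx hy
      have e : g y / g x - 1 = ((g y / g p - 1) - (g x / g p - 1)) / (g x / g p) := by
        have := h0 x; have := h0 p; field_simp; ring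
      have h3 : 3 / 4 < ‖g x / g p‖ := by
        have := norm_sub_norm_le (1 : ℂ) (1 - g x / g p)
        rw [norm_one, norm_sub_rev, sub_sub_cancel] at this
        linarith
      rw [e, norm_div, div_lt_one (by linarith)]
      linarith [norm_sub_le (g y / g p - 1) (g x / g p - 1)]
    intro x hx y hy z hz
    refine ULift.ext _ _ (exp_inj_of_abs_im_sub_lt ?_ ?_)
    · change Complex.exp (Complex.log _ + Complex.log _) = Complex.exp (Complex.log _)
      rw [Complex.exp_add, Complex.exp_log (div_ne_zero (h0 _) (h0 _)),
        Complex.exp_log (div_ne_zero (h0 _) (h0 _)), Complex.exp_log (div_ne_zero (h0 _) (h0 _))]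
      have := h0 x; have := h0 y
      field_simp
    · change |(Complex.log _ + Complex.log _).im - (Complex.log _).im| < _
      have a1 := abs_log_im_lt_of_norm_sub_one_lt (hlog x y hx hy)
      have a2 := abs_log_im_lt_of_norm_sub_one_lt (hlog y z hy hz)
      have a3 := abs_log_im_lt_of_norm_sub_one_lt (hlog x z hx hz)
      rw [abs_lt] at *
      rw [Complex.add_im]
      constructor <;> linarith [Real.pi_pos]
  obtain ⟨Φ, hΦ⟩ := hκ.exists_onHomology
  refine ⟨fun a => (Φ a).down, fun p L hL hexp => ?_⟩
  refine (congrArg ULift.down (hΦ p (fun t => ⟨L t⟩) ?_)).trans rfl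
  · intro t
    have h1 : ∀ᶠ s in 𝓝 t, ‖L s - L t‖ < 1 := by
      have : Tendsto (fun s => ‖L s - L t‖) (𝓝 t) (𝓝 ‖L t - L t‖) :=
        (hL.continuousAt.sub_const _).norm
      rw [sub_self, norm_zero] at this
      exact this.eventually_lt_const (by norm_num)
    filter_upwards [h1] with s hs
    refine ULift.ext _ _ (?_ : L s - L t = Complex.log _)
    rw [← hexp, ← hexp, ← Complex.exp_sub, Complex.log_exp]
    · linarith [(abs_le.1 (Complex.abs_im_le_norm (L s - L t))).1, Real.pi_gt_three]
    · linarith [(abs_le.1 (Complex.abs_im_le_norm (L s - L t))).2, Real.pi_gt_three]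

/-! ### Charts with values in the complex plane -/

/-- The identification of the model plane with `ℂ`. -/
noncomputable def toC : EuclideanSpace ℝ (Fin 2) ≃L[ℝ] ℂ :=
  Complex.orthonormalBasisOneI.repr.symm.toContinuousLinearEquiv

theorem toC_apply (v : EuclideanSpace ℝ (Fin 2)) : toC v = v 0 + v 1 * Complex.I :=
  Complex.orthonormalBasisOneI_repr_symm_apply v

section Charts

variable {S : Type u} [TopologicalSpace S] [ChartedSpace (EuclideanSpace ℝ (Fin 2)) S]

/-- The preferred chart at a point, as a complex coordinate. -/
noncomputable def cchart (x : S) : OpenPartialHomeomorph S ℂ :=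
  (chartAt (EuclideanSpace ℝ (Fin 2)) x).transHomeomorph toC.toHomeomorph

theorem mem_cchart_source (x : S) : x ∈ (cchart x).source := mem_chart_source _ x

theorem isPreconnected_punctured_ball (c : ℂ) (ρ : ℝ) :
    IsPreconnected (Metric.ball c ρ \ {c}) := by
  have h : Metric.ball c ρ \ {c} = (fun p : ℝ × ℝ => c + p.1 * Complex.exp (p.2 * Complex.I)) ''
      (Ioo 0 ρ ×ˢ univ) := by
    ext z
    constructor
    · rintro ⟨hz, hzc⟩
      have hzc' : z - c ≠ 0 := sub_ne_zero.2 hzc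
      refine ⟨(‖z - c‖, (z - c).arg), ⟨⟨norm_pos_iff.2 hzc', ?_⟩, trivial⟩, ?_⟩
      · rwa [← dist_eq_norm]
      · simp only [Complex.norm_mul_exp_arg_mul_I]
        ring
    · rintro ⟨⟨r, θ⟩, ⟨⟨h0, h1⟩, -⟩, rfl⟩
      refine ⟨?_, ?_⟩
      · simp [Complex.norm_exp_ofReal_mul_I, abs_of_pos h0, h1]
      · simp [h0.ne']
  rw [h]
  refine ((isPreconnected_Ioo.prod isPreconnected_univ).image _ ?_)
  exact Continuous.continuousOn (by fun_prop)

/-- Points of a surface have arbitrarily small neighbourhoods that stay connected when the point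
is removed. -/
theorem exists_punctured_preconnected {w : S} {U : Set S} (hU : U ∈ 𝓝 w) :
    ∃ V, V ⊆ U ∧ IsOpen V ∧ w ∈ V ∧ IsPreconnected (V \ {w}) := by
  let z := cchart w
  have hw := mem_cchart_source w
  have h1 : z.target ∩ z.symm ⁻¹' U ∈ 𝓝 (z w) := by
    refine inter_mem (z.open_target.mem_nhds (z.map_source hw)) ?_
    have := z.symm.continuousAt (z.map_source hw)
    refine this.preimage_mem_nhds ?_
    rwa [z.left_inv hw]
  obtain ⟨ρ, hρ, hball⟩ := Metric.mem_nhds_iff.1 h1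
  have himg : z.symm '' Metric.ball (z w) ρ = z.source ∩ z ⁻¹' Metric.ball (z w) ρ :=
    z.symm_image_eq_source_inter_preimage fun x hx => (hball hx).1
  refine ⟨z.symm '' Metric.ball (z w) ρ, ?_, ?_, ?_, ?_⟩
  · rintro _ ⟨x, hx, rfl⟩
    exact (hball hx).2
  · rw [himg]
    exact z.isOpen_inter_preimage Metric.isOpen_ball
  · exact ⟨z w, Metric.mem_ball_self hρ, z.left_inv hw⟩
  · have : z.symm '' Metric.ball (z w) ρ \ {w} = z.symm '' (Metric.ball (z w) ρ \ {z w}) := by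
      ext x
      constructor
      · rintro ⟨⟨y, hy, rfl⟩, hne⟩
        refine ⟨y, ⟨hy, ?_⟩, rfl⟩
        rintro rfl
        exact hne (z.left_inv hw)
      · rintro ⟨y, ⟨hy, hne⟩, rfl⟩
        refine ⟨⟨y, hy, rfl⟩, ?_⟩
        intro h
        refine hne ?_
        have h' : z.symm y = w := h
        rw [mem_singleton_iff, ← h', z.right_inv (hball hy).1]
    rw [this]
    refine (isPreconnected_punctured_ball _ _).image _ ?_
    exact z.symm.continuousOn.mono fun x hx => (hball hx.1).1

theorem neBot_nhdsNE (w : S) : NeBot (𝓝[≠] w) := by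
  let z := cchart w
  have hw := mem_cchart_source w
  rw [← mem_closure_iff_nhdsWithin_neBot, mem_closure_iff_nhds]
  intro U hU
  have h1 : z.target ∩ z.symm ⁻¹' U ∈ 𝓝 (z w) := by
    refine inter_mem (z.open_target.mem_nhds (z.map_source hw)) ?_
    have := z.symm.continuousAt (z.map_source hw)
    refine this.preimage_mem_nhds ?_
    rwa [z.left_inv hw]
  have h2 : NeBot (𝓝[≠] (z w)) := inferInstance
  have h3 := mem_closure_iff_nhds.1 (mem_closure_iff_nhdsWithin_neBot.2 h2) _ h1
  obtain ⟨y, ⟨hy1, hy2⟩, hy3⟩ := h3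
  refine ⟨z.symm y, hy2, fun h => hy3 ?_⟩
  have h' : z.symm y = w := h
  rw [mem_singleton_iff, ← h', z.right_inv hy1]

/-- Two logarithms of the same function on a preconnected set differ by a constant. -/
theorem exists_sub_eq_of_exp_eq {T : Type*} [TopologicalSpace T] {U : Set T}
    (hU : IsPreconnected U) {a b : T → ℂ} (ha : ContinuousOn a U) (hb : ContinuousOn b U)
    (h : ∀ x ∈ U, Complex.exp (a x) = Complex.exp (b x)) :
    ∃ k : ℂ, Complex.exp k = 1 ∧ ∀ x ∈ U, a x = b x + k := by
  rcases U.eq_empty_or_nonempty with rfl | ⟨x₀, hx₀⟩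
  · exact ⟨0, by simp, by simp⟩
  have hd : ∀ x ∈ U, ∃ n : ℤ, a x - b x = n * (2 * Real.pi * Complex.I) := by
    intro x hx
    obtain ⟨n, hn⟩ := Complex.exp_eq_exp_iff_exists_int.1 (h x hx)
    exact ⟨n, by rw [hn]; ring⟩
  choose! n hn using hd
  have hc : ContinuousOn (fun x => ((n x : ℤ) : ℝ)) U := by
    have h1 : ContinuousOn (fun x => ((a x - b x) / (2 * Real.pi * Complex.I)).re) U :=
      Complex.continuous_re.comp_continuousOn ((ha.sub hb).div_const _)
    refine h1.congr fun x hx => ?_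
    simp only
    rw [hn x hx, mul_div_cancel_right₀ _ Complex.two_pi_I_ne_zero]
    simp
  have hc' : ContinuousOn n U := by
    have := Int.isClosedEmbedding_coe_real.isInducing
    exact this.continuousOn_iff.2 hc
  have hconst : ∀ x ∈ U, n x = n x₀ := fun x hx => hU.constant hc' hx hx₀
  refine ⟨n x₀ * (2 * Real.pi * Complex.I), ?_, fun x hx => ?_⟩
  · rw [Complex.exp_int_mul_two_pi_mul_I]
  · rw [← hconst x hx, ← hn x hx]; ring

/-- A logarithm of a nonvanishing continuous function that is defined off a finite set extends. -/
theorem exists_continuous_log_of_finite [T1Space S] {h ℓ : S → ℂ} {F : Set S} (hF : F.Finite)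
    (hc : Continuous h) (h0 : ∀ w, h w ≠ 0)
    (hℓ : ∀ w ∉ F, ContinuousAt ℓ w ∧ h w = Complex.exp (ℓ w)) :
    ∃ L : S → ℂ, Continuous L ∧ ∀ w, Complex.exp (L w) = h w := by
  -- on a connected punctured neighbourhood, `ℓ` differs by a constant from a local logarithm of `h`
  have hloc : ∀ w, ∃ m : S → ℂ, (∀ᶠ v in 𝓝 w, ContinuousAt m v ∧ Complex.exp (m v) = h v) ∧
      ∀ᶠ v in 𝓝[≠] w, ℓ v = m v := by
    intro w
    obtain ⟨m, hm⟩ := exists_local_log hc.continuousAt (h0 w)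
    have hFw : (F \ {w})ᶜ ∈ 𝓝 w :=
      (hF.subset sdiff_subset).isClosed.isOpen_compl.mem_nhds (by simp)
    obtain ⟨V, hVU, hVo, hwV, hVc⟩ := exists_punctured_preconnected (inter_mem hm hFw)
    have hoff : ∀ v ∈ V \ {w}, v ∉ F := fun v hv hvF => (hVU hv.1).2 ⟨hvF, hv.2⟩
    obtain ⟨k, hk, hkV⟩ := exists_sub_eq_of_exp_eq hVc (a := ℓ) (b := m)
      (fun v hv => (hℓ v (hoff v hv)).1.continuousWithinAt)
      (fun v hv => ((hVU hv.1).1.1 hc.continuousAt).continuousWithinAt)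
      (fun v hv => by rw [← (hℓ v (hoff v hv)).2, (hVU hv.1).1.2])
    refine ⟨fun v => m v + k, ?_, ?_⟩
    · filter_upwards [hm] with v hv
      exact ⟨(hv.1 hc.continuousAt).add_const _, by rw [Complex.exp_add, hk, mul_one, hv.2]⟩
    · rw [eventually_nhdsWithin_iff]
      filter_upwards [hVo.mem_nhds hwV] with v hv hvw using hkV v ⟨hv, hvw⟩
  choose m hm hmℓ using hloc
  -- the local extensions of `ℓ` glue, as their values are limits of `ℓ`
  have hL : ∀ w, (fun v => m v v) =ᶠ[𝓝 w] m w := by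
    intro w
    have h2' : ∀ᶠ v in 𝓝 w, v ≠ w → ∀ᶠ u in 𝓝[≠] v, ℓ u = m w u := by
      have h3 := eventually_nhdsWithin_iff.1 (hmℓ w)
      filter_upwards [h3.eventually_nhds] with v hv hvw
      have h4 : ∀ᶠ u in 𝓝 v, u ≠ w := isOpen_ne.mem_nhds hvw
      exact (hv.and h4).filter_mono nhdsWithin_le_nhds |>.mono fun u hu => hu.1 hu.2
    filter_upwards [h2', hm w] with v hv hvm
    by_cases hvw : v = w
    · rw [hvw]
    have : NeBot (𝓝[≠] v) := neBot_nhdsNE v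
    have e1 : Tendsto (m v) (𝓝[≠] v) (𝓝 (m v v)) :=
      (hm v).self_of_nhds.1.tendsto.mono_left nhdsWithin_le_nhds
    have e2 : Tendsto (m w) (𝓝[≠] v) (𝓝 (m w v)) :=
      hvm.1.tendsto.mono_left nhdsWithin_le_nhds
    refine tendsto_nhds_unique (e1.congr' ?_) e2
    filter_upwards [hv hvw, hmℓ v] with u hu hu'
    rw [← hu', hu]
  refine ⟨fun v => m v v, continuous_iff_continuousAt.2 fun w => ?_, fun w =>
    (hm w).self_of_nhds.2⟩
  exact (hm w).self_of_nhds.1.congr (hL w).symm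

end Charts

/-- If `exp ∘ lam` is continuous off a finite set, around each point of which it has a logarithm,
then it can be corrected by the exponential of a function continuous off the finite set so that it
extends continuously, without zeros. -/
theorem exists_continuous_nonvanishing {S : Type*} [TopologicalSpace S] [T2Space S]
    [CompactSpace S] {lam : S → ℂ} {F : Set S} (hF : F.Finite)
    (hc : ∀ w ∉ F, ContinuousAt (fun v => Complex.exp (lam v)) w)
    (hlog : ∀ w ∈ F, ∃ m : S → ℂ, ∀ᶠ v in 𝓝[≠] w,
      ContinuousAt m v ∧ Complex.exp (lam v) = Complex.exp (m v)) :
    ∃ g ℓ : S → ℂ, Continuous g ∧ (∀ w, g w ≠ 0) ∧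
      ∀ w ∉ F, ContinuousAt ℓ w ∧ g w = Complex.exp (lam w - ℓ w) := by
  classical
  choose! m hm using hlog
  have hχ : ∀ w ∈ F, ∃ χ : S → ℝ, Continuous χ ∧ (∀ᶠ v in 𝓝 w, χ v = 1) ∧
      (∀ v ∈ tsupport χ, v ≠ w → v ∉ F ∧ ContinuousAt (m w) v ∧
        Complex.exp (lam v) = Complex.exp (m w v)) := by
    intro w hw
    have hFw : ∀ᶠ v in 𝓝 w, v ≠ w → v ∉ F := by
      have : (F \ {w})ᶜ ∈ 𝓝 w :=
        (hF.subset sdiff_subset).isClosed.isOpen_compl.mem_nhds (by simp)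
      filter_upwards [this] with v hv hvw hvF
      exact hv ⟨hvF, hvw⟩
    obtain ⟨U, hU, hUo, hwU⟩ := eventually_nhds_iff.1
      (hFw.and (eventually_nhdsWithin_iff.1 (hm w hw)))
    obtain ⟨t, ht, htc, htU⟩ := exists_mem_nhds_isClosed_subset (hUo.mem_nhds hwU)
    obtain ⟨f, hf1, hf2, -⟩ := exists_tsupport_one_of_isOpen_isClosed hUo
      isClosed_closure.isCompact htc htU
    refine ⟨f, f.continuous, ?_, fun v hv hvw => ?_⟩
    · filter_upwards [ht] with v hv using hf2 hv
    · exact ⟨(hU v (hf1 hv)).1 hvw, (hU v (hf1 hv)).2 hvw⟩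
  choose! χ hχc hχ1 hχs using hχ
  -- subtract the local logarithms, cut off near the points of `F`
  let ℓ : S → ℂ := fun v => ∑ w ∈ hF.toFinset, χ w v * m w v
  have hzero : ∀ w ∈ F, ∀ v ∉ tsupport (χ w), ∀ᶠ x in 𝓝 v, χ w x = 0 := by
    intro w _ v hv
    filter_upwards [(isClosed_tsupport (χ w)).isOpen_compl.mem_nhds hv] with x hx
    exact image_eq_zero_of_notMem_tsupport hx
  have hℓc : ∀ v ∉ F, ContinuousAt ℓ v := by
    intro v hv
    refine tendsto_finsetSum _ fun w hw => ?_
    rw [hF.mem_toFinset] at hw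
    by_cases hvs : v ∈ tsupport (χ w)
    · exact (Complex.continuous_ofReal.comp (hχc w hw)).continuousAt.mul
        (hχs w hw v hvs (by rintro rfl; exact hv hw)).2.1
    · have h0 := hzero w hw v hvs
      have : (fun x => (χ w x : ℂ) * m w x) =ᶠ[𝓝 v] fun _ => 0 := by
        filter_upwards [h0] with x hx
        simp [hx]
      exact (continuousAt_const.congr this.symm)
  refine ⟨fun v => if v ∈ F then 1 else Complex.exp (lam v - ℓ v), ℓ, ?_, ?_, ?_⟩
  · refine continuous_iff_continuousAt.2 fun v => ?_
    by_cases hv : v ∈ F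
    · have : (fun v => if v ∈ F then (1 : ℂ) else Complex.exp (lam v - ℓ v)) =ᶠ[𝓝 v]
          fun _ => 1 := by
        have h1 : ∀ᶠ x in 𝓝 v, ∀ w ∈ hF.toFinset, w ≠ v → χ w x = 0 := by
          rw [Finset.eventually_all]
          intro w hw
          rw [hF.mem_toFinset] at hw
          by_cases hwv : w = v
          · exact Eventually.of_forall fun x h => absurd hwv h
          · have hvs : v ∉ tsupport (χ w) := fun h => (hχs w hw v h (Ne.symm hwv)).1 hv
            filter_upwards [hzero w hw v hvs] with x hx _ using hx
        filter_upwards [h1, hχ1 v hv, eventually_nhdsWithin_iff.1 (hm v hv)] with x hx1 hx2 hx3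
        split_ifs with hxF
        · rfl
        have hxv : x ≠ v := by rintro rfl; exact hxF hv
        have : ℓ x = m v x := by
          simp only [ℓ]
          rw [Finset.sum_eq_single v]
          · simp [hx2]
          · intro w hw hwv
            simp [hx1 w hw hwv]
          · intro h
            exact absurd (hF.mem_toFinset.2 hv) h
        rw [this, Complex.exp_sub, (hx3 hxv).2, div_self (Complex.exp_ne_zero _)]
      exact continuousAt_const.congr this.symm
    · have : (fun v => if v ∈ F then (1 : ℂ) else Complex.exp (lam v - ℓ v)) =ᶠ[𝓝 v]
          fun v => Complex.exp (lam v) / Complex.exp (ℓ v) := by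
        filter_upwards [hF.isClosed.isOpen_compl.mem_nhds hv] with x hx
        rw [if_neg hx, Complex.exp_sub]
      exact ((hc v hv).div (hℓc v hv).cexp (Complex.exp_ne_zero _)).congr this.symm
  · intro w
    dsimp only
    split_ifs
    · exact one_ne_zero
    · exact Complex.exp_ne_zero _
  · intro w hw
    exact ⟨hℓc w hw, if_neg hw⟩

/-! ### Coordinate changes -/

theorem eq_sum_basis (v : EuclideanSpace ℝ (Fin 2)) :
    v = v 0 • EuclideanSpace.single 0 1 + v 1 • EuclideanSpace.single 1 1 := by
  ext i; fin_cases i <;> simp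

theorem det_eq_fin_two (A : EuclideanSpace ℝ (Fin 2) →L[ℝ] EuclideanSpace ℝ (Fin 2)) :
    A.det = A (EuclideanSpace.single 0 1) 0 * A (EuclideanSpace.single 1 1) 1 -
      A (EuclideanSpace.single 1 1) 0 * A (EuclideanSpace.single 0 1) 1 := by
  rw [ContinuousLinearMap.det, ← LinearMap.det_toMatrix (EuclideanSpace.basisFun (Fin 2) ℝ).toBasis,
    Matrix.det_fin_two]
  simp [LinearMap.toMatrix_apply]

theorem cross_map (A : EuclideanSpace ℝ (Fin 2) →L[ℝ] EuclideanSpace ℝ (Fin 2))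
    (v w : EuclideanSpace ℝ (Fin 2)) :
    A v 0 * A w 1 - A v 1 * A w 0 = A.det * (v 0 * w 1 - v 1 * w 0) := by
  rw [det_eq_fin_two]
  conv_lhs => rw [eq_sum_basis v, eq_sum_basis w]
  simp only [map_add, map_smul, PiLp.add_apply, PiLp.smul_apply, smul_eq_mul]
  ring

theorem cross_eq_im (v w : EuclideanSpace ℝ (Fin 2)) :
    (starRingEnd ℂ (toC v) * toC w).im = v 0 * w 1 - v 1 * w 0 := by
  simp [toC_apply, Complex.mul_im]
  ring

/-- A linear map of positive determinant is the sum of a complex linear map and a smaller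
antilinear map. -/
theorem exists_conformal_part (A : EuclideanSpace ℝ (Fin 2) →L[ℝ] EuclideanSpace ℝ (Fin 2))
    (hA : 0 < A.det) : ∃ a b : ℂ, ‖b‖ < ‖a‖ ∧
      ∀ v, toC (A v) = a * toC v + b * starRingEnd ℂ (toC v) := by
  set p := A (EuclideanSpace.single 0 1) 0
  set q := A (EuclideanSpace.single 0 1) 1
  set r := A (EuclideanSpace.single 1 1) 0
  set s := A (EuclideanSpace.single 1 1) 1
  refine ⟨⟨(p + s) / 2, (q - r) / 2⟩, ⟨(p - s) / 2, (q + r) / 2⟩, ?_, fun v => ?_⟩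
  · rw [det_eq_fin_two] at hA
    rw [← sq_lt_sq₀ (norm_nonneg _) (norm_nonneg _), ← Complex.normSq_eq_norm_sq,
      ← Complex.normSq_eq_norm_sq, Complex.normSq_mk, Complex.normSq_mk]
    nlinarith
  · have h0 : A v 0 = v 0 * p + v 1 * r := by
      conv_lhs => rw [eq_sum_basis v]
      simp [p, r]
    have h1 : A v 1 = v 0 * q + v 1 * s := by
      conv_lhs => rw [eq_sum_basis v]
      simp [q, s]
    rw [toC_apply, toC_apply, h0, h1]
    apply Complex.ext <;> simp <;> ring

theorem norm_toC (v : EuclideanSpace ℝ (Fin 2)) : ‖toC v‖ = ‖v‖ :=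
  Complex.orthonormalBasisOneI.repr.symm.norm_map v

section Charts

variable {S : Type u} [TopologicalSpace S] [ChartedSpace (EuclideanSpace ℝ (Fin 2)) S]

theorem contDiffAt_coord_change [IsManifold (𝓡 2) ∞ S]
    {e e' : OpenPartialHomeomorph S (EuclideanSpace ℝ (Fin 2))}
    (he : e ∈ atlas (EuclideanSpace ℝ (Fin 2)) S) (he' : e' ∈ atlas (EuclideanSpace ℝ (Fin 2)) S)
    {w : S} (hw : w ∈ e.source) (hw' : w ∈ e'.source) :
    ContDiffAt ℝ ∞ (e' ∘ e.symm) (e w) := by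
  have h := (contDiffGroupoid ∞ (𝓡 2)).compatible he he'
  rw [contDiffGroupoid, mem_groupoid_of_pregroupoid] at h
  have h1 : ContDiffOn ℝ ∞ (e' ∘ e.symm) (e.symm ≫ₕ e').source := by
    simpa [contDiffPregroupoid] using h.1
  refine h1.contDiffAt ((e.symm ≫ₕ e').open_source.mem_nhds ?_)
  simp [e.map_source hw, e.left_inv hw, hw']

/-- Near a point, the quotient of the differences of two coordinates, divided by a suitable
constant, stays within distance `1` of `1`, so that it has a logarithm: a coordinate change that
preserves the orientation is close to a linear map that is dominated by its complex linear part. -/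
theorem exists_eventually_norm_div_sub_one_lt [IsManifold (𝓡 2) ∞ S] [OrientedAtlas S]
    {p q w₀ : S} (hp : w₀ ∈ (cchart p).source) (hq : w₀ ∈ (cchart q).source) :
    ∃ k : ℂ, k ≠ 0 ∧ ∃ V ∈ 𝓝 w₀, V ⊆ (cchart p).source ∧ V ⊆ (cchart q).source ∧
      ∀ x ∈ V, ∀ w ∈ V, w ≠ x →
        ‖(cchart q w - cchart q x) / (k * (cchart p w - cchart p x)) - 1‖ < 1 := by
  let e := chartAt (EuclideanSpace ℝ (Fin 2)) p
  let e' := chartAt (EuclideanSpace ℝ (Fin 2)) q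
  have he := chart_mem_atlas (EuclideanSpace ℝ (Fin 2)) p
  have he' := chart_mem_atlas (EuclideanSpace ℝ (Fin 2)) q
  have hs := (contDiffAt_coord_change he he' hp hq).hasStrictFDerivAt (by simp)
  have hdet := OrientedAtlas.det_pos e he e' he' w₀ ⟨hp, hq⟩
  obtain ⟨a, b, hab, hA⟩ := exists_conformal_part _ hdet
  have hε : 0 < (‖a‖ - ‖b‖) / 2 := by linarith
  obtain ⟨s, hs, happ⟩ := hs.approximates_deriv_on_nhds (c := ⟨_, hε.le⟩) (Or.inr hε)
  have ha : a ≠ 0 := norm_pos_iff.1 ((norm_nonneg b).trans_lt hab)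
  refine ⟨a, ha, e.source ∩ e ⁻¹' s ∩ e'.source, ?_, fun x hx => hx.1.1, fun x hx => hx.2, ?_⟩
  · exact inter_mem (inter_mem (e.open_source.mem_nhds hp)
      ((e.continuousAt hp).preimage_mem_nhds hs)) (e'.open_source.mem_nhds hq)
  · intro x hx w hw hne
    have h1 := happ _ hw.1.2 _ hx.1.2
    simp only [Function.comp] at h1
    rw [e.left_inv hx.1.1, e.left_inv hw.1.1, ← norm_toC, ← norm_toC (e w - e x), map_sub, hA] at h1
    have hzq : cchart q w - cchart q x = toC (e' w - e' x) := (map_sub toC _ _).symm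
    have hzp : cchart p w - cchart p x = toC (e w - e x) := (map_sub toC _ _).symm
    rw [hzq, hzp]
    set u := toC (e w - e x)
    have hu : u ≠ 0 := by
      intro h
      have h2 : e w - e x = 0 := toC.injective (by rw [map_zero]; exact h)
      exact hne (e.injOn hw.1.1 hx.1.1 (sub_eq_zero.1 h2))
    have hau : 0 < ‖a * u‖ := norm_pos_iff.2 (mul_ne_zero ha hu)
    rw [div_sub_one (norm_pos_iff.1 hau), norm_div, div_lt_one hau]
    have h3 : toC (e' w - e' x) - a * u =
        (toC (e' w - e' x) - (a * u + b * starRingEnd ℂ u)) + b * starRingEnd ℂ u := by ring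
    rw [h3]
    refine (norm_add_le _ _).trans_lt ?_
    have h4 : ‖toC (e' w - e' x) - (a * u + b * starRingEnd ℂ u)‖ ≤ (‖a‖ - ‖b‖) / 2 * ‖u‖ := h1
    have h5 : 0 < ‖u‖ := norm_pos_iff.2 hu
    rw [norm_mul, norm_mul, RCLike.norm_conj]
    nlinarith

/-- The velocities of curves through `w` are read in a chart through a linear map that preserves
the orientation. -/
theorem exists_velocity_map [IsManifold (𝓡 2) ∞ S] [OrientedAtlas S] {p w : S}
    (hw : w ∈ (cchart p).source) : ∃ B : EuclideanSpace ℝ (Fin 2) →L[ℝ] ℂ,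
      (∀ v v', (SignType.sign (starRingEnd ℂ (B v) * B v').im : ℤ) = orientationSign v v') ∧
      ∀ (α : ClosedCurve S) (t : ℝ), α t = w →
        HasDerivAt (fun s => cchart p (α s)) (B (α.velocity t)) t := by
  let e := chartAt (EuclideanSpace ℝ (Fin 2)) w
  let e' := chartAt (EuclideanSpace ℝ (Fin 2)) p
  have he := chart_mem_atlas (EuclideanSpace ℝ (Fin 2)) w
  have he' := chart_mem_atlas (EuclideanSpace ℝ (Fin 2)) p
  have hwe : w ∈ e.source := mem_chart_source _ w
  have hs := ((contDiffAt_coord_change he he' hwe hw).differentiableAt (by simp)).hasFDerivAt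
  have hdet := OrientedAtlas.det_pos e he e' he' w ⟨hwe, hw⟩
  set A := fderiv ℝ (e' ∘ e.symm) (e w)
  refine ⟨(toC : EuclideanSpace ℝ (Fin 2) →L[ℝ] ℂ).comp A, fun v v' => ?_, fun α t ht => ?_⟩
  · change (SignType.sign (starRingEnd ℂ (toC (A v)) * toC (A v')).im : ℤ) = _
    rw [cross_eq_im, cross_map, orientationSign, sign_mul, sign_pos hdet, one_mul]
  · subst ht
    have hd : MDifferentiableAt 𝓘(ℝ, ℝ) (𝓡 2) α.toFun t := α.smooth.mdifferentiableAt (by simp)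
    let A' : ℝ →L[ℝ] EuclideanSpace ℝ (Fin 2) := mfderiv 𝓘(ℝ, ℝ) (𝓡 2) α.toFun t
    have h0 := hd.hasMFDerivAt.2
    have hr : range 𝓘(ℝ, ℝ) = univ := by simp
    rw [hr] at h0
    have h0' : HasFDerivWithinAt (fun s => e (α s)) A' univ t := h0
    have h2 : HasDerivAt (fun s => e (α s)) (α.velocity t) t :=
      (hasFDerivWithinAt_univ.1 h0').hasDerivAt
    have h3 := (toC : EuclideanSpace ℝ (Fin 2) →L[ℝ] ℂ).hasFDerivAt.comp_hasDerivAt t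
      (hs.comp_hasDerivAt t h2)
    refine h3.congr_of_eventuallyEq ?_
    have hc : ContinuousAt α.toFun t := α.smooth.continuous.continuousAt
    filter_upwards [hc.preimage_mem_nhds (e.open_source.mem_nhds hwe)] with s hs
    simp only [Function.comp]
    rw [e.left_inv hs]
    rfl

theorem ClosedCurve.contDiffAt_cchart_comp [IsManifold (𝓡 2) ∞ S] (α : ClosedCurve S) {p : S}
    {t : ℝ} (ht : α t ∈ (cchart p).source) :
    ContDiffAt ℝ ∞ (fun s => cchart p (α s)) t := by
  have h1 : ContMDiffAt (𝓡 2) (𝓡 2) ∞ (chartAt (EuclideanSpace ℝ (Fin 2)) p) (α t) :=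
    (contMDiffOn_chart (I := 𝓡 2) (n := ∞) (x := p)).contMDiffAt
      ((chartAt (EuclideanSpace ℝ (Fin 2)) p).open_source.mem_nhds ht)
  have h2 : ContMDiffAt 𝓘(ℝ, ℝ) (𝓡 2) ∞
      (fun s => chartAt (EuclideanSpace ℝ (Fin 2)) p (α s)) t :=
    h1.comp t α.smooth.contMDiffAt
  have h3 : ContDiffAt ℝ ∞ (fun s => chartAt (EuclideanSpace ℝ (Fin 2)) p (α s)) t :=
    h2.contDiffAt
  exact toC.contDiff.contDiffAt.comp t h3

end Charts

/-! ### Orders of vanishing -/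

/-- Functions whose exponential is, off a finite set, the exponential of a function that is
continuous off that set. -/
def expTrivial (S : Type u) [TopologicalSpace S] : AddSubgroup (S → ℂ) where
  carrier := {lam | ∃ F : Set S, F.Finite ∧ ∃ ℓ : S → ℂ, ∀ w ∉ F, ContinuousAt ℓ w ∧
    Complex.exp (lam w) = Complex.exp (ℓ w)}
  zero_mem' := ⟨∅, finite_empty, 0, fun _ _ => ⟨continuousAt_const, rfl⟩⟩
  add_mem' := by
    rintro a b ⟨F, hF, ℓ, h⟩ ⟨F', hF', ℓ', h'⟩
    refine ⟨F ∪ F', hF.union hF', ℓ + ℓ', fun w hw => ?_⟩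
    have h1 := h w fun hw' => hw (Or.inl hw')
    have h2 := h' w fun hw' => hw (Or.inr hw')
    exact ⟨h1.1.add h2.1, by rw [Pi.add_apply, Pi.add_apply, Complex.exp_add, Complex.exp_add,
      h1.2, h2.2]⟩
  neg_mem' := by
    rintro a ⟨F, hF, ℓ, h⟩
    exact ⟨F, hF, -ℓ, fun w hw => ⟨(h w hw).1.neg, by
      rw [Pi.neg_apply, Pi.neg_apply, Complex.exp_neg, Complex.exp_neg, (h w hw).2]⟩⟩

section Charts

variable {S : Type u} [TopologicalSpace S] [ChartedSpace (EuclideanSpace ℝ (Fin 2)) S]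

/-- A function on a punctured neighbourhood of `w` that is the product of the `n`-th power of the
local coordinate at `w` and of the exponential of a continuous function. -/
def HasOrder (h : S → ℂ) (w : S) (n : ℤ) : Prop :=
  ∃ m : S → ℂ, ∀ᶠ v in 𝓝[≠] w, ContinuousAt m v ∧
    h v = (cchart w v - cchart w w) ^ n * Complex.exp (m v)

theorem eventually_cchart_sub_ne_zero (p w : S) (hw : w ∈ (cchart p).source) :
    ∀ᶠ v in 𝓝[≠] w, v ∈ (cchart p).source ∧ cchart p v - cchart p w ≠ 0 := by
  rw [eventually_nhdsWithin_iff]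
  filter_upwards [(cchart p).open_source.mem_nhds hw] with v hv hne
  exact ⟨hv, sub_ne_zero.2 fun h => hne ((cchart p).injOn hv hw h)⟩

theorem HasOrder.congr {h h' : S → ℂ} {w : S} {n : ℤ} (hh : HasOrder h w n)
    (he : h' =ᶠ[𝓝[≠] w] h) : HasOrder h' w n := by
  obtain ⟨m, hm⟩ := hh
  refine ⟨m, ?_⟩
  filter_upwards [hm, he] with v hv hv'
  rwa [hv']

theorem HasOrder.mul {h h' : S → ℂ} {w : S} {n n' : ℤ} (hh : HasOrder h w n)
    (hh' : HasOrder h' w n') : HasOrder (fun v => h v * h' v) w (n + n') := by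
  obtain ⟨m, hm⟩ := hh
  obtain ⟨m', hm'⟩ := hh'
  refine ⟨fun v => m v + m' v, ?_⟩
  filter_upwards [hm, hm', eventually_cchart_sub_ne_zero w w (mem_cchart_source w)] with v hv hv' h0
  refine ⟨hv.1.add hv'.1, ?_⟩
  rw [hv.2, hv'.2, zpow_add₀ h0.2, Complex.exp_add]
  ring

theorem HasOrder.inv {h : S → ℂ} {w : S} {n : ℤ} (hh : HasOrder h w n) :
    HasOrder (fun v => (h v)⁻¹) w (-n) := by
  obtain ⟨m, hm⟩ := hh
  refine ⟨fun v => -m v, ?_⟩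
  filter_upwards [hm] with v hv
  refine ⟨hv.1.neg, ?_⟩
  rw [hv.2, mul_inv, zpow_neg, Complex.exp_neg]

theorem hasOrder_zero_of_continuousAt {h : S → ℂ} {w : S} (hc : ∀ᶠ v in 𝓝 w, ContinuousAt h v)
    (h0 : h w ≠ 0) : HasOrder h w 0 := by
  obtain ⟨m, hm⟩ := exists_local_log hc.self_of_nhds h0
  refine ⟨m, eventually_nhdsWithin_of_eventually_nhds ?_⟩
  filter_upwards [hm, hc] with v hv hv'
  exact ⟨hv.1 hv', by rw [zpow_zero, one_mul, hv.2]⟩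

theorem HasOrder.prod {ι : Type*} (s : Finset ι) {h : ι → S → ℂ} {w : S} {n : ι → ℤ}
    (hh : ∀ i ∈ s, HasOrder (h i) w (n i)) :
    HasOrder (fun v => ∏ i ∈ s, h i v) w (∑ i ∈ s, n i) := by
  classical
  induction s using Finset.induction_on with
  | empty =>
    simpa using hasOrder_zero_of_continuousAt (w := w) (h := fun _ => (1 : ℂ))
      (Eventually.of_forall fun _ => continuousAt_const) one_ne_zero
  | insert i s hi ih =>
    simp only [Finset.prod_insert hi, Finset.sum_insert hi]
    exact (hh i (Finset.mem_insert_self _ _)).mul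
      (ih fun j hj => hh j (Finset.mem_insert_of_mem hj))

/-! ### Logarithms of functions with a zero and a pole in a disc -/

variable (S) in
/-- A closed coordinate disc around a point, in the preferred chart there. -/
structure Disc where
  base : S
  radius : ℝ
  pos : 0 < radius
  closedBall_subset : Metric.closedBall (cchart base base) radius ⊆ (cchart base).target

theorem exists_disc (p : S) : ∃ D : Disc S, D.base = p := by
  obtain ⟨R, hR, h⟩ := Metric.nhds_basis_closedBall.mem_iff.1
    ((cchart p).open_target.mem_nhds ((cchart p).map_source (mem_cchart_source p)))
  exact ⟨⟨p, R, hR, h⟩, rfl⟩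

namespace Disc

variable (D : Disc S)

/-- The coordinate of a disc. -/
noncomputable abbrev z : OpenPartialHomeomorph S ℂ := cchart D.base

/-- The centre of a disc in its coordinate. -/
noncomputable abbrev c : ℂ := D.z D.base

/-- A smaller concentric disc. For two of its points `x` and `y`, the quotient
`(ζ - y) / (ζ - x)` lies within distance `1` of `1` for all `ζ` that are at least half of the
radius away from the centre. -/
def core : Set S := D.z.source ∩ D.z ⁻¹' Metric.ball D.c (D.radius / 6)

theorem isOpen_core : IsOpen D.core := D.z.isOpen_inter_preimage Metric.isOpen_ball

theorem base_mem_core : D.base ∈ D.core :=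
  ⟨mem_cchart_source _, Metric.mem_ball_self (by linarith [D.pos])⟩

/-- A radial cutoff function, equal to `1` up to half of the radius and to `0` from the radius
on. -/
noncomputable def cutoff (ζ : ℂ) : ℝ := max 0 (min 1 (2 - 2 * ‖ζ - D.c‖ / D.radius))

theorem continuous_cutoff : Continuous D.cutoff := by
  unfold cutoff
  fun_prop

theorem cutoff_eq_one {ζ : ℂ} (h : ‖ζ - D.c‖ ≤ D.radius / 2) : D.cutoff ζ = 1 := by
  have : 2 * ‖ζ - D.c‖ / D.radius ≤ 1 := by
    rw [div_le_one D.pos]; linarith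
  rw [cutoff, min_eq_left (by linarith), max_eq_right zero_le_one]

theorem cutoff_eq_zero {ζ : ℂ} (h : D.radius ≤ ‖ζ - D.c‖) : D.cutoff ζ = 0 := by
  have : 2 ≤ 2 * ‖ζ - D.c‖ / D.radius := by
    rw [le_div_iff₀ D.pos]; linarith
  rw [cutoff, min_eq_right (by linarith), max_eq_left (by linarith)]

open Classical in
/-- A function of the coordinate, cut off and extended by zero to the surface. -/
noncomputable def ext (B : ℂ → ℂ) (w : S) : ℂ :=
  if w ∈ D.z.source then D.cutoff (D.z w) * B (D.z w) else 0

theorem ext_of_mem {B : ℂ → ℂ} {w : S} (hw : w ∈ D.z.source) :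
    D.ext B w = D.cutoff (D.z w) * B (D.z w) := if_pos hw

theorem ext_of_norm_le {B : ℂ → ℂ} {w : S} (hw : w ∈ D.z.source)
    (h : ‖D.z w - D.c‖ ≤ D.radius / 2) : D.ext B w = B (D.z w) := by
  rw [ext_of_mem _ hw, cutoff_eq_one _ h, Complex.ofReal_one, one_mul]

theorem continuousAt_ext [T2Space S] {B : ℂ → ℂ} {w : S}
    (h : w ∈ D.z.source → ContinuousAt B (D.z w)) : ContinuousAt (D.ext B) w := by
  by_cases hw : w ∈ D.z.source
  · have h1 : ContinuousAt (fun v => (D.cutoff (D.z v) : ℂ) * B (D.z v)) w := by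
      have hz := D.z.continuousAt hw
      have hc : ContinuousAt (fun v => (D.cutoff (D.z v) : ℂ)) w :=
        (Complex.continuous_ofReal.comp D.continuous_cutoff).continuousAt.comp hz
      exact hc.mul ((h hw).comp hz)
    refine h1.congr ?_
    filter_upwards [D.z.open_source.mem_nhds hw] with v hv
    rw [D.ext_of_mem hv]
  · have hK : IsCompact (D.z.symm '' Metric.closedBall D.c D.radius) :=
      (isCompact_closedBall _ _).image_of_continuousOn
        (D.z.symm.continuousOn.mono D.closedBall_subset)
    have hwK : w ∉ D.z.symm '' Metric.closedBall D.c D.radius := by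
      rintro ⟨y, hy, rfl⟩
      exact hw (D.z.map_target (D.closedBall_subset hy))
    have h0 : D.ext B =ᶠ[𝓝 w] fun _ => 0 := by
      filter_upwards [hK.isClosed.isOpen_compl.mem_nhds hwK] with v hv
      by_cases hvs : v ∈ D.z.source
      · rw [D.ext_of_mem hvs, cutoff_eq_zero, Complex.ofReal_zero, zero_mul]
        by_contra! hc
        refine hv ⟨D.z v, ?_, D.z.left_inv hvs⟩
        rw [Metric.mem_closedBall, dist_eq_norm]
        exact hc.le
      · exact if_neg hvs
    exact continuousAt_const.congr h0.symm

/-- A function whose exponential has a simple zero at `y` and a simple pole at `x`, and is `1`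
outside the disc. It is used for points `x`, `y` of the core. It is continuous only off a cut
between `x` and `y`, but it is the exponential that matters. -/
noncomputable def lam (x y : S) : S → ℂ :=
  D.ext fun ζ => Complex.log ((ζ - D.z y) / (ζ - D.z x))

variable {D}

theorem norm_ratio_sub_one_lt {a b ζ : ℂ} (ha : ‖a - D.c‖ < D.radius / 6)
    (hb : ‖b - D.c‖ < D.radius / 6) (hζ : D.radius / 2 ≤ ‖ζ - D.c‖) :
    ζ ≠ a ∧ ‖(ζ - b) / (ζ - a) - 1‖ < 1 := by
  have h1 : ‖ζ - D.c‖ ≤ ‖ζ - a‖ + ‖a - D.c‖ := norm_sub_le_norm_sub_add_norm_sub _ _ _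
  have h2 : 0 < ‖ζ - a‖ := by linarith [D.pos]
  have h3 : ‖a - b‖ ≤ ‖a - D.c‖ + ‖b - D.c‖ := by
    rw [norm_sub_rev b]; exact norm_sub_le_norm_sub_add_norm_sub _ _ _
  refine ⟨fun h => by simp [h] at h2, ?_⟩
  rw [div_sub_one (norm_pos_iff.1 h2), norm_div, div_lt_one h2]
  rw [show ζ - b - (ζ - a) = a - b by ring]
  linarith

theorem norm_sub_lt_of_mem_core {x : S} (hx : x ∈ D.core) : ‖D.z x - D.c‖ < D.radius / 6 := by
  rw [← dist_eq_norm]; exact hx.2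

theorem continuousAt_lam [T2Space S] {x y w : S} (hx : x ∈ D.core) (hy : y ∈ D.core)
    (hw : w ∈ D.z.source → D.radius / 2 ≤ ‖D.z w - D.c‖) : ContinuousAt (D.lam x y) w := by
  refine D.continuousAt_ext fun hws => ?_
  obtain ⟨h1, h2⟩ := norm_ratio_sub_one_lt (norm_sub_lt_of_mem_core hx)
    (norm_sub_lt_of_mem_core hy) (hw hws)
  refine ContinuousAt.clog ?_ (mem_slitPlane_of_norm_sub_one_lt h2)
  exact (continuousAt_id.sub continuousAt_const).div (continuousAt_id.sub continuousAt_const)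
    (sub_ne_zero.2 h1)

theorem exp_lam_of_norm_le {x y w : S} (hx : x ∈ D.core) (hy : y ∈ D.core) (hw : w ∈ D.z.source)
    (h : ‖D.z w - D.c‖ ≤ D.radius / 2) (hwx : w ≠ x) (hwy : w ≠ y) :
    Complex.exp (D.lam x y w) = (D.z w - D.z y) / (D.z w - D.z x) := by
  rw [lam, D.ext_of_norm_le hw h, Complex.exp_log]
  exact div_ne_zero (sub_ne_zero.2 fun h => hwy (D.z.injOn hw hy.1 h))
    (sub_ne_zero.2 fun h => hwx (D.z.injOn hw hx.1 h))

theorem mem_core_norm_lt {x : S} (hx : x ∈ D.core) : ‖D.z x - D.c‖ < D.radius / 2 := by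
  linarith [norm_sub_lt_of_mem_core hx, D.pos]

theorem eventually_norm_lt {w : S} (hw : w ∈ D.z.source) (h : ‖D.z w - D.c‖ < D.radius / 2) :
    ∀ᶠ v in 𝓝 w, v ∈ D.z.source ∧ ‖D.z v - D.c‖ < D.radius / 2 := by
  have h1 : ContinuousAt (fun v => ‖D.z v - D.c‖) w := ((D.z.continuousAt hw).sub_const _).norm
  have h2 : ∀ᶠ v in 𝓝 w, v ∈ D.z.source := D.z.open_source.mem_nhds hw
  exact h2.and (h1.eventually_lt_const h)

theorem lam_self {x : S} : D.lam x x = 0 := by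
  ext w
  by_cases hw : w ∈ D.z.source
  · rw [lam, D.ext_of_mem hw]
    by_cases h : D.z w - D.z x = 0
    · simp [h]
    · simp [div_self h]
  · exact if_neg hw

theorem continuousAt_exp_lam [T2Space S] {x y w : S} (hx : x ∈ D.core) (hy : y ∈ D.core)
    (hwx : w ≠ x) (hwy : w ≠ y) : ContinuousAt (fun v => Complex.exp (D.lam x y v)) w := by
  by_cases hw : w ∈ D.z.source → D.radius / 2 ≤ ‖D.z w - D.c‖
  · exact (continuousAt_lam hx hy hw).cexp
  · push Not at hw
    have h1 : (fun v => Complex.exp (D.lam x y v)) =ᶠ[𝓝 w]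
        fun v => (D.z v - D.z y) / (D.z v - D.z x) := by
      filter_upwards [eventually_norm_lt hw.1 hw.2, isOpen_ne.mem_nhds hwx,
        isOpen_ne.mem_nhds hwy] with v hv hvx hvy
      exact exp_lam_of_norm_le hx hy hv.1 hv.2.le hvx hvy
    have hz := D.z.continuousAt hw.1
    have h2 : ContinuousAt (fun v => (D.z v - D.z y) / (D.z v - D.z x)) w :=
      (hz.sub_const _).div (hz.sub_const _)
        (sub_ne_zero.2 fun h => hwx (D.z.injOn hw.1 hx.1 h))
    exact h2.congr h1.symm

open Classical in
/-- The difference of a coordinate and its value at `x` has order `1` at `x`, and `0` elsewhere. -/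
theorem hasOrder_sub [IsManifold (𝓡 2) ∞ S] [OrientedAtlas S] {x w : S} (hx : x ∈ D.z.source)
    (hw : w ∈ D.z.source) :
    HasOrder (fun v => D.z v - D.z x) w (if x = w then 1 else 0) := by
  split_ifs with h
  · subst h
    obtain ⟨k, hk, V, hV, hVp, hVq, hVk⟩ :=
      exists_eventually_norm_div_sub_one_lt (mem_cchart_source x) hw
    refine ⟨fun v => Complex.log ((D.z v - D.z x) / (k * (cchart x v - cchart x x))) +
      Complex.log k, ?_⟩
    have hV' : interior V ∈ 𝓝 x := interior_mem_nhds.2 hV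
    filter_upwards [eventually_cchart_sub_ne_zero x x (mem_cchart_source x), self_mem_nhdsWithin,
      mem_nhdsWithin_of_mem_nhds hV'] with v hv hne hvV'
    have hvV := interior_subset hvV'
    have hlt := hVk x (mem_of_mem_nhds hV) v hvV hne
    have hk' := mul_ne_zero hk hv.2
    refine ⟨?_, ?_⟩
    · refine ContinuousAt.add (ContinuousAt.clog ?_ (mem_slitPlane_of_norm_sub_one_lt hlt))
        continuousAt_const
      exact ((D.z.continuousAt (hVq hvV)).sub_const _).div
        ((((cchart x).continuousAt hv.1).sub_const _).const_mul _) hk'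
    · rw [Complex.exp_add, Complex.exp_log hk, Complex.exp_log (ne_zero_of_norm_sub_one_lt hlt),
        zpow_one]
      have := hv.2
      field_simp
  · refine hasOrder_zero_of_continuousAt ?_ (sub_ne_zero.2 fun h' => h (D.z.injOn hw hx h').symm)
    filter_upwards [D.z.open_source.mem_nhds hw] with v hv
    exact (D.z.continuousAt hv).sub_const _

open Classical in
/-- The order is `1` at `y`, `-1` at `x`, and `0` elsewhere. -/
theorem hasOrder_exp_lam [T2Space S] [IsManifold (𝓡 2) ∞ S] [OrientedAtlas S] {x y : S}
    (hx : x ∈ D.core) (hy : y ∈ D.core) (w : S) :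
    HasOrder (fun v => Complex.exp (D.lam x y v)) w
      ((if y = w then 1 else 0) - (if x = w then 1 else 0)) := by
  by_cases hw : w ∈ D.z.source ∧ ‖D.z w - D.c‖ < D.radius / 2
  · refine ((hasOrder_sub hy.1 hw.1).mul (hasOrder_sub hx.1 hw.1).inv).congr ?_
    have h1 : ∀ a : S, ∀ᶠ v in 𝓝[≠] w, v ≠ a := by
      intro a
      by_cases ha : w = a
      · subst ha; exact self_mem_nhdsWithin
      · exact mem_nhdsWithin_of_mem_nhds (isOpen_ne.mem_nhds ha)
    filter_upwards [mem_nhdsWithin_of_mem_nhds (eventually_norm_lt hw.1 hw.2), h1 x, h1 y]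
      with v hv hvx hvy
    rw [exp_lam_of_norm_le hx hy hv.1 hv.2.le hvx hvy, div_eq_mul_inv]
  · have hwx : w ≠ x := by
      rintro rfl; exact hw ⟨hx.1, mem_core_norm_lt hx⟩
    have hwy : w ≠ y := by
      rintro rfl; exact hw ⟨hy.1, mem_core_norm_lt hy⟩
    rw [if_neg hwx.symm, if_neg hwy.symm, sub_zero]
    refine hasOrder_zero_of_continuousAt ?_ (Complex.exp_ne_zero _)
    filter_upwards [isOpen_ne.mem_nhds hwx, isOpen_ne.mem_nhds hwy] with v hvx hvy
    exact continuousAt_exp_lam hx hy hvx hvy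

/-- In one disc, the functions `lam` are additive up to exponentials. -/
theorem lam_add_lam_sub_lam_mem {x y t : S} (hx : x ∈ D.core) (hy : y ∈ D.core)
    (ht : t ∈ D.core) : D.lam x y + D.lam y t - D.lam x t ∈ expTrivial S := by
  refine ⟨{x, y, t}, by simp, 0, fun w hw => ⟨continuousAt_const, ?_⟩⟩
  simp only [mem_insert_iff, mem_singleton_iff, not_or] at hw
  by_cases hws : w ∈ D.z.source
  · rcases le_or_gt ‖D.z w - D.c‖ (D.radius / 2) with h | h
    · rw [Pi.sub_apply, Pi.add_apply, Complex.exp_sub, Complex.exp_add,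
        exp_lam_of_norm_le hx hy hws h hw.1 hw.2.1, exp_lam_of_norm_le hy ht hws h hw.2.1 hw.2.2,
        exp_lam_of_norm_le hx ht hws h hw.1 hw.2.2]
      have h1 : D.z w - D.z x ≠ 0 := sub_ne_zero.2 fun h => hw.1 (D.z.injOn hws hx.1 h)
      have h2 : D.z w - D.z y ≠ 0 := sub_ne_zero.2 fun h => hw.2.1 (D.z.injOn hws hy.1 h)
      have h3 : D.z w - D.z t ≠ 0 := sub_ne_zero.2 fun h => hw.2.2 (D.z.injOn hws ht.1 h)
      rw [Pi.zero_apply, Complex.exp_zero]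
      field_simp
    · have hx' := norm_sub_lt_of_mem_core hx
      have hy' := norm_sub_lt_of_mem_core hy
      have ht' := norm_sub_lt_of_mem_core ht
      obtain ⟨hnx, h1⟩ := norm_ratio_sub_one_lt hx' hy' h.le
      obtain ⟨hny, h2⟩ := norm_ratio_sub_one_lt hy' ht' h.le
      obtain ⟨-, h3⟩ := norm_ratio_sub_one_lt hx' ht' h.le
      have e : Complex.log ((D.z w - D.z y) / (D.z w - D.z x)) +
          Complex.log ((D.z w - D.z t) / (D.z w - D.z y)) =
          Complex.log ((D.z w - D.z t) / (D.z w - D.z x)) := by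
        refine exp_inj_of_abs_im_sub_lt ?_ ?_
        · rw [Complex.exp_add, Complex.exp_log (ne_zero_of_norm_sub_one_lt h1),
            Complex.exp_log (ne_zero_of_norm_sub_one_lt h2),
            Complex.exp_log (ne_zero_of_norm_sub_one_lt h3)]
          have := sub_ne_zero.2 hnx
          have := sub_ne_zero.2 hny
          field_simp
        · have a1 := abs_log_im_lt_of_norm_sub_one_lt h1
          have a2 := abs_log_im_lt_of_norm_sub_one_lt h2
          have a3 := abs_log_im_lt_of_norm_sub_one_lt h3
          rw [abs_lt] at *
          rw [Complex.add_im]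
          constructor <;> linarith [Real.pi_pos]
      rw [Pi.sub_apply, Pi.add_apply, lam, lam, lam, D.ext_of_mem hws, D.ext_of_mem hws,
        D.ext_of_mem hws, ← e]
      rw [← mul_add, sub_self, Pi.zero_apply]
  · simp [lam, ext, hws]

/-- Functions of two discs for the same pair of close points agree up to exponentials. -/
theorem exists_lam_sub_lam_mem [T2Space S] [CompactSpace S] [IsManifold (𝓡 2) ∞ S]
    [OrientedAtlas S] {D D' : Disc S} {w₀ : S} (h : w₀ ∈ D.core) (h' : w₀ ∈ D'.core) :
    ∃ V ∈ 𝓝 w₀, ∀ x ∈ V, ∀ y ∈ V, D.lam x y - D'.lam x y ∈ expTrivial S := by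
  obtain ⟨k, hk, V₁, hV₁, hVq, hVp, hVk⟩ :=
    exists_eventually_norm_div_sub_one_lt h'.1 h.1
  -- `V₀` lies in both cores, `W` is a smaller closed neighbourhood
  obtain ⟨V₀, hV₀, hV₀o, hwV₀⟩ := mem_nhds_iff.1 (inter_mem hV₁
    (inter_mem (D.isOpen_core.mem_nhds h) (D'.isOpen_core.mem_nhds h')))
  obtain ⟨W, hW, hWc, hWV⟩ := exists_mem_nhds_isClosed_subset (hV₀o.mem_nhds hwV₀)
  -- near `w₀`, the quotient of coordinate differences is close to `1` outside `W`
  have hfar : ∀ E : Disc S, w₀ ∈ E.core → ∃ V ∈ 𝓝 w₀, V ⊆ E.core ∧ ∀ x ∈ V, ∀ y ∈ V, ∀ w ∉ W,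
      w ∈ E.z.source → E.z w ≠ E.z x ∧ ‖(E.z w - E.z y) / (E.z w - E.z x) - 1‖ < 1 := by
    intro E hE
    have h1 : E.z.target ∩ E.z.symm ⁻¹' W ∈ 𝓝 (E.z w₀) := by
      refine inter_mem (E.z.open_target.mem_nhds (E.z.map_source hE.1)) ?_
      refine (E.z.symm.continuousAt (E.z.map_source hE.1)).preimage_mem_nhds ?_
      rwa [E.z.left_inv hE.1]
    obtain ⟨ρ, hρ, hball⟩ := Metric.mem_nhds_iff.1 h1
    refine ⟨E.core ∩ E.z ⁻¹' Metric.ball (E.z w₀) (ρ / 3), inter_mem (E.isOpen_core.mem_nhds hE)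
      ((E.z.continuousAt hE.1).preimage_mem_nhds (Metric.ball_mem_nhds _ (by linarith))),
      inter_subset_left, ?_⟩
    intro x hx y hy w hwW hws
    have hd : ρ ≤ dist (E.z w) (E.z w₀) := by
      by_contra! hc
      refine hwW ?_
      have := (hball hc).2
      rwa [mem_preimage, E.z.left_inv hws] at this
    have hx' : dist (E.z x) (E.z w₀) < ρ / 3 := hx.2
    have hy' : dist (E.z y) (E.z w₀) < ρ / 3 := hy.2
    have h2 : ρ / 3 * 2 < dist (E.z w) (E.z x) := by
      linarith [dist_triangle (E.z w) (E.z x) (E.z w₀)]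
    have h3 : dist (E.z x) (E.z y) < ρ / 3 * 2 := by
      linarith [dist_triangle_right (E.z x) (E.z y) (E.z w₀)]
    rw [dist_eq_norm] at h2 h3
    have h4 : 0 < ‖E.z w - E.z x‖ := by linarith
    refine ⟨sub_ne_zero.1 (norm_pos_iff.1 h4), ?_⟩
    rw [div_sub_one (norm_pos_iff.1 h4), norm_div, div_lt_one h4]
    rw [show E.z w - E.z y - (E.z w - E.z x) = E.z x - E.z y by ring]
    linarith
  have hcont : ∀ E : Disc S, ∀ V : Set S, V ⊆ E.core → (∀ x ∈ V, ∀ y ∈ V, ∀ w ∉ W,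
      w ∈ E.z.source → E.z w ≠ E.z x ∧ ‖(E.z w - E.z y) / (E.z w - E.z x) - 1‖ < 1) →
      ∀ x ∈ V, ∀ y ∈ V, ∀ w ∉ W, ContinuousAt (E.lam x y) w := by
    intro E V _ hV x hx y hy w hw
    refine E.continuousAt_ext fun hws => ?_
    obtain ⟨h1, h2⟩ := hV x hx y hy w hw hws
    refine ContinuousAt.clog ?_ (mem_slitPlane_of_norm_sub_one_lt h2)
    exact (continuousAt_id.sub continuousAt_const).div (continuousAt_id.sub continuousAt_const)
      (sub_ne_zero.2 h1)
  obtain ⟨V, hV, hVD, hVlt⟩ := hfar D h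
  obtain ⟨V', hV', hVD', hVlt'⟩ := hfar D' h'
  refine ⟨V ∩ V' ∩ V₀, inter_mem (inter_mem hV hV') (hV₀o.mem_nhds hwV₀), ?_⟩
  rintro x ⟨⟨hxV, hxV'⟩, hxV₀⟩ y ⟨⟨hyV, hyV'⟩, hyV₀⟩
  classical
  -- on `V₀`, the difference is a logarithm of `T y / T x`
  let T : S → S → ℂ := fun a w => (D.z w - D.z a) / (k * (D'.z w - D'.z a))
  have hT : ∀ a ∈ V₀, ∀ w ∈ V₀, w ≠ a → ‖T a w - 1‖ < 1 := fun a ha w hw hne =>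
    hVk a (hV₀ ha).1 w (hV₀ hw).1 hne
  have hTc : ∀ a ∈ V₀, ∀ w ∈ V₀, w ≠ a → ContinuousAt (fun w => Complex.log (T a w)) w := by
    intro a ha w hw hne
    refine ContinuousAt.clog ?_ (mem_slitPlane_of_norm_sub_one_lt (hT a ha w hw hne))
    refine ((D.z.continuousAt (hVp (hV₀ hw).1)).sub_const _).div
      (((D'.z.continuousAt (hVq (hV₀ hw).1)).sub_const _).const_mul _) (mul_ne_zero hk ?_)
    exact sub_ne_zero.2 fun h => hne (D'.z.injOn (hVq (hV₀ hw).1) (hVq (hV₀ ha).1) h)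
  have hexp : ∀ w ∈ V₀, w ≠ x → w ≠ y → Complex.exp ((D.lam x y - D'.lam x y) w) =
      Complex.exp (Complex.log (T y w) - Complex.log (T x w)) := by
    intro w hw hwx hwy
    have hwD := (hV₀ hw).2.1
    have hwD' := (hV₀ hw).2.2
    rw [Pi.sub_apply, Complex.exp_sub, Complex.exp_sub,
      exp_lam_of_norm_le (hVD hxV) (hVD hyV) hwD.1 (mem_core_norm_lt hwD).le hwx hwy,
      exp_lam_of_norm_le (hVD' hxV') (hVD' hyV') hwD'.1 (mem_core_norm_lt hwD').le hwx hwy,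
      Complex.exp_log (ne_zero_of_norm_sub_one_lt (hT y hyV₀ w hw hwy)),
      Complex.exp_log (ne_zero_of_norm_sub_one_lt (hT x hxV₀ w hw hwx))]
    have h1 : D.z w - D.z x ≠ 0 := sub_ne_zero.2 fun h => hwx (D.z.injOn hwD.1 (hVD hxV).1 h)
    have h3 : D'.z w - D'.z x ≠ 0 :=
      sub_ne_zero.2 fun h => hwx (D'.z.injOn hwD'.1 (hVD' hxV').1 h)
    have h4 : D'.z w - D'.z y ≠ 0 :=
      sub_ne_zero.2 fun h => hwy (D'.z.injOn hwD'.1 (hVD' hyV').1 h)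
    simp only [T]
    field_simp
  refine ⟨{x, y}, by simp, fun w => if w ∈ V₀ then Complex.log (T y w) - Complex.log (T x w)
    else (D.lam x y - D'.lam x y) w, fun w hw => ?_⟩
  simp only [mem_insert_iff, mem_singleton_iff, not_or] at hw
  by_cases hwV : w ∈ V₀
  · refine ⟨?_, by simp only [if_pos hwV]; exact hexp w hwV hw.1 hw.2⟩
    refine ((hTc y hyV₀ w hwV hw.2).sub (hTc x hxV₀ w hwV hw.1)).congr ?_
    filter_upwards [hV₀o.mem_nhds hwV] with v hv
    exact (if_pos hv).symm
  · refine ⟨?_, by simp only [if_neg hwV]⟩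
    have hwW : w ∉ W := fun h => hwV (hWV h)
    refine ((hcont D V hVD hVlt x hxV y hyV w hwW).sub
      (hcont D' V' hVD' hVlt' x hxV' y hyV' w hwW)).congr ?_
    have hwx : w ≠ x := hw.1
    have hwy : w ≠ y := hw.2
    filter_upwards [hWc.isOpen_compl.mem_nhds hwW, isOpen_ne.mem_nhds hwx,
      isOpen_ne.mem_nhds hwy] with v hvW hvx hvy
    split_ifs with hv
    · -- both sides are logarithms of the same number, with small imaginary parts
      refine exp_inj_of_abs_im_sub_lt (hexp v hv hvx hvy) ?_
      have hvD := (hV₀ hv).2.1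
      have hvD' := (hV₀ hv).2.2
      have a1 := abs_log_im_lt_of_norm_sub_one_lt (hT y hyV₀ v hv hvy)
      have a2 := abs_log_im_lt_of_norm_sub_one_lt (hT x hxV₀ v hv hvx)
      have a3 := abs_log_im_lt_of_norm_sub_one_lt (hVlt x hxV y hyV v hvW hvD.1).2
      have a4 := abs_log_im_lt_of_norm_sub_one_lt (hVlt' x hxV' y hyV' v hvW hvD'.1).2
      rw [← ext_of_norm_le D (B := fun ζ => Complex.log ((ζ - D.z y) / (ζ - D.z x))) hvD.1
        (mem_core_norm_lt hvD).le] at a3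
      rw [← ext_of_norm_le D' (B := fun ζ => Complex.log ((ζ - D'.z y) / (ζ - D'.z x))) hvD'.1
        (mem_core_norm_lt hvD').le] at a4
      change |(D.lam x y v).im| < _ at a3
      change |(D'.lam x y v).im| < _ at a4
      rw [abs_lt] at *
      rw [Pi.sub_apply, Complex.sub_im, Complex.sub_im]
      constructor <;> linarith [Real.pi_pos]
    · rfl

end Disc
end Charts

/-! ### The dual class of a closed curve -/

/-- Primitives on the intervals `[-n, n]`, normalized at `0`, fit together. -/
theorem LocallyAdditive.exists_isPrimitive_real {X G : Type*} [TopologicalSpace X]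
    [AddCommGroup G] {κ : X → X → G} (hκ : LocallyAdditive κ) {σ : ℝ → X} (hσ : Continuous σ) :
    ∃ h : ℝ → G, IsPrimitive κ σ h := by
  have hex : ∀ n : ℕ, ∃ h : Icc (-n : ℝ) n → G, IsPrimitive κ (fun t : Icc (-n : ℝ) n => σ t) h :=
    fun n => hκ.exists_isPrimitive isCompact_Icc (convex_Icc _ _)
      (hσ.comp continuous_subtype_val)
  choose H hH using hex
  have hpc : ∀ n : ℕ, PreconnectedSpace (Icc (-n : ℝ) n) := fun n =>
    isPreconnected_iff_preconnectedSpace.1 isPreconnected_Icc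
  have h0 : ∀ n : ℕ, (0 : ℝ) ∈ Icc (-n : ℝ) n := fun n => by simp
  have hagree : ∀ (m n : ℕ) (hmn : m ≤ n) (t : ℝ) (ht : t ∈ Icc (-m : ℝ) m)
      (ht' : t ∈ Icc (-n : ℝ) n),
      H n ⟨t, ht'⟩ - H n ⟨0, h0 n⟩ = H m ⟨t, ht⟩ - H m ⟨0, h0 m⟩ := by
    intro m n hmn t ht ht'
    have hmn' : (m : ℝ) ≤ n := by exact_mod_cast hmn
    have hsub : ∀ s : Icc (-m : ℝ) m, (s : ℝ) ∈ Icc (-n : ℝ) n := fun s =>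
      ⟨by linarith [s.2.1], by linarith [s.2.2]⟩
    have h1 := (hH n).comp (L := Icc (-m : ℝ) m) (φ := fun s => ⟨s, hsub s⟩)
      (continuous_subtype_val.subtype_mk _)
    have := hpc m
    exact h1.sub_eq_sub (hH m) ⟨0, h0 m⟩ ⟨t, ht⟩
  have hmem : ∀ t : ℝ, t ∈ Icc (-(⌈|t|⌉₊ : ℝ)) ⌈|t|⌉₊ := fun t => abs_le.1 (Nat.le_ceil _)
  refine ⟨fun t => H ⌈|t|⌉₊ ⟨t, hmem t⟩ - H ⌈|t|⌉₊ ⟨0, h0 _⟩, fun t => ?_⟩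
  obtain ⟨n, hn⟩ := exists_nat_gt |t|
  rw [abs_lt] at hn
  have h1 := (hH n) ⟨t, hn.1.le, hn.2.le⟩
  rw [nhds_subtype, eventually_comap] at h1
  filter_upwards [h1, Ioo_mem_nhds hn.1 hn.2] with s hs hsn
  have h2 := hs ⟨s, hsn.1.le, hsn.2.le⟩ rfl
  have h3 : ∀ (r : ℝ) (hr : r ∈ Ioo (-n : ℝ) n),
      H ⌈|r|⌉₊ ⟨r, hmem r⟩ - H ⌈|r|⌉₊ ⟨0, h0 _⟩ =
        H n ⟨r, hr.1.le, hr.2.le⟩ - H n ⟨0, h0 n⟩ := by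
    intro r hr
    refine (hagree _ _ ?_ _ _ _).symm
    exact Nat.ceil_le.2 (abs_lt.2 hr).le
  rw [h3 s hsn, h3 t hn, sub_sub_sub_cancel_right, h2]

section Charts

variable {S : Type u} [TopologicalSpace S] [ChartedSpace (EuclideanSpace ℝ (Fin 2)) S]

theorem ClosedCurve.restrict_zero_one (α : ClosedCurve S) (h : α 0 = α 1) (t : unitInterval) :
    (α.restrict 0 1 h).toMap t = α t := by
  change α (0 + (1 - 0) * (t : ℝ)) = α t
  simp

/-- The class of `Disc.lam` does not depend on the disc, for close points, and defines a locally
additive function. -/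
theorem exists_locallyAdditive_lam (S : Type u) [TopologicalSpace S]
    [ChartedSpace (EuclideanSpace ℝ (Fin 2)) S] [T2Space S] [CompactSpace S]
    [IsManifold (𝓡 2) ∞ S] [OrientedAtlas S] :
    ∃ κ : S → S → (S → ℂ) ⧸ expTrivial S, LocallyAdditive κ ∧
      ∀ (D : Disc S), ∀ w ∈ D.core, ∃ V ∈ 𝓝 w, ∀ x ∈ V, ∀ y ∈ V, κ x y = D.lam x y := by
  choose E hE using exists_disc (S := S)
  have hcl : ∀ p, ∃ C ∈ 𝓝 p, IsClosed C ∧ C ⊆ (E p).core := fun p => by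
    have : p ∈ (E p).core := by
      have := (E p).base_mem_core; rwa [hE] at this
    obtain ⟨C, hC, hCc, hCE⟩ := exists_mem_nhds_isClosed_subset ((E p).isOpen_core.mem_nhds this)
    exact ⟨C, hC, hCc, hCE⟩
  choose C hC hCc hCE using hcl
  obtain ⟨T, hT⟩ := CompactSpace.elim_nhds_subcover C hC
  have hi : ∀ x : S, ∃ p ∈ T, x ∈ C p := fun x => by
    have : x ∈ ⋃ p ∈ T, C p := by rw [hT]; trivial
    simpa using this
  choose i hiT hiC using hi
  let κ : S → S → (S → ℂ) ⧸ expTrivial S := fun x y => ((E (i x)).lam x y : S → ℂ)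
  have hκ : ∀ (D : Disc S), ∀ w ∈ D.core, ∃ V ∈ 𝓝 w, ∀ x ∈ V, ∀ y ∈ V, κ x y = D.lam x y := by
    intro D w hw
    have hV : ∀ p, ∃ V ∈ 𝓝 w, w ∈ C p → ∀ x ∈ V, ∀ y ∈ V,
        (((E p).lam x y : S → ℂ) : (S → ℂ) ⧸ expTrivial S) = D.lam x y := by
      intro p
      by_cases hp : w ∈ C p
      · obtain ⟨V, hV, h⟩ := Disc.exists_lam_sub_lam_mem (hCE p hp) hw
        refine ⟨V, hV, fun _ x hx y hy => ?_⟩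
        rw [QuotientAddGroup.eq_iff_sub_mem]
        exact h x hx y hy
      · exact ⟨univ, univ_mem, fun h => absurd h hp⟩
    choose V hV hVeq using hV
    have hoff : ∀ᶠ x in 𝓝 w, ∀ p ∈ T, x ∈ C p → w ∈ C p := by
      rw [Finset.eventually_all]
      intro p _
      by_cases hp : w ∈ C p
      · exact Eventually.of_forall fun _ _ => hp
      · filter_upwards [(hCc p).isOpen_compl.mem_nhds hp] with x hx hxp
        exact absurd hxp hx
    have hin : ∀ᶠ x in 𝓝 w, ∀ p ∈ T, x ∈ V p := by
      rw [Finset.eventually_all]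
      exact fun p _ => hV p
    refine ⟨_, inter_mem hoff hin, fun x hx y hy => ?_⟩
    exact hVeq (i x) (hx.1 _ (hiT x) (hiC x)) x (hx.2 _ (hiT x)) y (hy.2 _ (hiT x))
  refine ⟨κ, fun p => ?_, hκ⟩
  have hp : p ∈ (E p).core := hCE p (mem_of_mem_nhds (hC p))
  obtain ⟨V, hV, h⟩ := hκ (E p) p hp
  refine ⟨V ∩ (E p).core, inter_mem hV ((E p).isOpen_core.mem_nhds hp), ?_⟩
  intro x hx y hy z hz
  rw [h x hx.1 y hy.1, h y hy.1 z hz.1, h x hx.1 z hz.1, ← QuotientAddGroup.mk_add,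
    QuotientAddGroup.eq_iff_sub_mem]
  exact Disc.lam_add_lam_sub_lam_mem hx.2 hy.2 hz.2

/-- The sum of the functions `Disc.lam` along a curve depends, up to exponentials, only on the
homology class of the curve. -/
theorem exists_dual_class (S : Type u) [TopologicalSpace S]
    [ChartedSpace (EuclideanSpace ℝ (Fin 2)) S] [T2Space S] [CompactSpace S]
    [IsManifold (𝓡 2) ∞ S] [OrientedAtlas S] :
    ∃ Φ : H1 S → (S → ℂ) ⧸ expTrivial S, ∀ (α : ClosedCurve S) (s : ℕ → ℝ) (N : ℕ)
      (d : ℕ → Disc S), Monotone s → s N = s 0 + 1 →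
      (∀ i < N, ∀ t ∈ Icc (s i) (s (i + 1)), α t ∈ (d i).core) →
      Φ α.homologyClass =
        ((∑ i ∈ Finset.range N, (d i).lam (α (s i)) (α (s (i + 1))) : S → ℂ) :
          (S → ℂ) ⧸ expTrivial S) := by
  obtain ⟨κ, hκ, hloc⟩ := exists_locallyAdditive_lam S
  obtain ⟨Φ, hΦ⟩ := hκ.exists_onHomology
  refine ⟨Φ, fun α s N d hs hsN hd => ?_⟩
  obtain ⟨h, hh⟩ := hκ.exists_isPrimitive_real α.smooth.continuous
  have h1 : Φ α.homologyClass = h 1 - h 0 := by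
    refine (hΦ _ (fun t => h t) ?_).trans (by simp)
    have := hh.comp (L := unitInterval) continuous_subtype_val
    intro t
    filter_upwards [this t] with t' ht'
    rw [ClosedCurve.restrict_zero_one, ClosedCurve.restrict_zero_one]
    exact ht'
  -- the increment over a period does not depend on the starting time
  have h2 : h 1 - h 0 = h (s 0 + 1) - h (s 0) := by
    have hh' : IsPrimitive κ α.toFun (fun t => h (t + 1)) := by
      intro t
      have hc : Continuous fun t : ℝ => t + 1 := by fun_prop
      filter_upwards [hc.continuousAt.eventually (hh (t + 1))] with t' ht'
      rw [ht', α.periodic t, α.periodic t']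
    have := hh'.sub_eq_sub hh 0 (s 0)
    simp only [zero_add] at this
    rw [sub_eq_sub_iff_add_eq_add] at this ⊢
    rw [add_comm, ← this, add_comm]
  have h3 : ∀ i < N, h (s (i + 1)) - h (s i) =
      ((d i).lam (α (s i)) (α (s (i + 1))) : S → ℂ) := by
    intro i hi
    have hle : s i ≤ s (i + 1) := hs (Nat.le_succ i)
    have : PreconnectedSpace (Icc (s i) (s (i + 1))) :=
      isPreconnected_iff_preconnectedSpace.1 isPreconnected_Icc
    have hp1 := hh.comp (L := Icc (s i) (s (i + 1))) continuous_subtype_val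
    have hp2 : IsPrimitive κ (α.toFun ∘ (Subtype.val : Icc (s i) (s (i + 1)) → ℝ))
        (fun t => (((d i).lam (α (s i)) (α t) : S → ℂ) : (S → ℂ) ⧸ expTrivial S)) := by
      intro t
      obtain ⟨V, hV, hVeq⟩ := hloc (d i) (α t) (hd i hi t t.2)
      have hc : ContinuousAt (fun t : Icc (s i) (s (i + 1)) => α t) t :=
        (α.smooth.continuous.comp continuous_subtype_val).continuousAt
      filter_upwards [hc.preimage_mem_nhds hV] with t' ht'
      have e := hVeq _ (mem_of_mem_nhds hV) _ ht'
      simp only [Function.comp]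
      rw [e, ← QuotientAddGroup.mk_sub, QuotientAddGroup.eq_iff_sub_mem]
      have := Disc.lam_add_lam_sub_lam_mem (hd i hi (s i) ⟨le_rfl, hle⟩) (hd i hi t t.2)
        (hd i hi t' t'.2)
      rw [← neg_mem_iff] at this
      convert this using 1
      abel
    have h4 := hp1.sub_eq_sub hp2 ⟨s i, le_rfl, hle⟩ ⟨s (i + 1), hle, le_rfl⟩
    simp only [Function.comp] at h4
    rw [h4, Disc.lam_self]
    exact sub_zero _
  rw [h1, h2, ← hsN, ← Finset.sum_range_sub (fun i => h (s i)) N,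
    Finset.sum_congr rfl fun i hi => h3 i (Finset.mem_range.1 hi)]
  exact (map_sum (QuotientAddGroup.mk' (expTrivial S)) _ _).symm

end Charts

/-! ### Logarithmic variation along plane arcs -/

/-- The variation of `log (a s - ζ)` for `s` from `s₀` to `s₁`. -/
noncomputable def logVar (a : ℝ → ℂ) (s₀ s₁ : ℝ) (ζ : ℂ) : ℂ :=
  ∫ s in s₀..s₁, deriv a s / (a s - ζ)

section LogVar

variable {a : ℝ → ℂ} {s₀ s₁ : ℝ} {ζ : ℂ}

theorem continuousAt_deriv_of_contDiffAt {s : ℝ} (ha : ContDiffAt ℝ 1 a s) :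
    ContinuousAt (deriv a) s :=
  (ha.fderiv_right (m := 0) (by simp)).continuousAt.clm_apply continuousAt_const

theorem continuousAt_deriv_div {s : ℝ} (ha : ContDiffAt ℝ 1 a s) (hs : a s ≠ ζ) :
    ContinuousAt (fun s => deriv a s / (a s - ζ)) s := by
  exact (continuousAt_deriv_of_contDiffAt ha).div (ha.continuousAt.sub continuousAt_const)
    (sub_ne_zero.2 hs)

theorem intervalIntegrable_logVar (ha : ∀ s ∈ uIcc s₀ s₁, ContDiffAt ℝ 1 a s)
    (hζ : ∀ s ∈ uIcc s₀ s₁, a s ≠ ζ) :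
    IntervalIntegrable (fun s => deriv a s / (a s - ζ)) MeasureTheory.volume s₀ s₁ :=
  ContinuousOn.intervalIntegrable fun s hs =>
    (continuousAt_deriv_div (ha s hs) (hζ s hs)).continuousWithinAt

theorem logVar_add {s₂ : ℝ} (h01 : s₀ ≤ s₁) (h12 : s₁ ≤ s₂)
    (ha : ∀ s ∈ Icc s₀ s₂, ContDiffAt ℝ 1 a s) (hζ : ∀ s ∈ Icc s₀ s₂, a s ≠ ζ) :
    logVar a s₀ s₁ ζ + logVar a s₁ s₂ ζ = logVar a s₀ s₂ ζ := by
  refine intervalIntegral.integral_add_adjacent_intervals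
    (intervalIntegrable_logVar (fun s hs => ?_) fun s hs => ?_)
    (intervalIntegrable_logVar (fun s hs => ?_) fun s hs => ?_)
  all_goals
    first
    | rw [uIcc_of_le h01] at hs
    | rw [uIcc_of_le h12] at hs
    first
    | exact ha s ⟨by linarith [hs.1], by linarith [hs.2]⟩
    | exact hζ s ⟨by linarith [hs.1], by linarith [hs.2]⟩

/-- The variation of the logarithm, when a branch is defined along the arc. -/
theorem logVar_eq_log_sub_log {k : ℂ} (h01 : s₀ ≤ s₁) (ha : ∀ s ∈ Icc s₀ s₁, ContDiffAt ℝ 1 a s)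
    (hk : ∀ s ∈ Icc s₀ s₁, k * (a s - ζ) ∈ Complex.slitPlane) :
    logVar a s₀ s₁ ζ = Complex.log (k * (a s₁ - ζ)) - Complex.log (k * (a s₀ - ζ)) := by
  have hne : ∀ s ∈ Icc s₀ s₁, k ≠ 0 ∧ a s - ζ ≠ 0 := fun s hs =>
    mul_ne_zero_iff.1 (Complex.slitPlane_ne_zero (hk s hs))
  refine intervalIntegral.integral_eq_sub_of_hasDerivAt (f := fun s => Complex.log (k * (a s - ζ)))
    (fun s hs => ?_) (intervalIntegrable_logVar ?_ ?_)
  · rw [uIcc_of_le h01] at hs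
    have h1 : HasDerivAt (fun s => k * (a s - ζ)) (k * deriv a s) s :=
      (((ha s hs).differentiableAt (by simp)).hasDerivAt.sub_const _).const_mul _
    have h2 := h1.clog_real (hk s hs)
    exact h2.congr_deriv (mul_div_mul_left _ _ (hne s hs).1)
  · rwa [uIcc_of_le h01]
  · intro s hs
    rw [uIcc_of_le h01] at hs
    exact sub_ne_zero.1 (hne s hs).2

/-- The product of `a s - ζ` and the exponential of minus the variation from `s₀` to `s` has
derivative zero. -/
theorem exp_logVar (h01 : s₀ ≤ s₁) (ha : ∀ s ∈ Icc s₀ s₁, ContDiffAt ℝ 1 a s)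
    (hζ : ∀ s ∈ Icc s₀ s₁, a s ≠ ζ) :
    Complex.exp (logVar a s₀ s₁ ζ) = (a s₁ - ζ) / (a s₀ - ζ) := by
  let f : ℝ → ℂ := fun s => deriv a s / (a s - ζ)
  let g : ℝ → ℂ := fun s => (a s - ζ) * Complex.exp (-∫ r in s₀..s, f r)
  have hUo : IsOpen {s | ContDiffAt ℝ 1 a s ∧ a s ≠ ζ} := by
    rw [isOpen_iff_eventually]
    rintro s ⟨h1, h2⟩
    exact (h1.eventually (by simp)).and (h1.continuousAt.eventually_ne h2)
  have hd : ∀ s ∈ Icc s₀ s₁, HasDerivAt g 0 s := by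
    intro s hs
    have hint : IntervalIntegrable f MeasureTheory.volume s₀ s := by
      refine intervalIntegrable_logVar (fun r hr => ?_) fun r hr => ?_
      all_goals rw [uIcc_of_le hs.1] at hr
      · exact ha r ⟨hr.1, hr.2.trans hs.2⟩
      · exact hζ r ⟨hr.1, hr.2.trans hs.2⟩
    have hmeas : StronglyMeasurableAtFilter f (𝓝 s) MeasureTheory.volume :=
      ContinuousAt.stronglyMeasurableAtFilter hUo
        (fun r hr => continuousAt_deriv_div hr.1 hr.2) s ⟨ha s hs, hζ s hs⟩
    have h1 := intervalIntegral.integral_hasDerivAt_right hint hmeas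
      (continuousAt_deriv_div (ha s hs) (hζ s hs))
    have h2 := (((ha s hs).differentiableAt (by simp)).hasDerivAt.sub_const ζ).mul h1.neg.cexp
    refine h2.congr_deriv ?_
    have := sub_ne_zero.2 (hζ s hs)
    simp only [f]
    field_simp
    ring
  have hconst : g s₁ = g s₀ := by
    refine constant_of_has_deriv_right_zero (f := g) (a := s₀) (b := s₁)
      (fun s hs => (hd s hs).continuousAt.continuousWithinAt)
      (fun s hs => (hd s ⟨hs.1, hs.2.le⟩).hasDerivWithinAt) s₁ ⟨h01, le_rfl⟩
  simp only [g, intervalIntegral.integral_same, neg_zero, Complex.exp_zero, mul_one] at hconst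
  have h0 := sub_ne_zero.2 (hζ s₀ ⟨le_rfl, h01⟩)
  change Complex.exp (∫ r in s₀..s₁, f r) = _
  rw [eq_div_iff h0, ← hconst, mul_left_comm, ← Complex.exp_add, add_neg_cancel, Complex.exp_zero,
    mul_one]

theorem continuousAt_logVar (h01 : s₀ ≤ s₁) (ha : ∀ s ∈ Icc s₀ s₁, ContDiffAt ℝ 1 a s)
    (hζ : ∀ s ∈ Icc s₀ s₁, a s ≠ ζ) : ContinuousAt (logVar a s₀ s₁) ζ := by
  have hac : ContinuousOn a (Icc s₀ s₁) := fun s hs => (ha s hs).continuousAt.continuousWithinAt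
  have hdc : ContinuousOn (deriv a) (Icc s₀ s₁) := fun s hs =>
    (continuousAt_deriv_of_contDiffAt (ha s hs)).continuousWithinAt
  have hK : IsCompact (a '' Icc s₀ s₁) := isCompact_Icc.image_of_continuousOn hac
  have hζK : ζ ∉ a '' Icc s₀ s₁ := by
    rintro ⟨s, hs, h⟩; exact hζ s hs h
  obtain ⟨ε, hε, hball⟩ := Metric.mem_nhds_iff.1 (hK.isClosed.isOpen_compl.mem_nhds hζK)
  have hlow : ∀ ξ ∈ Metric.ball ζ (ε / 2), ∀ s ∈ Icc s₀ s₁, ε / 2 ≤ ‖a s - ξ‖ := by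
    intro ξ hξ s hs
    by_contra! hc
    have : a s ∈ Metric.ball ζ ε := by
      rw [Metric.mem_ball] at *
      rw [← dist_eq_norm] at hc
      linarith [dist_triangle (a s) ξ ζ]
    exact hball this ⟨s, hs, rfl⟩
  have hcont : ∀ ξ ∈ Metric.ball ζ (ε / 2),
      ContinuousOn (fun s => deriv a s / (a s - ξ)) (Icc s₀ s₁) := fun ξ hξ =>
    hdc.div (hac.sub continuousOn_const) fun s hs =>
      norm_pos_iff.1 (lt_of_lt_of_le (half_pos hε) (hlow ξ hξ s hs))
  have hsub : uIoc s₀ s₁ ⊆ Icc s₀ s₁ := by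
    rw [uIoc_of_le h01]; exact Ioc_subset_Icc_self
  have hb := Metric.ball_mem_nhds ζ (half_pos hε)
  refine intervalIntegral.continuousAt_of_dominated_interval
    (bound := fun s => ‖deriv a s‖ / (ε / 2)) ?_ ?_ ?_ ?_
  · filter_upwards [hb] with ξ hξ
    exact ((hcont ξ hξ).mono hsub).aestronglyMeasurable measurableSet_uIoc
  · filter_upwards [hb] with ξ hξ
    refine Eventually.of_forall fun s hs => ?_
    rw [norm_div]
    exact div_le_div_of_nonneg_left (norm_nonneg _) (half_pos hε) (hlow ξ hξ s (hsub hs))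
  · refine ContinuousOn.intervalIntegrable ?_
    rw [uIcc_of_le h01]
    exact hdc.norm.div_const _
  · refine Eventually.of_forall fun s hs => ?_
    exact continuousAt_const.div (continuousAt_const.sub continuousAt_id)
      (sub_ne_zero.2 (hζ s (hsub hs)))

end LogVar

/-! ### The jump at a transverse crossing -/

theorem log_I_mul_sub_log {G : ℂ} (hG : 0 < G.re) :
    Complex.log (Complex.I * G) - Complex.log (-(Complex.I * G)) = Real.pi * Complex.I := by
  have h : 0 < (Complex.I * G).im := by simpa using hG
  rw [Complex.log, Complex.log, norm_neg, Complex.arg_neg_eq_arg_sub_pi_of_im_pos h]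
  push_cast
  ring

/-- Near a transverse crossing, consider the difference of a point of the first and a point of
the second curve, in units of the velocity `u` of the first. It avoids the closed upper or the
closed lower half of the imaginary axis, according to the side of the first curve on which the
second point lies. At the crossing time of the second curve, its real part has the sign of
`s - σ`. -/
theorem exists_slitPlane_of_crossing {a b : ℝ → ℂ} {σ τ : ℝ} {u v : ℂ} (ha : HasDerivAt a u σ)
    (hb : HasDerivAt b v τ) (hab : a σ = b τ) (huv : (v / u).im ≠ 0) :
    ∃ ε > 0, ∀ s t : ℝ, |s - σ| < ε → |t - τ| < ε →
      (0 < (v / u).im * (t - τ) → Complex.I / u * (a s - b t) ∈ Complex.slitPlane) ∧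
      ((v / u).im * (t - τ) < 0 → -(Complex.I / u) * (a s - b t) ∈ Complex.slitPlane) ∧
      (t = τ → σ < s → 0 < ((a s - b t) / u).re) ∧
      (t = τ → s < σ → ((a s - b t) / u).re < 0) := by
  have hu : u ≠ 0 := by
    rintro rfl; simp at huv
  set w := v / u with hw
  set C : ℝ := 2 * (|w.re| + 1)
  have hC : 0 < C := by positivity
  set η : ℝ := min (1 / 2) (|w.im| / (2 * (C + 1)))
  have hwi : 0 < |w.im| := abs_pos.2 huv
  have hη : 0 < η := lt_min (by norm_num) (by positivity)
  have hη1 : η ≤ 1 / 2 := min_le_left _ _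
  have hη2 : η * (C + 1) < |w.im| := by
    have : η ≤ |w.im| / (2 * (C + 1)) := min_le_right _ _
    rw [le_div_iff₀ (by positivity)] at this
    linarith
  have hηu : 0 < η * ‖u‖ := mul_pos hη (norm_pos_iff.2 hu)
  have h1 := (hasDerivAt_iff_isLittleO.1 ha).def hηu
  have h2 := (hasDerivAt_iff_isLittleO.1 hb).def hηu
  obtain ⟨ε₁, hε₁, h1⟩ := Metric.eventually_nhds_iff.1 h1
  obtain ⟨ε₂, hε₂, h2⟩ := Metric.eventually_nhds_iff.1 h2
  refine ⟨min ε₁ ε₂, lt_min hε₁ hε₂, fun s t hs ht => ?_⟩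
  have k1 := h1 (y := s) (by rw [Real.dist_eq]; exact hs.trans_le (min_le_left _ _))
  have k2 := h2 (y := t) (by rw [Real.dist_eq]; exact ht.trans_le (min_le_right _ _))
  set F := (a s - b t) / u with hF
  -- compare with the linearization
  have hest : ‖F - ((s - σ : ℝ) - (t - τ : ℝ) * w)‖ ≤ η * (|s - σ| + |t - τ|) := by
    have e : F - ((s - σ : ℝ) - (t - τ : ℝ) * w) =
        ((a s - a σ - (s - σ) • u) - (b t - b τ - (t - τ) • v)) / u := by
      rw [hF, hw, hab, Complex.real_smul, Complex.real_smul]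
      field_simp
      ring
    rw [e, norm_div, div_le_iff₀ (norm_pos_iff.2 hu)]
    refine (norm_sub_le _ _).trans ?_
    rw [Real.norm_eq_abs] at k1 k2
    linarith
  have hre : |F.re - ((s - σ) - (t - τ) * w.re)| ≤ η * (|s - σ| + |t - τ|) := by
    refine le_trans ?_ hest
    have := Complex.abs_re_le_norm (F - ((s - σ : ℝ) - (t - τ : ℝ) * w))
    rwa [Complex.sub_re, Complex.sub_re, Complex.ofReal_re, Complex.re_ofReal_mul] at this
  have him : |F.im + (t - τ) * w.im| ≤ η * (|s - σ| + |t - τ|) := by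
    refine le_trans ?_ hest
    have := Complex.abs_im_le_norm (F - ((s - σ : ℝ) - (t - τ : ℝ) * w))
    rwa [Complex.sub_im, Complex.sub_im, Complex.ofReal_im, Complex.im_ofReal_mul, zero_sub,
      sub_neg_eq_add] at this
  have hslit : F.re = 0 → t ≠ τ → |F.im + (t - τ) * w.im| < |(t - τ) * w.im| := by
    intro h0 htτ
    have hT : 0 < |t - τ| := abs_pos.2 (sub_ne_zero.2 htτ)
    have h3 : |s - σ| ≤ C * |t - τ| := by
      rw [h0, zero_sub, abs_neg] at hre
      have h4 : |s - σ| ≤ |(s - σ) - (t - τ) * w.re| + |(t - τ) * w.re| := by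
        have := abs_add_le ((s - σ) - (t - τ) * w.re) ((t - τ) * w.re)
        rwa [sub_add_cancel] at this
      rw [abs_mul] at h4
      have h5 : η * (|s - σ| + |t - τ|) ≤ 1 / 2 * (|s - σ| + |t - τ|) := by
        have : 0 ≤ |s - σ| + |t - τ| := by positivity
        exact mul_le_mul_of_nonneg_right hη1 this
      simp only [C]
      nlinarith [abs_nonneg w.re]
    calc _ ≤ η * (|s - σ| + |t - τ|) := him
      _ ≤ η * (C * |t - τ| + |t - τ|) := by gcongr
      _ = η * (C + 1) * |t - τ| := by ring
      _ < |w.im| * |t - τ| := by gcongr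
      _ = _ := by rw [abs_mul, mul_comm]
  have e1 : Complex.I / u * (a s - b t) = Complex.I * F := by rw [hF]; ring
  have e2 : -(Complex.I / u) * (a s - b t) = -(Complex.I * F) := by rw [hF]; ring
  refine ⟨fun h => ?_, fun h => ?_, ?_, ?_⟩
  · rw [e1, Complex.mem_slitPlane_iff]
    by_cases h0 : F.re = 0
    · left
      have htτ : t ≠ τ := by rintro rfl; simp at h
      have := hslit h0 htτ
      rw [abs_of_pos (by linarith : 0 < (t - τ) * w.im), abs_lt] at this
      simp
      linarith
    · right; simpa using h0
  · rw [e2, Complex.mem_slitPlane_iff]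
    by_cases h0 : F.re = 0
    · left
      have htτ : t ≠ τ := by rintro rfl; simp at h
      have := hslit h0 htτ
      rw [abs_of_neg (by linarith : (t - τ) * w.im < 0), abs_lt] at this
      simp
      linarith
    · right; simpa using h0
  · rintro rfl hsσ
    simp only [sub_self, zero_mul, sub_zero, abs_zero, add_zero] at hre
    rw [abs_of_pos (sub_pos.2 hsσ), abs_le] at hre
    nlinarith [sub_pos.2 hsσ]
  · rintro rfl hsσ
    simp only [sub_self, zero_mul, sub_zero, abs_zero, add_zero] at hre
    rw [abs_of_neg (sub_neg.2 hsσ), abs_le] at hre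
    nlinarith [sub_neg.2 hsσ]

/-- The variation of the logarithm along an arc, seen from a curve that crosses the arc once,
jumps by `2πi` times the sign of the crossing. -/
theorem exists_logVar_jump {a b : ℝ → ℂ} {s₀ s₁ σ τ : ℝ} {u v : ℂ}
    (hs : ∀ s ∈ Icc s₀ s₁, ContDiffAt ℝ 1 a s) (hσ : σ ∈ Ioo s₀ s₁) (ha : HasDerivAt a u σ)
    (hb : HasDerivAt b v τ) (hab : a σ = b τ) (huv : (v / u).im ≠ 0)
    (hone : ∀ s ∈ Icc s₀ s₁, a s = b τ → s = σ) :
    ∃ l r : ℂ, Tendsto (fun t => logVar a s₀ s₁ (b t)) (𝓝[<] τ) (𝓝 l) ∧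
      Tendsto (fun t => logVar a s₀ s₁ (b t)) (𝓝[>] τ) (𝓝 r) ∧
      r - l = 2 * Real.pi * Complex.I * (SignType.sign (v / u).im : ℤ) := by
  obtain ⟨ε₀, hε₀, hF⟩ := exists_slitPlane_of_crossing ha hb hab huv
  obtain ⟨ε, hε, hεl⟩ : ∃ ε > 0, ε < ε₀ ∧ s₀ < σ - ε ∧ σ + ε < s₁ := by
    refine ⟨min (ε₀ / 2) (min ((σ - s₀) / 2) ((s₁ - σ) / 2)), ?_, ?_, ?_, ?_⟩
    · exact lt_min (by linarith) (lt_min (by linarith [hσ.1]) (by linarith [hσ.2]))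
    · exact (min_le_left _ _).trans_lt (by linarith)
    · have : min (ε₀ / 2) (min ((σ - s₀) / 2) ((s₁ - σ) / 2)) ≤ (σ - s₀) / 2 :=
        (min_le_right _ _).trans (min_le_left _ _)
      linarith [hσ.1]
    · have : min (ε₀ / 2) (min ((σ - s₀) / 2) ((s₁ - σ) / 2)) ≤ (s₁ - σ) / 2 :=
        (min_le_right _ _).trans (min_le_right _ _)
      linarith [hσ.2]
  obtain ⟨hεε, hl, hr⟩ := hεl
  have hbc : ContinuousAt b τ := hb.continuousAt
  -- the two outer arcs contribute continuously
  have hout1 : ContinuousAt (fun t => logVar a s₀ (σ - ε) (b t)) τ := by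
    refine ContinuousAt.comp (f := b) (x := τ) (continuousAt_logVar hl.le (fun s hs' => hs s
      ⟨hs'.1, by linarith [hs'.2]⟩) fun s hs' h => ?_) hbc
    have := hone s ⟨hs'.1, by linarith [hs'.2]⟩ h
    linarith [hs'.2]
  have hout2 : ContinuousAt (fun t => logVar a (σ + ε) s₁ (b t)) τ := by
    refine ContinuousAt.comp (f := b) (x := τ) (continuousAt_logVar hr.le (fun s hs' => hs s
      ⟨by linarith [hs'.1], hs'.2⟩) fun s hs' h => ?_) hbc
    have := hone s ⟨by linarith [hs'.1], hs'.2⟩ h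
    linarith [hs'.1]
  have hu : u ≠ 0 := by
    rintro rfl; simp at huv
  set G₁ := (a (σ + ε) - b τ) / u with hG₁
  set G₀ := (a (σ - ε) - b τ) / u with hG₀
  have hp : 0 < G₁.re := (hF (σ + ε) τ (by simpa [abs_of_pos hε] using hεε)
    (by simpa using hε₀)).2.2.1 rfl (by linarith)
  have hn : G₀.re < 0 := (hF (σ - ε) τ (by simpa [abs_of_pos hε] using hεε)
    (by simpa using hε₀)).2.2.2 rfl (by linarith)
  have hUo : ∀ t, b t ≠ b τ → (∀ s ∈ Icc s₀ s₁, a s ≠ b t) →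
      logVar a s₀ s₁ (b t) = logVar a s₀ (σ - ε) (b t) + logVar a (σ - ε) (σ + ε) (b t) +
        logVar a (σ + ε) s₁ (b t) := by
    intro t _ ht
    rw [logVar_add hl.le (by linarith) (fun s hs' => hs s ⟨hs'.1, by linarith [hs'.2]⟩)
      (fun s hs' => ht s ⟨hs'.1, by linarith [hs'.2]⟩),
      logVar_add (by linarith) hr.le hs ht]
  -- the one-sided limits: the middle arc is measured by the branch rotated by `κ = ±i`
  have key : ∀ (κ : ℂ) (l : Filter ℝ), l ≤ 𝓝 τ → κ ^ 2 = -1 →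
      (∀ᶠ t in l, ∀ s, |s - σ| ≤ ε → κ / u * (a s - b t) ∈ Complex.slitPlane) →
      Tendsto (fun t => logVar a s₀ s₁ (b t)) l (𝓝 (logVar a s₀ (σ - ε) (b τ) +
        (Complex.log (κ * G₁) - Complex.log (κ * G₀)) + logVar a (σ + ε) s₁ (b τ))) := by
    intro κ l hle hκ hsl
    have hκ' : κ = Complex.I ∨ κ = -Complex.I := by
      rw [← Complex.I_sq] at hκ
      exact sq_eq_sq_iff_eq_or_eq_neg.1 hκ
    have hmid : ∀ᶠ t in l, logVar a s₀ s₁ (b t) = logVar a s₀ (σ - ε) (b t) +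
        (Complex.log (κ / u * (a (σ + ε) - b t)) - Complex.log (κ / u * (a (σ - ε) - b t))) +
        logVar a (σ + ε) s₁ (b t) := by
      have hK : IsCompact (a '' (Icc s₀ (σ - ε) ∪ Icc (σ + ε) s₁)) := by
        refine (isCompact_Icc.union isCompact_Icc).image_of_continuousOn fun s hs' => ?_
        refine (hs s ?_).continuousAt.continuousWithinAt
        rcases hs' with h | h
        · exact ⟨h.1, by linarith [h.2]⟩
        · exact ⟨by linarith [h.1], h.2⟩
      have hbK : b τ ∉ a '' (Icc s₀ (σ - ε) ∪ Icc (σ + ε) s₁) := by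
        rintro ⟨s, hs', h⟩
        rcases hs' with h' | h'
        · have := hone s ⟨h'.1, by linarith [h'.2]⟩ h
          linarith [h'.2]
        · have := hone s ⟨by linarith [h'.1], h'.2⟩ h
          linarith [h'.1]
      have hev := (hbc.preimage_mem_nhds (hK.isClosed.isOpen_compl.mem_nhds hbK))
      filter_upwards [hsl, hle hev] with t ht htK
      have hmem : ∀ s ∈ Icc (σ - ε) (σ + ε), κ / u * (a s - b t) ∈ Complex.slitPlane :=
        fun s hs' => ht s (abs_le.2 ⟨by linarith [hs'.1], by linarith [hs'.2]⟩)
      have hne : ∀ s ∈ Icc s₀ s₁, a s ≠ b t := by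
        intro s hs' h
        by_cases h1 : s ∈ Icc (σ - ε) (σ + ε)
        · have := Complex.slitPlane_ne_zero (hmem s h1)
          rw [h, sub_self, mul_zero] at this
          exact this rfl
        · refine htK ⟨s, ?_, h⟩
          rw [mem_Icc, not_and_or, not_le, not_le] at h1
          rcases h1 with h1 | h1
          · exact Or.inl ⟨hs'.1, h1.le⟩
          · exact Or.inr ⟨h1.le, hs'.2⟩
      have hbt : b t ≠ b τ := fun h => hne σ ⟨hσ.1.le, hσ.2.le⟩ (hab.trans h.symm)
      rw [hUo t hbt hne, logVar_eq_log_sub_log (k := κ / u) (by linarith)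
        (fun s hs' => hs s ⟨by linarith [hs'.1], by linarith [hs'.2]⟩) hmem]
    have hlog : ∀ s, ((a s - b τ) / u).re ≠ 0 →
        ContinuousAt (fun t => Complex.log (κ / u * (a s - b t))) τ := by
      intro s hre
      refine ContinuousAt.clog (continuousAt_const.mul (continuousAt_const.sub hbc)) ?_
      rw [show κ / u * (a s - b τ) = κ * ((a s - b τ) / u) by ring, Complex.mem_slitPlane_iff]
      right
      rcases hκ' with rfl | rfl <;> simpa using hre
    have hc := (hout1.add ((hlog (σ + ε) hp.ne').sub (hlog (σ - ε) hn.ne))).add hout2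
    have hc' := hc.tendsto.mono_left hle
    simp only [Pi.add_apply, Pi.sub_apply] at hc'
    rw [show κ / u * (a (σ + ε) - b τ) = κ * G₁ by rw [hG₁]; ring,
      show κ / u * (a (σ - ε) - b τ) = κ * G₀ by rw [hG₀]; ring] at hc'
    refine hc'.congr' ?_
    filter_upwards [hmid] with t ht
    exact ht.symm
  have hev : ∀ᶠ t in 𝓝 τ, |t - τ| < ε₀ := by
    filter_upwards [Metric.ball_mem_nhds τ hε₀] with t ht
    rwa [Metric.mem_ball, Real.dist_eq] at ht
  have e1 := log_I_mul_sub_log hp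
  have e2 := log_I_mul_sub_log (G := -G₀) (by simpa using hn)
  rw [mul_neg, neg_neg] at e2
  rcases lt_or_gt_of_ne huv with hneg | hpos
  · refine ⟨_, _, key Complex.I _ nhdsWithin_le_nhds Complex.I_sq ?_,
      key (-Complex.I) _ nhdsWithin_le_nhds (by rw [neg_sq, Complex.I_sq]) ?_, ?_⟩
    · filter_upwards [nhdsWithin_le_nhds hev, self_mem_nhdsWithin] with t ht htτ s hs'
      exact (hF s t (hs'.trans_lt hεε) ht).1 (mul_pos_of_neg_of_neg hneg (sub_neg.2 htτ))
    · filter_upwards [nhdsWithin_le_nhds hev, self_mem_nhdsWithin] with t ht htτ s hs'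
      rw [neg_div]
      exact (hF s t (hs'.trans_lt hεε) ht).2.1 (mul_neg_of_neg_of_pos hneg (sub_pos.2 htτ))
    · rw [sign_neg hneg, neg_mul, neg_mul, SignType.coe_neg_one, Int.cast_neg, Int.cast_one]
      linear_combination -e1 - e2
  · refine ⟨_, _, key (-Complex.I) _ nhdsWithin_le_nhds (by rw [neg_sq, Complex.I_sq]) ?_,
      key Complex.I _ nhdsWithin_le_nhds Complex.I_sq ?_, ?_⟩
    · filter_upwards [nhdsWithin_le_nhds hev, self_mem_nhdsWithin] with t ht htτ s hs'
      rw [neg_div]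
      exact (hF s t (hs'.trans_lt hεε) ht).2.1 (mul_neg_of_pos_of_neg hpos (sub_neg.2 htτ))
    · filter_upwards [nhdsWithin_le_nhds hev, self_mem_nhdsWithin] with t ht htτ s hs'
      exact (hF s t (hs'.trans_lt hεε) ht).1 (mul_pos hpos (sub_pos.2 htτ))
    · rw [sign_pos hpos, neg_mul, neg_mul, SignType.coe_one, Int.cast_one]
      linear_combination e1 + e2

/-! ### Sums of locally finite functions over intervals -/

theorem finsum_mem_eq_single {ι : Type*} {f : ι → ℤ} {s : Set ι} {a : ι} (ha : a ∈ s)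
    (h : ∀ t ∈ s, t ≠ a → f t = 0) : ∑ᶠ t ∈ s, f t = f a := by
  rw [← finsum_mem_singleton (f := f) (a := a)]
  refine finsum_mem_inter_support_eq' _ _ _ fun t ht => ⟨fun hts => ?_, fun hta => hta ▸ ha⟩
  by_contra hne
  exact ht (h t hts hne)

section Sums

variable {J : ℝ → ℤ}

theorem finsum_Ico_add (hJ : ∀ a b, (Function.support J ∩ Icc a b).Finite) {a b c : ℝ} (hab : a ≤ b)
    (hbc : b ≤ c) :
    ∑ᶠ t ∈ Ico a b, J t + ∑ᶠ t ∈ Ico b c, J t = ∑ᶠ t ∈ Ico a c, J t := by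
  rw [← Ico_union_Ico_eq_Ico hab hbc]
  refine (finsum_mem_union' ?_ ?_ ?_).symm
  · rw [Set.disjoint_left]
    exact fun t h h' => absurd h.2 (not_lt.2 h'.1)
  · exact (hJ a b).subset fun t h => ⟨h.2, h.1.1, h.1.2.le⟩
  · exact (hJ b c).subset fun t h => ⟨h.2, h.1.1, h.1.2.le⟩

theorem finsum_Ico_add_one (hper : Function.Periodic J 1) (a b : ℝ) :
    ∑ᶠ t ∈ Ico (a + 1) (b + 1), J t = ∑ᶠ t ∈ Ico a b, J t := by
  refine (finsum_mem_eq_of_bijOn (fun t => t + 1) ⟨?_, ?_, ?_⟩ fun t _ => (hper t).symm).symm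
  · exact fun t h => ⟨by linarith [h.1], by linarith [h.2]⟩
  · exact fun t _ t' _ h => add_right_cancel h
  · exact fun t h => ⟨t - 1, ⟨by linarith [h.1], by linarith [h.2]⟩, by simp⟩

theorem finsum_Ico_period (hJ : ∀ a b, (Function.support J ∩ Icc a b).Finite)
    (hper : Function.Periodic J 1) (a : ℝ) :
    ∑ᶠ t ∈ Ico a (a + 1), J t = ∑ᶠ t ∈ Ico (0 : ℝ) 1, J t := by
  have hG : Function.Periodic (fun a => ∑ᶠ t ∈ Ico a (a + 1), J t) 1 := fun a =>
    finsum_Ico_add_one hper a (a + 1)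
  obtain ⟨b, hb, e⟩ := hG.exists_mem_Ico₀ one_pos a
  have e1 := finsum_Ico_add hJ hb.1 hb.2.le
  have e2 := finsum_Ico_add hJ hb.2.le (by linarith [hb.1] : (1 : ℝ) ≤ b + 1)
  have e3 := finsum_Ico_add_one hper 0 b
  rw [zero_add] at e3
  rw [e, ← e2, e3, ← e1, add_comm]

theorem finsum_Ico_eq_zero {a b : ℝ} (h : ∀ t ∈ Ico a b, J t = 0) : ∑ᶠ t ∈ Ico a b, J t = 0 :=
  finsum_mem_eq_zero_of_forall_eq_zero h

theorem sum_finsum_Ico (hJ : ∀ a b, (Function.support J ∩ Icc a b).Finite) {s : ℕ → ℝ}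
    (hs : Monotone s) (N : ℕ) :
    ∑ i ∈ Finset.range N, ∑ᶠ t ∈ Ico (s i) (s (i + 1)), J t = ∑ᶠ t ∈ Ico (s 0) (s N), J t := by
  induction N with
  | zero => simp
  | succ n ih =>
    rw [Finset.sum_range_succ, ih, finsum_Ico_add hJ (hs (Nat.zero_le n)) (hs (Nat.le_succ n))]

/-- A locally finite measure with integral weights on the line has a primitive. -/
theorem exists_primitive_finsum_Ico (hJ : ∀ a b, (Function.support J ∩ Icc a b).Finite) :
    ∃ N : ℝ → ℤ, ∀ s t, s ≤ t → N t - N s = ∑ᶠ r ∈ Ico s t, J r := by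
  refine ⟨fun t => ∑ᶠ s ∈ Ico 0 t, J s - ∑ᶠ s ∈ Ico t 0, J s, fun s t hst => ?_⟩
  have hempty : ∀ a b : ℝ, b ≤ a → ∑ᶠ s ∈ Ico a b, J s = 0 := fun a b h => by
    rw [Ico_eq_empty (not_lt.2 h)]; simp
  simp only
  rcases le_total 0 s with h0 | h0
  · rw [hempty s 0 h0, hempty t 0 (h0.trans hst), ← finsum_Ico_add hJ h0 hst]
    ring
  · rcases le_total 0 t with h1 | h1
    · rw [hempty t 0 h1, hempty 0 s h0, ← finsum_Ico_add hJ h0 h1]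
      ring
    · rw [hempty 0 t h1, hempty 0 s h0, ← finsum_Ico_add hJ hst h1]
      ring

theorem eventually_nhdsNE_eq_zero (hJ : ∀ a b, (Function.support J ∩ Icc a b).Finite) (t₀ : ℝ) :
    ∃ ε > 0, ∀ t, |t - t₀| ≤ ε → t ≠ t₀ → J t = 0 := by
  have h1 : ((Function.support J ∩ Icc (t₀ - 1) (t₀ + 1)) \ {t₀})ᶜ ∈ 𝓝 t₀ :=
    ((hJ _ _).subset sdiff_subset).isClosed.isOpen_compl.mem_nhds (by simp)
  have h2 := inter_mem h1 (Icc_mem_nhds (by linarith : t₀ - 1 < t₀) (by linarith : t₀ < t₀ + 1))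
  obtain ⟨ε, hε, h⟩ := Metric.nhds_basis_closedBall.mem_iff.1 h2
  refine ⟨ε, hε, fun t ht hne => ?_⟩
  have h3 := h (show t ∈ Metric.closedBall t₀ ε by rwa [Metric.mem_closedBall, Real.dist_eq])
  by_contra h0
  exact h3.1 ⟨⟨h0, h3.2⟩, hne⟩

end Sums

/-! ### The increment of a logarithm computed from jumps -/

/-- A function on the line that is constant on a punctured neighbourhood of each point takes the
same constant everywhere. -/
theorem exists_forall_eventually_eq_of_nhdsNE {E : ℝ → ℂ}
    (h : ∀ t, ∃ k, ∀ᶠ s in 𝓝[≠] t, E s = k) : ∃ k, ∀ t, ∀ᶠ s in 𝓝[≠] t, E s = k := by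
  choose K hK using h
  have hloc : IsLocallyConstant K := by
    rw [IsLocallyConstant.iff_eventually_eq]
    intro t
    have h1 := (eventually_nhdsWithin_iff.1 (hK t)).eventually_nhds
    filter_upwards [h1] with t' ht'
    by_cases hne : t' = t
    · rw [hne]
    · have h2 : ∀ᶠ s in 𝓝[≠] t', E s = K t := by
        filter_upwards [mem_nhdsWithin_of_mem_nhds ht',
          mem_nhdsWithin_of_mem_nhds (isOpen_ne.mem_nhds hne)] with s hs hs'
        exact hs hs'
      obtain ⟨s, hs⟩ := ((hK t').and h2).exists
      exact hs.1.symm.trans hs.2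
  exact ⟨K 0, fun t => hloc.apply_eq_of_isPreconnected isPreconnected_univ (mem_univ t)
    (mem_univ 0) ▸ hK t⟩

/-- If a continuous function `L` and a periodic function `M` are logarithms of the same
function, and `M` has jumps `2πi J t`, then the jumps of `M` over a period are compensated by
the increment of `L`: the sum of `L - M` and of `2πi` times a primitive of `J` is constant off
the jumps. -/
theorem sub_eq_neg_finsum_of_jumps {L M : ℝ → ℂ} {J : ℝ → ℤ} (hL : Continuous L)
    (hM : Function.Periodic M 1) (hJ : ∀ a b, (Function.support J ∩ Icc a b).Finite)
    (hper : Function.Periodic J 1)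
    (hexp : ∀ t₀, ∀ᶠ t in 𝓝[≠] t₀, Complex.exp (L t) = Complex.exp (M t))
    (hjump : ∀ t₀, ∃ l r, Tendsto M (𝓝[<] t₀) (𝓝 l) ∧ Tendsto M (𝓝[>] t₀) (𝓝 r) ∧
      r - l = 2 * Real.pi * Complex.I * J t₀) :
    L 1 - L 0 = -(2 * Real.pi * Complex.I * (∑ᶠ t ∈ Ico (0 : ℝ) 1, J t : ℤ)) := by
  obtain ⟨N, hN⟩ := exists_primitive_finsum_Ico hJ
  have hNl : ∀ t₀, ∀ᶠ t in 𝓝[<] t₀, N t = N t₀ := by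
    intro t₀
    obtain ⟨ε, hε, h⟩ := eventually_nhdsNE_eq_zero hJ t₀
    filter_upwards [Ioo_mem_nhdsLT (by linarith : t₀ - ε < t₀)] with t ht
    have := hN t t₀ ht.2.le
    rw [finsum_Ico_eq_zero fun s hs => h s (abs_le.2 ⟨by linarith [hs.1, ht.1], by linarith [hs.2]⟩)
      hs.2.ne] at this
    linarith
  have hNr : ∀ t₀, ∀ᶠ t in 𝓝[>] t₀, N t = N t₀ + J t₀ := by
    intro t₀
    obtain ⟨ε, hε, h⟩ := eventually_nhdsNE_eq_zero hJ t₀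
    filter_upwards [Ioo_mem_nhdsGT (by linarith : t₀ < t₀ + ε)] with t ht
    have := hN t₀ t ht.1.le
    rw [finsum_mem_eq_single (left_mem_Ico.2 ht.1) fun s hs hne =>
      h s (abs_le.2 ⟨by linarith [hs.1], by linarith [hs.2, ht.2]⟩) hne] at this
    linarith
  let E : ℝ → ℂ := fun t => L t - M t + 2 * Real.pi * Complex.I * N t
  have hE1 : ∀ t₀, ∀ᶠ t in 𝓝[≠] t₀, Complex.exp (E t) = 1 := by
    intro t₀
    filter_upwards [hexp t₀] with t ht
    have := Complex.exp_int_mul_two_pi_mul_I (N t)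
    rw [show E t = (L t - M t) + N t * (2 * Real.pi * Complex.I) by simp only [E]; ring,
      Complex.exp_add, Complex.exp_sub, ht, this, div_self (Complex.exp_ne_zero _), mul_one]
  have hElim : ∀ t₀, ∃ k, Tendsto E (𝓝[≠] t₀) (𝓝 k) := by
    intro t₀
    obtain ⟨l, r, hl, hr, hlr⟩ := hjump t₀
    refine ⟨L t₀ - l + 2 * Real.pi * Complex.I * N t₀, ?_⟩
    rw [← Iio_union_Ioi, nhdsWithin_union, tendsto_sup]
    constructor
    · refine ((((hL.tendsto t₀).mono_left nhdsWithin_le_nhds).sub hl).add_const _).congr' ?_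
      filter_upwards [hNl t₀] with t ht
      simp only [E, ht]
    · have h1 : L t₀ - l + 2 * Real.pi * Complex.I * N t₀ =
          L t₀ - r + 2 * Real.pi * Complex.I * (N t₀ + J t₀ : ℤ) := by
        push_cast
        linear_combination hlr
      rw [h1]
      refine ((((hL.tendsto t₀).mono_left nhdsWithin_le_nhds).sub hr).add_const _).congr' ?_
      filter_upwards [hNr t₀] with t ht
      simp only [E, ht]
  have hEloc : ∀ t₀, ∃ k, ∀ᶠ t in 𝓝[≠] t₀, E t = k := by
    intro t₀
    obtain ⟨k, hk⟩ := hElim t₀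
    have hk1 : Complex.exp k = 1 :=
      tendsto_nhds_unique ((Complex.continuous_exp.tendsto k).comp hk)
        (tendsto_const_nhds.congr' ((hE1 t₀).mono fun t ht => ht.symm))
    refine ⟨k, ?_⟩
    filter_upwards [hE1 t₀, hk (Metric.ball_mem_nhds k Real.pi_pos)] with t ht htk
    rw [mem_preimage, Metric.mem_ball, dist_eq_norm] at htk
    refine exp_inj_of_abs_im_sub_lt (ht.trans hk1.symm) ?_
    have := (Complex.abs_im_le_norm (E t - k)).trans_lt htk
    rw [Complex.sub_im] at this
    linarith [Real.pi_pos]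
  obtain ⟨k, hk⟩ := exists_forall_eventually_eq_of_nhdsNE hEloc
  have hconst : ∀ᶠ t in 𝓝[>] (0 : ℝ),
      L (t + 1) - L t = -(2 * Real.pi * Complex.I * (∑ᶠ t ∈ Ico (0 : ℝ) 1, J t : ℤ)) := by
    have h0 : ∀ᶠ t in 𝓝[>] (0 : ℝ), E t = k :=
      (hk 0).filter_mono (nhdsWithin_mono _ fun t ht => ne_of_gt ht)
    have h1 : ∀ᶠ t in 𝓝[>] (0 : ℝ), E (t + 1) = k := by
      have h2 : Tendsto (fun t : ℝ => t + 1) (𝓝[>] 0) (𝓝[≠] 1) := by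
        refine tendsto_nhdsWithin_iff.2 ⟨?_, ?_⟩
        · have : ContinuousAt (fun t : ℝ => t + 1) 0 := by fun_prop
          have h3 := this.tendsto
          rw [zero_add] at h3
          exact h3.mono_left nhdsWithin_le_nhds
        · filter_upwards [self_mem_nhdsWithin] with t ht
          have : (0 : ℝ) < t := ht
          simp [this.ne']
      exact h2.eventually (hk 1)
    filter_upwards [h0, h1, Ioo_mem_nhdsGT (zero_lt_one' ℝ)] with t h0 h1 ht
    have h2 := hN t (t + 1) (by linarith)
    rw [finsum_Ico_period hJ hper] at h2
    rw [← h2]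
    simp only [E, hM t] at h0 h1
    push_cast
    linear_combination h1 - h0
  have hc : ContinuousAt (fun t => L (t + 1) - L t) 0 := by fun_prop
  have h1 := hc.tendsto
  rw [zero_add] at h1
  exact tendsto_nhds_unique (h1.mono_left nhdsWithin_le_nhds)
    (tendsto_const_nhds.congr' (hconst.mono fun t ht => ht.symm))

/-! ### Crossings of transverse curves -/

section

theorem orientationSign_ne_zero {v w : EuclideanSpace ℝ (Fin 2)} (h : LinearIndependent ℝ ![v, w]) :
    orientationSign v w ≠ 0 := by
  intro h0
  have h1 : v 0 * w 1 - v 1 * w 0 = 0 := by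
    rw [orientationSign] at h0
    rcases lt_trichotomy (v 0 * w 1 - v 1 * w 0) 0 with h | h | h
    · simp [sign_neg h] at h0
    · exact h
    · simp [sign_pos h] at h0
  rw [LinearIndependent.pair_iff] at h
  have e0 := h (w 0) (-v 0) (by
    ext i
    fin_cases i
    · simp; ring
    · simp; linarith)
  have e1 := h (w 1) (-v 1) (by
    ext i
    fin_cases i
    · simp; linarith
    · simp; ring)
  have := h 1 0 (by
    ext i
    fin_cases i
    · simpa using e0.2
    · simpa using e1.2)
  exact one_ne_zero this.1

variable {S : Type u} [TopologicalSpace S] [ChartedSpace (EuclideanSpace ℝ (Fin 2)) S]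

namespace ClosedCurve

theorem continuous (α : ClosedCurve S) : Continuous α.toFun := α.smooth.continuous

theorem velocity_add_one (α : ClosedCurve S) (t : ℝ) : α.velocity (t + 1) = α.velocity t := by
  have h1 : MDifferentiableAt 𝓘(ℝ, ℝ) (𝓡 2) α.toFun (t + 1) :=
    α.smooth.mdifferentiableAt (by simp)
  have h2 : HasMFDerivAt 𝓘(ℝ, ℝ) 𝓘(ℝ, ℝ) (fun s : ℝ => s + 1) t (ContinuousLinearMap.id ℝ ℝ) :=
    ((hasFDerivAt_id t).add_const 1).hasMFDerivAt
  have h3 := (h1.hasMFDerivAt.comp t h2).mfderiv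
  have h4 : α.toFun ∘ (fun s : ℝ => s + 1) = α.toFun := funext fun s => α.periodic s
  rw [h4] at h3
  unfold velocity
  rw [h3]
  rfl

theorem mem_range_iff (β : ClosedCurve S) {w : S} : w ∈ range β ↔ ∃ t ∈ Icc (0 : ℝ) 1, β t = w := by
  constructor
  · rintro ⟨t, rfl⟩
    obtain ⟨t', ht', h⟩ := β.periodic.exists_mem_Ico₀ one_pos t
    exact ⟨t', Ico_subset_Icc_self ht', h.symm⟩
  · rintro ⟨t, -, rfl⟩; exact ⟨t, rfl⟩

theorem signedCount_eq_zero {α β : ClosedCurve S} {T : Set ℝ} (h : ∀ t ∈ T, β t ∉ range α) :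
    α.signedCount β T = 0 := by
  refine finsum_mem_eq_zero_of_forall_eq_zero fun p hp => ?_
  exact absurd ⟨p.1, hp.2.2⟩ (h _ hp.2.1)

theorem periodic_signedCount (α β : ClosedCurve S) :
    Function.Periodic (fun t => α.signedCount β {t}) 1 := by
  intro t
  refine finsum_mem_eq_of_bijOn (fun p => (p.1, p.2 - 1)) ⟨?_, ?_, ?_⟩ ?_
  · rintro ⟨s, t'⟩ ⟨h1, h2, h3⟩
    obtain rfl : t' = t + 1 := h2
    exact ⟨h1, by simp, by simpa [β.periodic t] using h3⟩
  · rintro ⟨s, t'⟩ _ ⟨r, t''⟩ _ h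
    simpa using h
  · rintro ⟨s, t'⟩ ⟨h1, h2, h3⟩
    obtain rfl : t' = t := h2
    exact ⟨(s, t' + 1), ⟨h1, rfl, by simpa [β.periodic t'] using h3⟩, by simp⟩
  · rintro ⟨s, t'⟩ ⟨h1, h2, h3⟩
    obtain rfl : t' = t + 1 := h2
    simp [β.velocity_add_one]

open Classical in
/-- The sign of the crossing of `α` at time `s` with `β` at time `t`, and zero if the curves are not
at the same point. -/
noncomputable def crossingSign (α β : ClosedCurve S) (t s : ℝ) : ℤ :=
  if α s = β t then orientationSign (α.velocity s) (β.velocity t) else 0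

theorem crossingSign_eq_zero {α β : ClosedCurve S} {s t : ℝ} (h : α s ≠ β t) :
    α.crossingSign β t s = 0 := if_neg h

theorem periodic_crossingSign (α β : ClosedCurve S) (t : ℝ) :
    Function.Periodic (α.crossingSign β t) 1 := by
  intro s
  have h : α (s + 1) = α s := α.periodic s
  by_cases hs : α s = β t
  · rw [crossingSign, crossingSign, if_pos hs, if_pos (h.trans hs), α.velocity_add_one]
  · rw [crossingSign, crossingSign, if_neg hs, if_neg (h ▸ hs)]

theorem signedCount_singleton (α β : ClosedCurve S) (t : ℝ) :
    α.signedCount β {t} = ∑ᶠ s ∈ Ico (0 : ℝ) 1, α.crossingSign β t s := by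
  have h : ∑ᶠ s ∈ Ico (0 : ℝ) 1, α.crossingSign β t s =
      ∑ᶠ s ∈ {s | s ∈ Ico (0 : ℝ) 1 ∧ α s = β t}, α.crossingSign β t s := by
    refine finsum_mem_inter_support_eq' _ _ _ fun s hs => ⟨fun h => ⟨h, ?_⟩, fun h => h.1⟩
    by_contra hne
    exact hs (crossingSign_eq_zero hne)
  rw [h]
  refine finsum_mem_eq_of_bijOn Prod.fst ⟨?_, ?_, ?_⟩ ?_
  · rintro ⟨s, t'⟩ ⟨h1, h2, h3⟩
    obtain rfl : t' = t := h2
    exact ⟨h1, h3⟩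
  · rintro ⟨s, t'⟩ h ⟨r, t''⟩ h' e
    exact Prod.ext e ((show t' = t from h.2.1).trans (show t'' = t from h'.2.1).symm)
  · exact fun s hs => ⟨(s, t), ⟨hs.1, rfl, hs.2⟩, rfl⟩
  · rintro ⟨s, t'⟩ ⟨h1, h2, h3⟩
    obtain rfl : t' = t := h2
    exact (if_pos h3).symm

variable [IsManifold (𝓡 2) ∞ S] [OrientedAtlas S] {α β : ClosedCurve S}

/-- In a chart, a transverse crossing of two curves becomes a transverse crossing of plane
curves, of the same sign. -/
theorem Transverse.exists_hasDerivAt (hT : α.Transverse β) {p : S} {σ τ : ℝ} (h : α σ = β τ)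
    (hp : β τ ∈ (cchart p).source) :
    ∃ u v : ℂ, HasDerivAt (fun s => cchart p (α s)) u σ ∧ HasDerivAt (fun t => cchart p (β t)) v τ ∧
      (v / u).im ≠ 0 ∧
      (SignType.sign (v / u).im : ℤ) = orientationSign (α.velocity σ) (β.velocity τ) := by
  obtain ⟨B, hB, hd⟩ := exists_velocity_map hp
  have hs := hB (α.velocity σ) (β.velocity τ)
  have hne := orientationSign_ne_zero (hT σ τ h)
  have h0 : (starRingEnd ℂ (B (α.velocity σ)) * B (β.velocity τ)).im ≠ 0 := by
    intro h0
    rw [h0] at hs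
    exact hne (by simpa using hs.symm)
  have hu : 0 < Complex.normSq (B (α.velocity σ)) := by
    rw [Complex.normSq_pos]
    intro hu
    rw [hu] at h0
    simp at h0
  have e : (B (β.velocity τ) / B (α.velocity σ)).im =
      (starRingEnd ℂ (B (α.velocity σ)) * B (β.velocity τ)).im *
        (Complex.normSq (B (α.velocity σ)))⁻¹ := by
    rw [div_eq_mul_inv, Complex.inv_def, mul_comm, mul_assoc, mul_comm _ (B (β.velocity τ)),
      ← mul_assoc, Complex.im_mul_ofReal]
  refine ⟨_, _, hd α σ h, hd β τ rfl, ?_, ?_⟩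
  · rw [e]
    exact mul_ne_zero h0 (inv_pos.2 hu).ne'
  · rw [e, sign_mul, sign_pos (inv_pos.2 hu), mul_one, hs]

/-- Crossings of transverse curves are isolated, as pairs of parameters. -/
theorem Transverse.eventually_eq (hT : α.Transverse β) {σ τ : ℝ} (h : α σ = β τ) :
    ∀ᶠ p in 𝓝 (σ, τ), α p.1 = β p.2 → p = (σ, τ) := by
  obtain ⟨u, v, hu, hv, h0, -⟩ := hT.exists_hasDerivAt h (mem_cchart_source (β τ))
  obtain ⟨ε, hε, hF⟩ := exists_slitPlane_of_crossing hu hv (by rw [h]) h0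
  filter_upwards [Metric.ball_mem_nhds (σ, τ) hε] with p hp hpe
  rw [Metric.mem_ball, Prod.dist_eq, max_lt_iff, Real.dist_eq, Real.dist_eq] at hp
  obtain ⟨h1, h2, h3, h4⟩ := hF p.1 p.2 hp.1 hp.2
  rw [hpe, sub_self, mul_zero] at h1 h2
  rw [hpe, sub_self, zero_div] at h3 h4
  have ht : p.2 = τ := by
    by_contra hne
    rcases lt_or_gt_of_ne (mul_ne_zero h0 (sub_ne_zero.2 hne)) with h5 | h5
    · exact Complex.slitPlane_ne_zero (h2 h5) rfl
    · exact Complex.slitPlane_ne_zero (h1 h5) rfl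
  refine Prod.ext ?_ ht
  rcases lt_trichotomy p.1 σ with h5 | h5 | h5
  · exact absurd (h4 ht h5) (lt_irrefl _)
  · exact h5
  · exact absurd (h3 ht h5) (lt_irrefl _)

variable [T2Space S]

theorem Transverse.finite_crossings (hT : α.Transverse β) (a b c d : ℝ) :
    {p : ℝ × ℝ | p.1 ∈ Icc a b ∧ p.2 ∈ Icc c d ∧ α p.1 = β p.2}.Finite := by
  set K := {p : ℝ × ℝ | p.1 ∈ Icc a b ∧ p.2 ∈ Icc c d ∧ α p.1 = β p.2} with hK
  have hcl : IsClosed {p : ℝ × ℝ | α p.1 = β p.2} :=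
    isClosed_eq (α.continuous.comp continuous_fst) (β.continuous.comp continuous_snd)
  have hcomp : IsCompact K := by
    have : K = (Icc a b ×ˢ Icc c d) ∩ {p : ℝ × ℝ | α p.1 = β p.2} := by
      ext p; exact (and_assoc (c := α p.1 = β p.2)).symm
    rw [this]
    exact (isCompact_Icc.prod isCompact_Icc).inter_right hcl
  have := hcomp.induction_on (p := fun s => (s ∩ K).Finite) (by simp)
    (fun s t hst ht => ht.subset (inter_subset_inter_left _ hst))
    (fun s t hs ht => by rw [union_inter_distrib_right]; exact hs.union ht)
    (fun p hp => by
      refine ⟨_, mem_nhdsWithin_of_mem_nhds (hT.eventually_eq hp.2.2), ?_⟩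
      refine (finite_singleton p).subset fun q hq => ?_
      exact hq.1 hq.2.2.2)
  rwa [inter_self] at this

theorem Transverse.finite_left (hT : α.Transverse β) (a b : ℝ) :
    {s | s ∈ Icc a b ∧ α s ∈ range β}.Finite := by
  refine ((hT.finite_crossings a b 0 1).image Prod.fst).subset fun s hs => ?_
  obtain ⟨t, ht, h⟩ := β.mem_range_iff.1 hs.2
  exact ⟨(s, t), ⟨hs.1, ht, h.symm⟩, rfl⟩

theorem Transverse.finite_right (hT : α.Transverse β) (c d : ℝ) :
    {t | t ∈ Icc c d ∧ β t ∈ range α}.Finite := by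
  refine ((hT.finite_crossings 0 1 c d).image Prod.snd).subset fun t ht => ?_
  obtain ⟨s, hs, h⟩ := α.mem_range_iff.1 ht.2
  exact ⟨(s, t), ⟨hs, ht.1, h⟩, rfl⟩

theorem Transverse.finite_support (hT : α.Transverse β) (a b : ℝ) :
    (Function.support (fun t => α.signedCount β {t}) ∩ Icc a b).Finite := by
  refine (hT.finite_right a b).subset fun t ht => ⟨ht.2, ?_⟩
  by_contra h
  exact ht.1 (signedCount_eq_zero (by simpa using h))

theorem Transverse.signedCount_eq_finsum (hT : α.Transverse β) {T : Set ℝ} {a b : ℝ}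
    (hab : T ⊆ Icc a b) : α.signedCount β T = ∑ᶠ t ∈ T, α.signedCount β {t} := by
  set C : Set ℝ → Set (ℝ × ℝ) := fun T =>
    {p : ℝ × ℝ | p.1 ∈ Ico (0 : ℝ) 1 ∧ p.2 ∈ T ∧ α p.1 = β p.2} with hC
  have hfin : (C T).Finite := (hT.finite_crossings 0 1 a b).subset fun p hp =>
    ⟨Ico_subset_Icc_self hp.1, hab hp.2.1, hp.2.2⟩
  have hU : C T = ⋃ t ∈ Prod.snd '' C T, C {t} := by
    ext p
    simp only [mem_iUnion, exists_prop]
    constructor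
    · exact fun hp => ⟨p.2, ⟨p, hp, rfl⟩, hp.1, rfl, hp.2.2⟩
    · rintro ⟨t, ⟨q, hq, rfl⟩, hp⟩
      refine ⟨hp.1, ?_, hp.2.2⟩
      rw [show p.2 = q.2 from hp.2.1]
      exact hq.2.1
  change ∑ᶠ p ∈ C T, _ = _
  rw [hU, finsum_mem_biUnion]
  · change ∑ᶠ t ∈ Prod.snd '' C T, α.signedCount β {t} = _
    refine finsum_mem_inter_support_eq' _ _ _ fun t ht => ?_
    constructor
    · rintro ⟨p, hp, rfl⟩; exact hp.2.1
    · intro htT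
      by_contra hne
      refine ht (finsum_mem_eq_zero_of_forall_eq_zero fun p hp => ?_)
      refine absurd ⟨p, ⟨hp.1, ?_, hp.2.2⟩, hp.2.1⟩ hne
      rw [show p.2 = t from hp.2.1]
      exact htT
  · intro t _ t' _ hne
    refine Set.disjoint_left.2 fun p hp hp' => hne ?_
    exact (show p.2 = t from hp.2.1).symm.trans hp'.2.1
  · exact hfin.image _
  · rintro t ⟨q, hq, rfl⟩
    refine hfin.subset fun p hp => ⟨hp.1, ?_, hp.2.2⟩
    rw [show p.2 = q.2 from hp.2.1]
    exact hq.2.1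

theorem Transverse.finite_support_crossingSign (hT : α.Transverse β) (t a b : ℝ) :
    (Function.support (α.crossingSign β t) ∩ Icc a b).Finite := by
  refine (hT.finite_left a b).subset fun s hs => ⟨hs.2, t, ?_⟩
  by_contra h
  exact hs.1 (crossingSign_eq_zero (Ne.symm h))

end ClosedCurve

end

/-! ### Logarithmic variation along arcs on the surface -/

section

variable {S : Type u} [TopologicalSpace S] [ChartedSpace (EuclideanSpace ℝ (Fin 2)) S]
  [IsManifold (𝓡 2) ∞ S]

namespace Disc

variable {d : Disc S} {α β : ClosedCurve S} {s₀ s₁ : ℝ}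

/-- The variation of the logarithm along an arc of a curve in the core of a disc, cut off and
extended by zero to the surface. -/
noncomputable def arcVar (d : Disc S) (α : ClosedCurve S) (s₀ s₁ : ℝ) : S → ℂ :=
  d.ext (logVar (fun s => d.z (α s)) s₀ s₁)

theorem contDiffAt_comp (hd : ∀ s ∈ Icc s₀ s₁, α s ∈ d.core) :
    ∀ s ∈ Icc s₀ s₁, ContDiffAt ℝ 1 (fun s => d.z (α s)) s := fun s hs =>
  (α.contDiffAt_cchart_comp (hd s hs).1).of_le (by simp)

theorem exp_arcVar (h01 : s₀ ≤ s₁) (hd : ∀ s ∈ Icc s₀ s₁, α s ∈ d.core) {w : S}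
    (hw : ∀ s ∈ Icc s₀ s₁, α s ≠ w) :
    Complex.exp (d.arcVar α s₀ s₁ w) = Complex.exp (d.lam (α s₀) (α s₁) w) := by
  have hm0 : s₀ ∈ Icc s₀ s₁ := ⟨le_rfl, h01⟩
  have hm1 : s₁ ∈ Icc s₀ s₁ := ⟨h01, le_rfl⟩
  by_cases hws : w ∈ d.z.source
  · have hne : ∀ s ∈ Icc s₀ s₁, d.z (α s) ≠ d.z w := fun s hs h =>
      hw s hs (d.z.injOn (hd s hs).1 hws h)
    -- near the arc the cutoff is `1`; away from it both sides use the same branch of the logarithm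
    rcases le_total ‖d.z w - d.c‖ (d.radius / 2) with h | h
    · rw [arcVar, d.ext_of_norm_le hws h, exp_logVar h01 (contDiffAt_comp hd) hne,
        exp_lam_of_norm_le (hd _ hm0) (hd _ hm1) hws h (hw _ hm0).symm (hw _ hm1).symm,
        ← neg_div_neg_eq, neg_sub, neg_sub]
    · have h0 := sub_ne_zero.2 (hne _ hm0)
      have e : ∀ s, (d.z (α s₀) - d.z w)⁻¹ * (d.z (α s) - d.z w) =
          (d.z w - d.z (α s)) / (d.z w - d.z (α s₀)) := fun s => by
        rw [← neg_div_neg_eq, neg_sub, neg_sub, div_eq_mul_inv, mul_comm]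
      rw [arcVar, lam, d.ext_of_mem hws, d.ext_of_mem hws,
        logVar_eq_log_sub_log (k := (d.z (α s₀) - d.z w)⁻¹) h01 (contDiffAt_comp hd), e,
        inv_mul_cancel₀ h0, Complex.log_one, sub_zero]
      intro s hs
      rw [e]
      exact mem_slitPlane_of_norm_sub_one_lt (norm_ratio_sub_one_lt
        (norm_sub_lt_of_mem_core (hd _ hm0)) (norm_sub_lt_of_mem_core (hd s hs)) h).2
  · rw [arcVar, lam, ext, ext, if_neg hws, if_neg hws]

variable [T2Space S]

theorem continuousAt_arcVar (h01 : s₀ ≤ s₁) (hd : ∀ s ∈ Icc s₀ s₁, α s ∈ d.core) {w : S}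
    (hw : ∀ s ∈ Icc s₀ s₁, α s ≠ w) : ContinuousAt (d.arcVar α s₀ s₁) w :=
  d.continuousAt_ext fun hws => continuousAt_logVar h01 (contDiffAt_comp hd) fun s hs h =>
    hw s hs (d.z.injOn (hd s hs).1 hws h)

variable [OrientedAtlas S]

/-- The variation of the logarithm along an arc, seen from a transverse curve, jumps at the
crossings with the arc by `2πi` times their sign. -/
theorem exists_arcVar_jump (hT : α.Transverse β) (h01 : s₀ ≤ s₁)
    (hd : ∀ s ∈ Icc s₀ s₁, α s ∈ d.core) (h0 : α s₀ ∉ range β) (h1 : α s₁ ∉ range β)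
    (hone : ∀ s ∈ Icc s₀ s₁, ∀ s' ∈ Icc s₀ s₁, α s ∈ range β → α s' ∈ range β → s = s') (τ : ℝ) :
    ∃ l r : ℂ, Tendsto (fun t => d.arcVar α s₀ s₁ (β t)) (𝓝[<] τ) (𝓝 l) ∧
      Tendsto (fun t => d.arcVar α s₀ s₁ (β t)) (𝓝[>] τ) (𝓝 r) ∧
      r - l = 2 * Real.pi * Complex.I * (∑ᶠ s ∈ Ico s₀ s₁, α.crossingSign β τ s : ℤ) := by
  have hβ := β.continuous.continuousAt (x := τ)
  by_cases hex : ∃ σ ∈ Icc s₀ s₁, α σ = β τ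
  · obtain ⟨σ, hσ, h⟩ := hex
    have hσ0 : s₀ < σ := lt_of_le_of_ne hσ.1 (by rintro rfl; exact h0 ⟨τ, h.symm⟩)
    have hσ1 : σ < s₁ := lt_of_le_of_ne hσ.2 (by rintro rfl; exact h1 ⟨τ, h.symm⟩)
    have huniq : ∀ s ∈ Icc s₀ s₁, α s = β τ → s = σ := fun s hs hs' =>
      hone s hs σ hσ ⟨τ, hs'.symm⟩ ⟨τ, h.symm⟩
    have hcore : β τ ∈ d.core := h ▸ hd σ hσ
    obtain ⟨u, v, hu, hv, hne, hsign⟩ := hT.exists_hasDerivAt h hcore.1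
    obtain ⟨l, r, hl, hr, hlr⟩ := exists_logVar_jump (contDiffAt_comp hd) ⟨hσ0, hσ1⟩ hu hv
      (by rw [h]) hne fun s hs hs' => huniq s hs (d.z.injOn (hd s hs).1 hcore.1 hs')
    have hev : (fun t => logVar (fun s => d.z (α s)) s₀ s₁ (d.z (β t))) =ᶠ[𝓝 τ]
        fun t => d.arcVar α s₀ s₁ (β t) := by
      filter_upwards [hβ.eventually (eventually_norm_lt hcore.1 (mem_core_norm_lt hcore))] with t ht
      rw [arcVar, d.ext_of_norm_le ht.1 ht.2.le]
    refine ⟨l, r, hl.congr' (hev.filter_mono nhdsWithin_le_nhds),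
      hr.congr' (hev.filter_mono nhdsWithin_le_nhds), ?_⟩
    rw [hlr, hsign, finsum_mem_eq_single (mem_Ico.2 ⟨hσ0.le, hσ1⟩) fun s hs hne' =>
      ClosedCurve.crossingSign_eq_zero fun hs' => hne' (huniq s (Ico_subset_Icc_self hs) hs'),
      ClosedCurve.crossingSign, if_pos h]
  · push Not at hex
    have hc : ContinuousAt (fun t => d.arcVar α s₀ s₁ (β t)) τ :=
      ContinuousAt.comp (f := β.toFun) (continuousAt_arcVar h01 hd hex) hβ
    refine ⟨_, _, hc.tendsto.mono_left nhdsWithin_le_nhds, hc.tendsto.mono_left nhdsWithin_le_nhds,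
      ?_⟩
    rw [finsum_mem_eq_zero_of_forall_eq_zero fun s hs =>
      ClosedCurve.crossingSign_eq_zero (hex s (Ico_subset_Icc_self hs))]
    simp

end Disc

/-! ### Fine subdivisions of a curve -/

/-- A curve `α` transverse to `β` can be subdivided so that each arc lies in the core of a disc,
meets `β` at one time at most, and has its end points off `β`. -/
theorem ClosedCurve.Transverse.exists_subdivision [T2Space S] [OrientedAtlas S]
    {α β : ClosedCurve S}
    (hT : α.Transverse β) : ∃ (s : ℕ → ℝ) (N : ℕ) (d : ℕ → Disc S), Monotone s ∧ s N = s 0 + 1 ∧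
      (∀ i < N, ∀ t ∈ Icc (s i) (s (i + 1)), α t ∈ (d i).core) ∧
      (∀ i ≤ N, α (s i) ∉ range β) ∧
      ∀ i < N, ∀ t ∈ Icc (s i) (s (i + 1)), ∀ t' ∈ Icc (s i) (s (i + 1)),
        α t ∈ range β → α t' ∈ range β → t = t' := by
  choose E hE using exists_disc (S := S)
  set P : Set ℝ := {s | s ∈ Icc (0 : ℝ) 2 ∧ α s ∈ range β} with hP
  have hPf : P.Finite := hT.finite_left 0 2
  -- around each time, a neighbourhood with its image in a core and with no other crossing
  let U : ℝ → Set ℝ := fun t => α ⁻¹' (E (α t)).core ∩ (P \ {t})ᶜ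
  have hUo : ∀ t, IsOpen (U t) := fun t =>
    ((E (α t)).isOpen_core.preimage α.continuous).inter
      (hPf.subset sdiff_subset).isClosed.isOpen_compl
  have htU : ∀ t, t ∈ U t := fun t => by
    refine ⟨?_, fun h => h.2 rfl⟩
    have := (E (α t)).base_mem_core
    rwa [hE] at this
  obtain ⟨δ, hδ, hleb⟩ := lebesgue_number_lemma_of_metric
    (isCompact_Icc (a := (0 : ℝ)) (b := 2)) hUo fun t _ => mem_iUnion.2 ⟨t, htU t⟩
  obtain ⟨n, hn⟩ := exists_nat_one_div_lt hδ
  set N := n + 1 with hN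
  have hNpos : (0 : ℝ) < N := by positivity
  have hNδ : 1 / (N : ℝ) < δ := by rw [hN]; push_cast; exact hn
  -- a starting time that keeps the subdivision points off the crossings
  have hbad : (⋃ i ∈ Finset.range (N + 1), (fun x : ℝ => x - i / N) '' P).Finite :=
    (Finset.finite_toSet _).biUnion fun i _ => hPf.image _
  obtain ⟨x, hx, hxb⟩ := (Ioo_infinite (zero_lt_one' ℝ)).exists_notMem_finite hbad
  have hmem : ∀ i ≤ N, x + i / N ∈ Icc (0 : ℝ) 2 := by
    intro i hi
    have h1 : (i : ℝ) / N ≤ 1 := (div_le_one hNpos).2 (by exact_mod_cast hi)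
    have h2 : (0 : ℝ) ≤ i / N := by positivity
    exact ⟨by linarith [hx.1], by linarith [hx.2]⟩
  have hstep : ∀ i : ℕ, x + ((i + 1 : ℕ) : ℝ) / N = x + i / N + 1 / N := fun i => by
    push_cast; ring
  have hcov : ∀ i, ∃ t, i < N → Icc (x + i / N) (x + ((i + 1 : ℕ) : ℝ) / N) ⊆ U t := by
    intro i
    by_cases hi : i < N
    · obtain ⟨t, ht⟩ := hleb _ (hmem i hi.le)
      refine ⟨t, fun _ y hy => ht ?_⟩
      rw [hstep] at hy
      rw [Metric.mem_ball, Real.dist_eq, abs_lt]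
      exact ⟨by linarith [hy.1], by linarith [hy.2]⟩
    · exact ⟨0, fun h => absurd h hi⟩
  choose c hc using hcov
  refine ⟨fun i => x + i / N, N, fun i => E (α (c i)), ?_, ?_, ?_, ?_, ?_⟩
  · intro i j hij
    have : (i : ℝ) ≤ j := by exact_mod_cast hij
    simp only
    gcongr
  · simp [hNpos.ne']
  · exact fun i hi t ht => (hc i hi ht).1
  · intro i hi hr
    refine hxb (mem_iUnion₂.2 ⟨i, Finset.mem_range.2 (by omega), x + i / N, ⟨hmem i hi, hr⟩, ?_⟩)
    simp
  · intro i hi t ht t' ht' hr hr'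
    have h02 : ∀ y ∈ Icc (x + (i : ℝ) / N) (x + ((i + 1 : ℕ) : ℝ) / N), y ∈ Icc (0 : ℝ) 2 :=
      fun y hy => ⟨(hmem i hi.le).1.trans hy.1, hy.2.trans (hmem (i + 1) hi).2⟩
    have key : ∀ y ∈ Icc (x + (i : ℝ) / N) (x + ((i + 1 : ℕ) : ℝ) / N),
        α y ∈ range β → y = c i := by
      intro y hy hyr
      by_contra hne
      exact (hc i hi hy).2 ⟨⟨h02 y hy, hyr⟩, hne⟩
    rw [key t ht hr, key t' ht' hr']

end

/-! ### Invariance of the signed count of crossings -/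

section

variable {S : Type u} [TopologicalSpace S] [ChartedSpace (EuclideanSpace ℝ (Fin 2)) S]
  [IsManifold (𝓡 2) ∞ S] [OrientedAtlas S] [T2Space S]

theorem ClosedCurve.Transverse.eventually_notMem_range {α β : ClosedCurve S} (hT : α.Transverse β)
    (τ : ℝ) : ∀ᶠ t in 𝓝[≠] τ, β t ∉ range α := by
  have h1 : ({t | t ∈ Icc (τ - 1) (τ + 1) ∧ β t ∈ range α} \ {τ})ᶜ ∈ 𝓝 τ :=
    ((hT.finite_right _ _).subset sdiff_subset).isClosed.isOpen_compl.mem_nhds (by simp)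
  filter_upwards [mem_nhdsWithin_of_mem_nhds h1, self_mem_nhdsWithin,
    mem_nhdsWithin_of_mem_nhds (Icc_mem_nhds (by linarith : τ - 1 < τ) (by linarith : τ < τ + 1))]
    with t ht hne hmem hr
  exact ht ⟨⟨hmem, hr⟩, hne⟩

variable [CompactSpace S]

/-- For transverse curves `α`, `β` there is a map `g` from the surface to the punctured plane whose
degree along `β` is minus the signed number of crossings. Up to exponentials and off a finite set,
it depends only on the homology class of `α`. -/
theorem exists_dual_map (S : Type u) [TopologicalSpace S]
    [ChartedSpace (EuclideanSpace ℝ (Fin 2)) S] [T2Space S] [CompactSpace S]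
    [IsManifold (𝓡 2) ∞ S] [OrientedAtlas S] :
    ∃ Φ : H1 S → (S → ℂ) ⧸ expTrivial S, ∀ α β : ClosedCurve S, α.Transverse β →
      ∃ (Λ g ℓ : S → ℂ) (F : Set S), Φ α.homologyClass = Λ ∧ F.Finite ∧ Continuous g ∧
        (∀ w, g w ≠ 0) ∧ (∀ w ∉ F, ContinuousAt ℓ w ∧ g w = Complex.exp (Λ w - ℓ w)) ∧
        ∀ L : ℝ → ℂ, Continuous L → (∀ t, Complex.exp (L t) = g (β t)) →
          L 1 - L 0 = -(2 * Real.pi * Complex.I * (α.signedCount β (Ico 0 1) : ℤ)) := by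
  classical
  obtain ⟨Φ, hΦ⟩ := exists_dual_class S
  refine ⟨Φ, fun α β hT => ?_⟩
  obtain ⟨s, N, d, hs, hsN, hd, hsβ, hone⟩ := hT.exists_subdivision
  have hle : ∀ i, s i ≤ s (i + 1) := fun i => hs (Nat.le_succ i)
  have hl : ∀ i < N, α (s i) ∈ (d i).core := fun i hi => hd i hi _ (left_mem_Icc.2 (hle i))
  have hr : ∀ i < N, α (s (i + 1)) ∈ (d i).core := fun i hi => hd i hi _ (right_mem_Icc.2 (hle i))
  set Λ : S → ℂ := ∑ i ∈ Finset.range N, (d i).lam (α (s i)) (α (s (i + 1))) with hΛ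
  have hexpΛ : ∀ w, Complex.exp (Λ w) =
      ∏ i ∈ Finset.range N, Complex.exp ((d i).lam (α (s i)) (α (s (i + 1))) w) := fun w => by
    rw [hΛ, Finset.sum_apply, Complex.exp_sum]
  set F : Set S := (fun i => α (s i)) '' Iic N with hF
  have hFf : F.Finite := (finite_Iic N).image _
  have hc : ∀ w ∉ F, ContinuousAt (fun v => Complex.exp (Λ v)) w := by
    intro w hw
    simp only [hexpΛ]
    refine tendsto_finsetProd _ fun i hi => ?_
    rw [Finset.mem_range] at hi
    exact Disc.continuousAt_exp_lam (hl i hi) (hr i hi)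
      (fun h => hw ⟨i, hi.le, h.symm⟩) (fun h => hw ⟨i + 1, hi, h.symm⟩)
  have hlog : ∀ w ∈ F, ∃ m : S → ℂ, ∀ᶠ v in 𝓝[≠] w,
      ContinuousAt m v ∧ Complex.exp (Λ v) = Complex.exp (m v) := by
    intro w _
    have h1 := HasOrder.prod (Finset.range N) fun i hi =>
      Disc.hasOrder_exp_lam (hl i (Finset.mem_range.1 hi)) (hr i (Finset.mem_range.1 hi)) w
    -- zeros and poles cancel along the closed curve
    rw [Finset.sum_range_sub (fun i => if α (s i) = w then (1 : ℤ) else 0), hsN,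
      show α (s 0 + 1) = α (s 0) from α.periodic _, sub_self] at h1
    obtain ⟨m, hm⟩ := h1
    refine ⟨m, hm.mono fun v hv => ⟨hv.1, ?_⟩⟩
    rw [hexpΛ]
    exact hv.2.trans (by rw [zpow_zero, one_mul])
  obtain ⟨g, ℓ, hg, hg0, hgℓ⟩ := exists_continuous_nonvanishing hFf hc hlog
  refine ⟨Λ, g, ℓ, F, hΦ α s N d hs hsN hd, hFf, hg, hg0, hgℓ, fun L hL hLg => ?_⟩
  have hβF : ∀ t, β t ∉ F := by
    rintro t ⟨i, hi, h⟩
    exact hsβ i hi ⟨t, h.symm⟩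
  -- two logarithms of `exp ∘ Λ` along `β`: one is continuous, the other one is periodic
  set L' : ℝ → ℂ := fun t => L t + ℓ (β t) with hL'
  have hL'c : Continuous L' := hL.add (continuous_iff_continuousAt.2 fun t =>
    ContinuousAt.comp (f := β.toFun) (hgℓ _ (hβF t)).1 β.continuous.continuousAt)
  set M : ℝ → ℂ := fun t => ∑ i ∈ Finset.range N, (d i).arcVar α (s i) (s (i + 1)) (β t) with hM
  have hβ1 : ∀ t, β (t + 1) = β t := β.periodic
  have key := sub_eq_neg_finsum_of_jumps (L := L') (M := M) (J := fun t => α.signedCount β {t})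
    hL'c (fun t => by simp only [hM, hβ1]) hT.finite_support (α.periodic_signedCount β) ?_ ?_
  · rw [hT.signedCount_eq_finsum Ico_subset_Icc_self, ← key]
    have h1 := hβ1 0
    rw [zero_add] at h1
    simp only [hL', h1]
    ring
  · intro τ
    filter_upwards [hT.eventually_notMem_range τ] with t ht
    rw [hL', Complex.exp_add, hLg, (hgℓ _ (hβF t)).2, ← Complex.exp_add, sub_add_cancel, hexpΛ, hM,
      Complex.exp_sum]
    refine Finset.prod_congr rfl fun i hi => (Disc.exp_arcVar (hle i)
      (hd i (Finset.mem_range.1 hi)) fun r _ h => ht ⟨r, h⟩).symm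
  · intro τ
    have hj : ∀ i, ∃ l r : ℂ, i < N →
        Tendsto (fun t => (d i).arcVar α (s i) (s (i + 1)) (β t)) (𝓝[<] τ) (𝓝 l) ∧
        Tendsto (fun t => (d i).arcVar α (s i) (s (i + 1)) (β t)) (𝓝[>] τ) (𝓝 r) ∧
        r - l = 2 * Real.pi * Complex.I *
          (∑ᶠ r ∈ Ico (s i) (s (i + 1)), α.crossingSign β τ r : ℤ) := by
      intro i
      by_cases hi : i < N
      · obtain ⟨l, r, h⟩ := Disc.exists_arcVar_jump hT (hle i) (hd i hi) (hsβ i hi.le)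
          (hsβ (i + 1) hi) (hone i hi) τ
        exact ⟨l, r, fun _ => h⟩
      · exact ⟨0, 0, fun h => absurd h hi⟩
    choose l r hlr using hj
    refine ⟨∑ i ∈ Finset.range N, l i, ∑ i ∈ Finset.range N, r i,
      tendsto_finsetSum _ fun i hi => (hlr i (Finset.mem_range.1 hi)).1,
      tendsto_finsetSum _ fun i hi => (hlr i (Finset.mem_range.1 hi)).2.1, ?_⟩
    rw [← Finset.sum_sub_distrib, Finset.sum_congr rfl fun i hi =>
      (hlr i (Finset.mem_range.1 hi)).2.2, ← Finset.mul_sum, ← Int.cast_sum,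
      sum_finsum_Ico (hT.finite_support_crossingSign τ) hs, hsN,
      finsum_Ico_period (hT.finite_support_crossingSign τ) (α.periodic_crossingSign β τ),
      ClosedCurve.signedCount_singleton]

/-- The signed number of crossings of transverse curves depends only on their classes in `H₁`. -/
theorem ClosedCurve.Transverse.signedCount_eq {α β α' β' : ClosedCurve S} (hT : α.Transverse β)
    (hT' : α'.Transverse β') (hα : α.homologyClass = α'.homologyClass)
    (hβ : β.homologyClass = β'.homologyClass) :
    α.signedCount β (Ico 0 1) = α'.signedCount β' (Ico 0 1) := by
  obtain ⟨Φ, hΦ⟩ := exists_dual_map S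
  obtain ⟨Λ, g, ℓ, F, hΛ, hF, hg, hg0, hgℓ, hcount⟩ := hΦ α β hT
  obtain ⟨Λ', g', ℓ', F', hΛ', hF', hg', hg0', hgℓ', hcount'⟩ := hΦ α' β' hT'
  -- the quotient of the two dual maps has a continuous logarithm
  have hmem : Λ - Λ' ∈ expTrivial S := by
    rw [← QuotientAddGroup.eq_iff_sub_mem, ← hΛ, ← hΛ', hα]
  obtain ⟨F₀, hF₀, m, hm⟩ := hmem
  obtain ⟨Q, hQ, hQe⟩ := exists_continuous_log_of_finite (h := fun w => g w / g' w)
    (ℓ := fun w => m w - ℓ w + ℓ' w) ((hF.union hF').union hF₀) (hg.div hg' hg0')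
    (fun w => div_ne_zero (hg0 w) (hg0' w)) (fun w hw => by
      simp only [mem_union, not_or] at hw
      obtain ⟨⟨h1, h2⟩, h3⟩ := hw
      refine ⟨((hm w h3).1.sub (hgℓ w h1).1).add (hgℓ' w h2).1, ?_⟩
      rw [(hgℓ w h1).2, (hgℓ' w h2).2, Complex.exp_add, Complex.exp_sub (m w), ← (hm w h3).2,
        ← Complex.exp_sub, ← Complex.exp_sub, ← Complex.exp_add, Pi.sub_apply]
      congr 1
      ring)
  obtain ⟨ψ, hψ⟩ := exists_degree_onHomology hg hg0
  have hloop : ∀ (δ : ClosedCurve S) (L : ℝ → ℂ), Continuous L →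
      (∀ t, Complex.exp (L t) = g (δ t)) → ψ δ.homologyClass = L 1 - L 0 := by
    intro δ L hL hLg
    refine (hψ _ (fun t => L t) (hL.comp continuous_subtype_val) fun t => ?_).trans (by simp)
    rw [ClosedCurve.restrict_zero_one, hLg]
  obtain ⟨L, hL, hLg⟩ := exists_continuous_log_real (hg.comp β.continuous) fun t => hg0 _
  obtain ⟨L', hL', hLg'⟩ := exists_continuous_log_real (hg'.comp β'.continuous) fun t => hg0' _
  have h1 := hloop β L hL hLg
  have h2 := hloop β' (fun t => L' t + Q (β' t)) (hL'.add (hQ.comp β'.continuous)) fun t => by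
    rw [Complex.exp_add, hLg', hQe, Function.comp, mul_div_cancel₀ _ (hg0' _)]
  have h3 : β' 1 = β' 0 := by
    have : β' (0 + 1) = β' 0 := β'.periodic 0
    rwa [zero_add] at this
  rw [hcount L hL hLg] at h1
  simp only [h3, add_sub_add_right_eq_sub] at h2
  rw [hcount' L' hL' hLg', ← hβ, h1, neg_inj] at h2
  have h4 := mul_left_cancel₀ (by simp [Real.pi_ne_zero]) h2
  exact_mod_cast h4

theorem intersectionNumber_eq {α β : ClosedCurve S} (hT : α.Transverse β) {a b : H1 S}
    (ha : α.homologyClass = a) (hb : β.homologyClass = b) :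
    intersectionNumber a b = α.signedCount β (Ico 0 1) := by
  have h : ∃ n, IsIntersectionNumber a b n := ⟨_, α, β, ha, hb, hT, rfl⟩
  rw [intersectionNumber, dif_pos h]
  obtain ⟨α', β', ha', hb', hT', hn⟩ := h.choose_spec
  rw [← hn]
  exact hT'.signedCount_eq hT (ha'.trans ha.symm) (hb'.trans hb.symm)

end

/-! ### A step function with vanishing derivatives at its ends -/

section

theorem exists_pos_hasDerivAt_expNegInvGlue {x : ℝ} (hx : 0 < x) :
    ∃ c > 0, HasDerivAt expNegInvGlue c x := by
  have h1 : HasDerivAt (fun y : ℝ => Real.exp (-y⁻¹)) (Real.exp (-x⁻¹) * -(-(x ^ 2)⁻¹)) x :=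
    (hasDerivAt_inv hx.ne').fun_neg.exp
  refine ⟨Real.exp (-x⁻¹) * -(-(x ^ 2)⁻¹), by rw [neg_neg]; positivity,
    h1.congr_of_eventuallyEq ?_⟩
  filter_upwards [lt_mem_nhds hx] with y hy
  rw [expNegInvGlue, if_neg (not_le.2 hy)]

theorem exists_pos_hasDerivAt_smoothTransition {x : ℝ} (hx : x ∈ Ioo (0 : ℝ) 1) :
    ∃ c > 0, HasDerivAt Real.smoothTransition c x := by
  obtain ⟨c, hc, h⟩ := exists_pos_hasDerivAt_expNegInvGlue hx.1
  obtain ⟨c', hc', h'⟩ := exists_pos_hasDerivAt_expNegInvGlue (sub_pos.2 hx.2)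
  have h1 : HasDerivAt (fun y => expNegInvGlue (1 - y)) (-c') x := by
    exact (h'.comp x ((hasDerivAt_id x).const_sub 1)).congr_deriv (by ring)
  have hf := expNegInvGlue.pos_of_pos hx.1
  have hf' := expNegInvGlue.pos_of_pos (sub_pos.2 hx.2)
  refine ⟨_, ?_, h.div (h.add h1) (Real.smoothTransition.pos_denom x).ne'⟩
  refine div_pos ?_ (by have := Real.smoothTransition.pos_denom x; positivity)
  have : c * (expNegInvGlue x + expNegInvGlue (1 - x)) - expNegInvGlue x * (c + -c') =
      c * expNegInvGlue (1 - x) + expNegInvGlue x * c' := by ring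
  change 0 < c * (expNegInvGlue x + expNegInvGlue (1 - x)) - expNegInvGlue x * (c + -c')
  rw [this]
  positivity

/-- A smooth monotone step, equal to `0` up to `1/3` and to `1` from `2/3` on. -/
noncomputable def step (t : ℝ) : ℝ := Real.smoothTransition (3 * t - 1)

theorem contDiff_step : ContDiff ℝ ∞ step :=
  Real.smoothTransition.contDiff.comp (by fun_prop)

theorem step_eq_zero {t : ℝ} (h : t ≤ 1 / 3) : step t = 0 :=
  Real.smoothTransition.zero_of_nonpos (by linarith)

theorem step_eq_one {t : ℝ} (h : 2 / 3 ≤ t) : step t = 1 :=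
  Real.smoothTransition.one_of_one_le (by linarith)

theorem step_mem_Ioo {t : ℝ} (h : t ∈ Ioo (1 / 3 : ℝ) (2 / 3)) : step t ∈ Ioo (0 : ℝ) 1 :=
  ⟨Real.smoothTransition.pos_of_pos (by linarith [h.1]),
    Real.smoothTransition.lt_one_of_lt_one (by linarith [h.2])⟩

theorem exists_pos_hasDerivAt_step {t : ℝ} (h : t ∈ Ioo (1 / 3 : ℝ) (2 / 3)) :
    ∃ c > 0, HasDerivAt step c t := by
  obtain ⟨c, hc, hd⟩ := exists_pos_hasDerivAt_smoothTransition (x := 3 * t - 1)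
    ⟨by linarith [h.1], by linarith [h.2]⟩
  have h1 : HasDerivAt (fun s : ℝ => 3 * s - 1) 3 t := by
    simpa using ((hasDerivAt_id t).const_mul 3).sub_const 1
  exact ⟨c * 3, by positivity, hd.comp t h1⟩

theorem strictMonoOn_step : StrictMonoOn step (Icc (1 / 3) (2 / 3)) := by
  refine strictMonoOn_of_deriv_pos (convex_Icc _ _) contDiff_step.continuous.continuousOn
    fun t ht => ?_
  rw [interior_Icc] at ht
  obtain ⟨c, hc, h⟩ := exists_pos_hasDerivAt_step ht
  rwa [h.deriv]

/-! ### Rounding the corner of a piece of a curve -/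

theorem orientationSign_smul {c : ℝ} (hc : 0 < c) (v w : EuclideanSpace ℝ (Fin 2)) :
    orientationSign v (c • w) = orientationSign v w := by
  unfold orientationSign
  rw [show v 0 * (c • w) 1 - v 1 * (c • w) 0 = c * (v 0 * w 1 - v 1 * w 0) by
    simp only [PiLp.smul_apply, smul_eq_mul]; ring, sign_mul, sign_pos hc, one_mul]

variable {S : Type u} [TopologicalSpace S] [ChartedSpace (EuclideanSpace ℝ (Fin 2)) S]

namespace ClosedCurve

theorem velocity_comp {α δ : ClosedCurve S} {φ : ℝ → ℝ} {t c : ℝ} (hφ : HasDerivAt φ c t)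
    (h : δ.toFun =ᶠ[𝓝 t] α.toFun ∘ φ) : δ.velocity t = c • α.velocity (φ t) := by
  have h1 : MDifferentiableAt 𝓘(ℝ, ℝ) (𝓡 2) α.toFun (φ t) := α.smooth.mdifferentiableAt (by simp)
  have h3 := ((h1.hasMFDerivAt.comp t hφ.hasFDerivAt.hasMFDerivAt).congr_of_eventuallyEq h).mfderiv
  unfold velocity
  rw [h3]
  have key : ∀ A : ℝ →L[ℝ] EuclideanSpace ℝ (Fin 2),
      (A ∘L ContinuousLinearMap.toSpanSingleton ℝ c) 1 = c • A 1 := fun A => by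
    rw [ContinuousLinearMap.comp_apply, ContinuousLinearMap.toSpanSingleton_apply, one_smul,
      ← map_smul, smul_eq_mul, mul_one]
  exact key _

/-- Around `[n, n + 1]`, the fractional part can be replaced by `t - n`: the step is locally
constant where the two differ. -/
theorem apply_fract_step {α : ClosedCurve S} {a b : ℝ} (h : α a = α b) (n : ℤ) {t : ℝ}
    (ht : t ∈ Ioo (n - 1 / 3 : ℝ) (n + 4 / 3)) :
    α (a + (b - a) * step (Int.fract t)) = α (a + (b - a) * step (t - n)) := by
  rcases lt_or_ge t n with h1 | h1
  · have hf : Int.fract t = t - (n - 1 : ℤ) := by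
      rw [Int.fract_eq_iff]
      exact ⟨by push_cast; linarith [ht.1], by push_cast; linarith, n - 1, by ring⟩
    rw [hf, step_eq_one (by push_cast; linarith [ht.1]), step_eq_zero (by linarith)]
    simpa using h.symm
  rcases lt_or_ge t (n + 1) with h2 | h2
  · have hf : Int.fract t = t - n := by
      rw [Int.fract_eq_iff]
      exact ⟨by linarith, by linarith, n, by ring⟩
    rw [hf]
  · have hf : Int.fract t = t - (n + 1 : ℤ) := by
      rw [Int.fract_eq_iff]
      exact ⟨by push_cast; linarith, by push_cast; linarith [ht.2], n + 1, by ring⟩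
    rw [hf, step_eq_zero (by push_cast; linarith [ht.2]), step_eq_one (by linarith)]
    simpa using h

theorem eventually_apply_fract_step {α : ClosedCurve S} {a b : ℝ} (h : α a = α b) (t : ℝ) :
    ∀ᶠ s in 𝓝 t, α (a + (b - a) * step (Int.fract s)) = α (a + (b - a) * step (s - ⌊t⌋)) := by
  filter_upwards [Ioo_mem_nhds (a := (⌊t⌋ - 1 / 3 : ℝ)) (b := ⌊t⌋ + 4 / 3)
    (by linarith [Int.floor_le t]) (by linarith [Int.lt_floor_add_one t])] with s hs
  exact apply_fract_step h _ hs

/-- The piece of a closed curve between two times at which it is at the same point,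
reparametrized to a smooth closed curve that rests at that point for a while, so that the corner
there does no harm to smoothness. -/
noncomputable def corner (α : ClosedCurve S) (a b : ℝ) (h : α a = α b) : ClosedCurve S where
  toFun t := α (a + (b - a) * step (Int.fract t))
  smooth t := by
    have h1 : ContMDiff 𝓘(ℝ, ℝ) 𝓘(ℝ, ℝ) ∞ fun s : ℝ => a + (b - a) * step (s - ⌊t⌋) := by
      rw [contMDiff_iff_contDiff]
      have := contDiff_step
      fun_prop
    exact (α.smooth.comp h1).contMDiffAt.congr_of_eventuallyEq (eventually_apply_fract_step h t)
  periodic t := by simp only [Int.fract_add_one]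

variable {α γ : ClosedCurve S} {a b : ℝ} (h : α a = α b)

theorem corner_apply (t : ℝ) : α.corner a b h t = α (a + (b - a) * step (Int.fract t)) := rfl

theorem homologyClass_corner :
    (α.corner a b h).homologyClass = (α.restrict a b h).homologyClass := by
  symm
  refine Loop.homologyClass_reparam (c := fun s => α (a + (b - a) * s))
    (α.continuous.comp (by fun_prop)) contDiff_step.continuous (step_eq_zero (by norm_num))
    (step_eq_one (by norm_num)) _ _ (fun t => rfl) fun t => ?_
  rw [restrict_zero_one, corner_apply, apply_fract_step h 0]
  · simp
  · exact ⟨by norm_num; linarith [t.2.1], by norm_num; linarith [t.2.2]⟩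

/-- The rounded curve leaves its base point only in the middle third of each period. -/
theorem fract_mem_of_corner_ne {t : ℝ} (ht : α.corner a b h t ≠ α a) :
    Int.fract t ∈ Ioo (1 / 3 : ℝ) (2 / 3) := by
  rw [corner_apply] at ht
  constructor
  · by_contra! hc
    rw [step_eq_zero hc] at ht
    simp at ht
  · by_contra! hc
    rw [step_eq_one hc] at ht
    simp [h] at ht

theorem exists_velocity_corner (hab : a < b) {t : ℝ} (ht : Int.fract t ∈ Ioo (1 / 3 : ℝ) (2 / 3)) :
    ∃ c : ℝ, 0 < c ∧ (α.corner a b h).velocity t =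
      c • α.velocity (a + (b - a) * step (Int.fract t)) := by
  obtain ⟨c, hc, hd⟩ := exists_pos_hasDerivAt_step ht
  have h1 : HasDerivAt (fun s : ℝ => a + (b - a) * step (s - ⌊t⌋)) ((b - a) * c) t := by
    have h2 : HasDerivAt (fun s : ℝ => s - ⌊t⌋) 1 t := (hasDerivAt_id t).sub_const _
    have hd' : HasDerivAt step c (t - ⌊t⌋) := hd
    exact (((hd'.comp t h2).const_mul (b - a)).const_add a).congr_deriv (by rw [mul_one])
  exact ⟨(b - a) * c, mul_pos (sub_pos.2 hab) hc,
    velocity_comp (α := α) (δ := α.corner a b h) h1 (eventually_apply_fract_step h t)⟩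

theorem Transverse.corner (hT : γ.Transverse α) (hab : a < b) (ha : α a ∉ range γ) :
    γ.Transverse (α.corner a b h) := by
  intro s t hst
  have ht := fract_mem_of_corner_ne h (t := t) fun h' => ha ⟨s, hst.trans h'⟩
  obtain ⟨c, hc, hv⟩ := exists_velocity_corner h hab ht
  have h1 := hT s _ hst
  rw [hv]
  rw [LinearIndependent.pair_iff] at h1 ⊢
  intro x y hxy
  rw [smul_smul] at hxy
  obtain ⟨hx, hy⟩ := h1 x (y * c) hxy
  exact ⟨hx, (mul_eq_zero.1 hy).resolve_right hc.ne'⟩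

theorem signedCount_corner (hab : a < b) (ha : α a ∉ range γ) :
    γ.signedCount (α.corner a b h) (Ico 0 1) = γ.signedCount α (Ioo a b) := by
  have hba := sub_pos.2 hab
  have hfr : ∀ t ∈ Ico (0 : ℝ) 1, Int.fract t = t := fun t ht => Int.fract_eq_self.2 ht
  have hne : ∀ s t, γ s = α.corner a b h t → Int.fract t ∈ Ioo (1 / 3 : ℝ) (2 / 3) := fun s t hst =>
    fract_mem_of_corner_ne h fun h' => ha ⟨s, hst.trans h'⟩
  refine finsum_mem_eq_of_bijOn (fun p => (p.1, a + (b - a) * step p.2)) ⟨?_, ?_, ?_⟩ ?_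
  · rintro ⟨s, t⟩ ⟨h1, h2, h3⟩
    have h4 := hne s t h3
    simp only at h1 h2 h3 h4
    rw [corner_apply, hfr t h2] at h3
    rw [hfr t h2] at h4
    have h5 := step_mem_Ioo h4
    exact ⟨h1, ⟨by nlinarith [h5.1], by nlinarith [h5.2]⟩, h3⟩
  · rintro ⟨s, t⟩ ⟨h1, h2, h3⟩ ⟨s', t'⟩ ⟨h1', h2', h3'⟩ e
    have h4 := hne s t h3
    have h4' := hne s' t' h3'
    simp only at h2 h2' h4 h4'
    rw [hfr t h2] at h4
    rw [hfr t' h2'] at h4'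
    simp only [Prod.mk.injEq, add_right_inj, mul_eq_mul_left_iff, hba.ne', or_false] at e
    exact Prod.ext e.1 (strictMonoOn_step.injOn (Ioo_subset_Icc_self h4) (Ioo_subset_Icc_self h4')
      e.2)
  · rintro ⟨s, r⟩ ⟨h1, h2, h3⟩
    simp only at h1 h2 h3
    have hr : (r - a) / (b - a) ∈ Ioo (step (1 / 3)) (step (2 / 3)) := by
      rw [step_eq_zero le_rfl, step_eq_one le_rfl]
      exact ⟨div_pos (sub_pos.2 h2.1) hba, (div_lt_one hba).2 (by linarith [h2.2])⟩
    obtain ⟨t, ht, e⟩ := intermediate_value_Ioo (by norm_num)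
      contDiff_step.continuous.continuousOn hr
    have ht01 : t ∈ Ico (0 : ℝ) 1 := ⟨by linarith [ht.1], by linarith [ht.2]⟩
    have e' : a + (b - a) * step t = r := by
      rw [e]; field_simp; ring
    refine ⟨(s, t), ⟨h1, ht01, ?_⟩, by simp only [e']⟩
    rw [corner_apply, hfr t ht01, e']
    exact h3
  · rintro ⟨s, t⟩ ⟨h1, h2, h3⟩
    obtain ⟨c, hc, hv⟩ := exists_velocity_corner h hab (hne s t h3)
    simp only at h2 hv ⊢
    rw [hv, hfr t h2, orientationSign_smul hc]

end ClosedCurve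

end

/-! ### Colorings and the chord index -/

section

variable {S : Type u} [TopologicalSpace S] [ChartedSpace (EuclideanSpace ℝ (Fin 2)) S]

theorem ClosedCurve.restrict_congr {α : ClosedCurve S} {a b a' b' : ℝ} (ha : a = a') (hb : b = b')
    (h : α a = α b) (h' : α a' = α b') : α.restrict a b h = α.restrict a' b' h' := by
  subst ha hb
  rfl

namespace KnotDiagram.Crossing

variable {D : KnotDiagram S} (c : D.Crossing)

theorem underTime_lt_nextTime : c.underTime < nextTime c.underTime c.overTime := by
  unfold nextTime
  split_ifs with h
  · exact h
  · linarith [c.overTime_mem.1, c.underTime_mem.2]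

theorem strands_of_writhe_eq_one (h : c.writhe = 1) : c.strands = (c.overTime, c.underTime) := by
  unfold writhe at h
  rw [strands, if_pos (by rw [h]; exact one_pos)]

theorem strands_of_writhe_eq_neg_one (h : c.writhe = -1) :
    c.strands = (c.underTime, c.overTime) := by
  unfold writhe at h
  rw [strands, if_neg (by rw [h]; decide)]

end KnotDiagram.Crossing

variable [IsManifold (𝓡 2) ∞ S] [OrientedAtlas S] [T2Space S]

theorem ClosedCurve.Transverse.signedCount_Ioo {γ α : ClosedCurve S} (hT : γ.Transverse α) {s t : ℝ}
    (hs : α s ∉ range γ) :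
    γ.signedCount α (Ioo s t) = ∑ᶠ r ∈ Ico s t, γ.signedCount α {r} := by
  rw [hT.signedCount_eq_finsum Ioo_subset_Icc_self]
  refine finsum_mem_inter_support_eq' _ _ _ fun r hr => ⟨fun h => Ioo_subset_Ico_self h, fun h =>
    ⟨lt_of_le_of_ne h.1 ?_, h.2⟩⟩
  rintro rfl
  refine hr (signedCount_eq_zero fun r' hr' => ?_)
  rw [mem_singleton_iff] at hr'
  rwa [hr']

/-- A coloring exists as soon as the signed number of crossings over a period vanishes. -/
theorem KnotDiagram.exists_isColoring {D : KnotDiagram S} {γ : ClosedCurve S}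
    (hT : γ.Transverse D.toClosedCurve) (h0 : γ.signedCount D.toClosedCurve (Ico 0 1) = 0) :
    ∃ col, D.IsColoring γ col := by
  obtain ⟨N, hN⟩ := exists_primitive_finsum_Ico hT.finite_support
  refine ⟨N, fun t _ => ?_, fun s t hst hs _ => ?_⟩
  · have h1 := hN t (t + 1) (by linarith)
    rw [finsum_Ico_period hT.finite_support (γ.periodic_signedCount _),
      ← hT.signedCount_eq_finsum Ico_subset_Icc_self, h0] at h1
    exact sub_eq_zero.1 h1
  · rw [hT.signedCount_Ioo hs, ← hN s t hst.le]
    ring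

namespace KnotDiagram.Crossing

variable {D : KnotDiagram S} (c : D.Crossing) {γ : ClosedCurve S}

/-- The chord index is the signed number of crossings met from the under-passage to the next
over-passage. -/
theorem chordIndex_eq (hT : γ.Transverse D.toClosedCurve)
    (h0 : γ.signedCount D.toClosedCurve (Ico 0 1) = 0) (hγ : D c.overTime ∉ range γ) :
    c.chordIndex γ =
      γ.signedCount D.toClosedCurve (Ioo c.underTime (nextTime c.underTime c.overTime)) := by
  have hex := exists_isColoring hT h0
  rw [chordIndex, dif_pos hex]
  obtain ⟨h1, h2⟩ := hex.choose_spec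
  have h3 := h2 c.underTime (nextTime c.underTime c.overTime) c.underTime_lt_nextTime (c.meet ▸ hγ)
    (by rwa [apply_nextTime])
  have h4 : hex.choose (nextTime c.underTime c.overTime) = hex.choose c.overTime := by
    unfold nextTime
    split_ifs
    · rfl
    · exact h1 _ hγ
  rw [← h4, h3, add_sub_cancel_left]

/-- The intersection number with the part of the diagram from the under-passage to the next
over-passage. -/
theorem intersectionNumber_restrict [CompactSpace S] (hT : γ.Transverse D.toClosedCurve)
    (hγ : D c.overTime ∉ range γ)
    (h : D c.underTime = D (nextTime c.underTime c.overTime)) :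
    intersectionNumber γ.homologyClass
        (D.restrict c.underTime (nextTime c.underTime c.overTime) h).homologyClass =
      γ.signedCount D.toClosedCurve (Ioo c.underTime (nextTime c.underTime c.overTime)) := by
  have hlt := c.underTime_lt_nextTime
  have hu : D c.underTime ∉ range γ := c.meet ▸ hγ
  rw [intersectionNumber_eq (hT.corner h hlt hu) rfl (ClosedCurve.homologyClass_corner h),
    ClosedCurve.signedCount_corner h hlt hu]

end KnotDiagram.Crossing

end

end SurfaceKnot

theorem lemma2p3 {S : Type*} [TopologicalSpace S] [T2Space S] [CompactSpace S] [ConnectedSpace S]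
    [ChartedSpace (EuclideanSpace ℝ (Fin 2)) S] [IsManifold (𝓡 2) ∞ S] [SurfaceKnot.OrientedAtlas S]
    (D : SurfaceKnot.KnotDiagram S) (c : D.Crossing) (γ : SurfaceKnot.ClosedCurve S)
    (hγD : γ.Transverse D.toClosedCurve) (hγc : D c.overTime ∉ Set.range γ)
    (h0 : SurfaceKnot.intersectionNumber γ.homologyClass D.homologyClass = 0) :
    (c.writhe = 1 → c.chordIndex γ =
      SurfaceKnot.intersectionNumber γ.homologyClass c.smoothRight.homologyClass) ∧
    (c.writhe = -1 → c.chordIndex γ =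
      SurfaceKnot.intersectionNumber γ.homologyClass c.smoothLeft.homologyClass) := by
  have hcount : γ.signedCount D.toClosedCurve (Set.Ico 0 1) = 0 := by
    rw [← SurfaceKnot.intersectionNumber_eq hγD rfl rfl]
    exact h0
  have hmeet : D c.underTime =
      D (SurfaceKnot.KnotDiagram.Crossing.nextTime c.underTime c.overTime) :=
    c.meet.symm.trans (SurfaceKnot.KnotDiagram.Crossing.apply_nextTime D _ _).symm
  have hmain := (c.chordIndex_eq hγD hcount hγc).trans
    (c.intersectionNumber_restrict hγD hγc hmeet).symm
  -- in both cases the smoothed curve runs from the under-passage to the next over-passage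
  refine ⟨fun hw => ?_, fun hw => ?_⟩
  · have hs := c.strands_of_writhe_eq_one hw
    exact hmain.trans (congrArg (fun L : SurfaceKnot.Loop S =>
      SurfaceKnot.intersectionNumber γ.homologyClass L.homologyClass)
      (SurfaceKnot.ClosedCurve.restrict_congr (by rw [hs]) (by rw [hs]) hmeet _))
  · have hs := c.strands_of_writhe_eq_neg_one hw
    exact hmain.trans (congrArg (fun L : SurfaceKnot.Loop S =>
      SurfaceKnot.intersectionNumber γ.homologyClass L.homologyClass)
      (SurfaceKnot.ClosedCurve.restrict_congr (by rw [hs]) (by rw [hs]) hmeet _))
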